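/- Let $M$ be a complex manifold of dimension $n$ and let $E=\bigcup_{i\in I}E_i$ ($I$ finite) be a strong normal crossings divisor on $M$: locally at each point, $E$ is a union of coordinate hyperplanes, one for each component $E_i$ through the point, and for every $J\subset I$ the set $E_J=\bigcap_{j\in J}E_j$ is connected (possibly empty). Let $\mathcal F$ be a codimension one holomorphic foliation on $M$, that is, a subsheaf of $\Omega^1_M$ locally generated by one Frobenius integrable holomorphic one-form whose coefficients have no common factor. For $p\in M$ let $J_p=\{i\in I: p\in E_i\}$. Coordinates $(\mathbf x,\mathbf y)$ centred at $p$, with $\mathbf x=(x_j)_{j\in J_p}$ and $\mathbf y=(y_j)_{j\in c}$ (where $c$ is an index set disjoint from $J_p$ with $\#(J_p\cup c)=n$), are *adapted* if $E_j=(x_j=0)$ near $p$ for all $j\in J_p$. A *logarithmic generator* of $\mathcal F$ at $p$ is a form $$\eta=\sum_{j\in J_p}a_j\frac{dx_j}{x_j}+\sum_{j\in c}a_j\,dy_j ,$$ with $a_j$ holomorphic and without common factor, that defines $\mathcal F$ near $p$. Write $a_j=\sum_{\sigma\in\mathbb Z_{\ge0}^{J_p}}a_{j,\sigma}(\mathbf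 y)\,\mathbf x^\sigma$, let the support of $\eta$ be the set of $\sigma$ such that some $a_{j,\sigma}$ is not identically zero, and let the Newton polyhedron $N$ be the convex hull of $\operatorname{Supp}(\eta)+\mathbb R_{\ge0}^{J_p}$. A *vector of weights* is a linear form $\rho:\mathbb R^{J_p}\to\mathbb R$ that is positive on the non-zero vectors of $\mathbb R_{\ge0}^{J_p}$; put $\nu_\rho=\min\{\rho(\sigma):\sigma\in\operatorname{Supp}(\eta)\}$ and $$A_j(\mathbf T)=\sum_{\rho(\sigma)=\nu_\rho}a_{j,\sigma}(0)\,\mathbf T^\sigma .$$ The compact faces of $N$ are the sets $N\cap(\rho=\nu_\rho)$. The foliated space $(M,E;\mathcal F)$ is *Newton non-degenerate* if, for every $p\in M$ and every compact face of $N$, for the vectors of weights $\rho$ defining that face the polynomials $A_j$ (for all $j\in J_p\cup c$) have no common zero $\mathbf T\in(\mathbb C\setminus\{0\})^{J_p}$. (The condition does not depend on the adapted coordinates or on $\eta$.) Let $\emptyset\ne J\subset I$, let $\pi:M'\to M$ be the blowing-up with center $E_J$, let $E'=\pi^{-1}(E)$, with components the exceptional divisor $\pi^{-1}(E_J)$ and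 the strict transforms of the $E_i$, and let $\mathcal F'$ be the transform of $\mathcal F$, that is, the foliation on $M'$ locally generated by the pull-back of a local generator of $\mathcal F$ divided by a power of a local equation of the exceptional divisor. Then $(M,E;\mathcal F)$ is Newton non-degenerate if and only if $(M',E';\mathcal F')$ is Newton non-degenerate. -/

import Mathlib

open Set Filter Topology
open scoped Manifold ContDiff LinearAlgebra.Projectivization

noncomputable section

namespace NewtonFoliation

/-! ## Holomorphic one-forms and foliations on an `n`-dimensional complex manifold -/

/-- The maximal holomorphic atlas: local holomorphic coordinate systems of `M`. -/
def coordSystems (n : ℕ) (M : Type*) [TopologicalSpace M] [ChartedSpace (Fin n → ℂ) M] :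
    Set (OpenPartialHomeomorph M (Fin n → ℂ)) :=
  IsManifold.maximalAtlas 𝓘(ℂ, Fin n → ℂ) ω M

/-- Arbitrary (not necessarily holomorphic) fields of complex linear forms on `M`. Holomorphy is
imposed near the points where it is needed. -/
abbrev OneForm (n : ℕ) (M : Type*) [TopologicalSpace M] [ChartedSpace (Fin n → ℂ) M] :=
  (q : M) → (TangentSpace 𝓘(ℂ, Fin n → ℂ) q →L[ℂ] ℂ)

/-- The differential of a function, as a one-form. -/
def differential {n : ℕ} {M : Type*} [TopologicalSpace M] [ChartedSpace (Fin n → ℂ) M]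
    (t : M → ℂ) : OneForm n M :=
  fun q => (mfderiv 𝓘(ℂ, Fin n → ℂ) 𝓘(ℂ, ℂ) t q : TangentSpace 𝓘(ℂ, Fin n → ℂ) q →L[ℂ] ℂ)

/-- The one-form `∑ k, f k dz k`, where `z` is the coordinate system `φ` and the coefficients are
written as functions of the coordinates. -/
def coordForm {n : ℕ} {M : Type*} [TopologicalSpace M] [ChartedSpace (Fin n → ℂ) M]
    (φ : OpenPartialHomeomorph M (Fin n → ℂ)) (f : Fin n → (Fin n → ℂ) → ℂ) : OneForm n M :=
  fun q => ∑ k, f k (φ q) • differential (n := n) (fun r => φ r k) q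

/-- The pull-back of a one-form by a map. -/
def pullback {n : ℕ} {M M' : Type*} [TopologicalSpace M] [ChartedSpace (Fin n → ℂ) M]
    [TopologicalSpace M'] [ChartedSpace (Fin n → ℂ) M'] (π : M' → M) (α : OneForm n M) :
    OneForm n M' :=
  fun q => (α (π q)).comp (mfderiv 𝓘(ℂ, Fin n → ℂ) 𝓘(ℂ, Fin n → ℂ) π q)

/-- The germs at `z` of the functions `f k` have no common factor: every germ of holomorphic
function at `z` that divides all of them is a unit. -/
def NoCommonFactor {n : ℕ} (f : Fin n → (Fin n → ℂ) → ℂ) (z : Fin n → ℂ) : Prop :=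
  ∀ g : (Fin n → ℂ) → ℂ, AnalyticAt ℂ g z →
    (∀ k, ∃ h : (Fin n → ℂ) → ℂ, AnalyticAt ℂ h z ∧ ∀ᶠ w in 𝓝 z, f k w = g w * h w) →
    g z ≠ 0

/-- The partial derivative `∂ g / ∂ z j`. -/
def partialDeriv {n : ℕ} (j : Fin n) (g : (Fin n → ℂ) → ℂ) (z : Fin n → ℂ) : ℂ :=
  fderiv ℂ g z (Pi.single j 1)

/-- Frobenius integrability `α ∧ dα = 0` at `z` of `α = ∑ k, f k dz k`, coefficient by
coefficient. -/
def FrobeniusAt {n : ℕ} (f : Fin n → (Fin n → ℂ) → ℂ) (z : Fin n → ℂ) : Prop :=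
  ∀ i j k : Fin n,
    f i z * (partialDeriv j (f k) z - partialDeriv k (f j) z) +
    f j z * (partialDeriv k (f i) z - partialDeriv i (f k) z) +
    f k z * (partialDeriv i (f j) z - partialDeriv j (f i) z) = 0

/-- A codimension one holomorphic foliation: a subsheaf of the sheaf of holomorphic one-forms,
given by its stalks, which locally is freely generated by one integrable holomorphic one-form
whose coefficients have no common factor. Here `stalk p` is the set of the one-forms whose germ
at `p` belongs to the stalk at `p`. -/
structure Foliation (n : ℕ) (M : Type*) [TopologicalSpace M] [ChartedSpace (Fin n → ℂ) M] where
  stalk : M → Set (OneForm n M)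
  locally_generated : ∀ p : M, ∃ φ ∈ coordSystems n M, p ∈ φ.source ∧
    ∃ f : Fin n → (Fin n → ℂ) → ℂ,
      (∀ k, AnalyticOnNhd ℂ (f k) φ.target) ∧
      (∀ z ∈ φ.target, FrobeniusAt f z) ∧
      (∀ z ∈ φ.target, NoCommonFactor f z) ∧
      ∀ q ∈ φ.source, ∀ β : OneForm n M, β ∈ stalk q ↔
        ∃ g : (Fin n → ℂ) → ℂ, AnalyticAt ℂ g (φ q) ∧
          ∀ᶠ r in 𝓝 q, β r = coordForm φ (fun k z => g z * f k z) r

/-- `α` is a local generator of the foliation at `p`: the stalk at `p` consists of the multiples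
of `α` by germs of holomorphic functions. -/
def Foliation.IsGenerator {n : ℕ} {M : Type*} [TopologicalSpace M] [ChartedSpace (Fin n → ℂ) M]
    (F : Foliation n M) (p : M) (α : OneForm n M) : Prop :=
  ∀ β : OneForm n M, β ∈ F.stalk p ↔
    ∃ h : M → ℂ, ContMDiffAt 𝓘(ℂ, Fin n → ℂ) 𝓘(ℂ, ℂ) ω h p ∧ ∀ᶠ r in 𝓝 p, β r = h r • α r

/-! ## Strong normal crossings divisors -/

/-- The set `E_J`, the intersection of the components `E j` for `j ∈ J`. -/
def stratumClosure {M I : Type*} (E : I → Set M) (J : Set I) : Set M :=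
  {p | ∀ j ∈ J, p ∈ E j}

/-- The index set `J` of the stratum `S_J` that contains `p`. -/
abbrev StratumIndex {M I : Type*} (E : I → Set M) (p : M) := {i : I // p ∈ E i}

/-- A local coordinate system `(x, y)` at `p` adapted to the divisor `⋃ i, E i`. The coordinate
number `idx i` is `x i`: it is an equation of the component `E i` through `p`. The coordinates
whose number is not of the form `idx i` are the `y`'s. -/
structure AdaptedCoords (n : ℕ) {M I : Type*} [TopologicalSpace M] [ChartedSpace (Fin n → ℂ) M]
    (E : I → Set M) (p : M) where
  chart : OpenPartialHomeomorph M (Fin n → ℂ)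
  chart_mem : chart ∈ coordSystems n M
  mem_source : p ∈ chart.source
  chart_center : chart p = 0
  idx : StratumIndex E p ↪ Fin n
  mem_iff : ∀ i : StratumIndex E p, ∀ q ∈ chart.source, q ∈ E i.1 ↔ chart q (idx i) = 0
  not_mem : ∀ i : I, p ∉ E i → ∀ q ∈ chart.source, q ∉ E i

/-- `⋃ i, E i` is a strong normal crossings divisor with components `E i`: locally at each point
it is a union of coordinate hyperplanes, one for each component through the point, and the
intersections of components are connected (possibly empty). -/
structure IsStrongNormalCrossings (n : ℕ) {M I : Type*} [TopologicalSpace M]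
    [ChartedSpace (Fin n → ℂ) M] (E : I → Set M) : Prop where
  exists_adapted : ∀ p : M, Nonempty (AdaptedCoords n E p)
  connected : ∀ J : Set I, J.Nonempty → IsPreconnected (stratumClosure E J)

/-! ## Logarithmic generators and Newton non-degeneracy -/

section LogForms

variable {n : ℕ} {M I : Type*} [TopologicalSpace M] [ChartedSpace (Fin n → ℂ) M]
  {E : I → Set M} {p : M}

open scoped Classical in
/-- The coordinate numbers of the `x`'s. -/
def AdaptedCoords.divisorIdx (c : AdaptedCoords n E p) : Finset (Fin n) :=
  Finset.univ.filter (fun k => k ∈ Set.range c.idx)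

open scoped Classical in
/-- The one-form `(∏ x) • η`, where `η = ∑ a j dx j / x j + ∑ a k dy k` is the logarithmic form
with coefficients `a` in the adapted coordinates `c`. -/
def AdaptedCoords.clearedLogForm (c : AdaptedCoords n E p) (a : Fin n → (Fin n → ℂ) → ℂ) :
    OneForm n M :=
  coordForm c.chart (fun k z => (∏ l ∈ c.divisorIdx.erase k, z l) * a k z)

/-- The logarithmic form `η = ∑ a j dx j / x j + ∑ a k dy k` is a local logarithmic generator of
`F` at `p`: it defines `F` (the form obtained by clearing its denominators is a section
of `F`), and its coefficients have no common factor (in particular they are not all zero). -/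
structure IsLogGenerator (F : Foliation n M) (c : AdaptedCoords n E p)
    (a : Fin n → (Fin n → ℂ) → ℂ) : Prop where
  analytic : ∀ k, AnalyticAt ℂ (a k) 0
  noCommonFactor : NoCommonFactor a 0
  defines : c.clearedLogForm a ∈ F.stalk p

variable [Fintype I]

open scoped Classical in
/-- The monomial `∏ T i ^ σ i`, over the components `i` through the point. -/
def monomialAt (T : StratumIndex E p → ℂ) (σ : StratumIndex E p → ℕ) : ℂ :=
  ∏ i, T i ^ σ i

/-- `a k = ∑ σ, s k σ (y) x ^ σ` for all `k`, on a neighbourhood of the point: the expansion of the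
coefficients in powers of the `x`'s, with coefficients holomorphic in the `y`'s. -/
def IsExpansion (c : AdaptedCoords n E p) (a : Fin n → (Fin n → ℂ) → ℂ)
    (s : Fin n → (StratumIndex E p → ℕ) → (Fin n → ℂ) → ℂ) : Prop :=
  ∃ r > 0, ∀ k,
    (∀ σ, AnalyticOnNhd ℂ (s k σ) (Metric.ball 0 r)) ∧
    (∀ σ z z', (∀ l ∉ Set.range c.idx, z l = z' l) → s k σ z = s k σ z') ∧
    ∀ z ∈ Metric.ball (0 : Fin n → ℂ) r,
      HasSum (fun σ => s k σ z * monomialAt (fun i => z (c.idx i)) σ) (a k z)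

/-- The support of the expansion: the exponents `σ` such that some `s k σ` is a non-zero germ. -/
def expansionSupport (s : Fin n → (StratumIndex E p → ℕ) → (Fin n → ℂ) → ℂ) :
    Set (StratumIndex E p → ℕ) :=
  {σ | ∃ k, ¬ ∀ᶠ z in 𝓝 0, s k σ z = 0}

/-- A vector of weights: a linear form which is positive on the non-zero vectors with
non-negative entries. -/
def IsWeight {S : Type*} (ρ : (S → ℝ) →ₗ[ℝ] ℝ) : Prop :=
  ∀ v : S → ℝ, v ≠ 0 → (∀ i, 0 ≤ v i) → 0 < ρ v

/-- The value `ρ σ` of an exponent `σ`. -/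
def weightOf {S : Type*} (ρ : (S → ℝ) →ₗ[ℝ] ℝ) (σ : S → ℕ) : ℝ := ρ (fun i => (σ i : ℝ))

/-- The `ρ`-value of a logarithmic form with support `Σ`: the minimum of `ρ` on the support. -/
def rhoValue {S : Type*} (ρ : (S → ℝ) →ₗ[ℝ] ℝ) (supp : Set (S → ℕ)) : ℝ :=
  sInf (weightOf ρ '' supp)

/-- The Newton polyhedron: the positively convex hull of the support. -/
def newtonPolyhedron {S : Type*} (supp : Set (S → ℕ)) : Set (S → ℝ) :=
  convexHull ℝ {v | ∃ σ ∈ supp, ∀ i, (σ i : ℝ) ≤ v i}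

/-- The compact face of the Newton polyhedron cut out by the vector of weights `ρ`. -/
def rhoFace {S : Type*} (supp : Set (S → ℕ)) (ρ : (S → ℝ) →ₗ[ℝ] ℝ) : Set (S → ℝ) :=
  {v ∈ newtonPolyhedron supp | ρ v = rhoValue ρ supp}

/-- The compact faces of the Newton polyhedron. -/
def IsCompactFace {S : Type*} (supp : Set (S → ℕ)) (Φ : Set (S → ℝ)) : Prop :=
  ∃ ρ : (S → ℝ) →ₗ[ℝ] ℝ, IsWeight ρ ∧ rhoFace supp ρ = Φ

/-- The component number `k` at the point with coordinates `z` of the `ρ`-initial form: the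
polynomial `∑ s k σ (z) T ^ σ`, the (finite) sum being over the exponents `σ` whose weight is the
`ρ`-value. -/
def initialForm (s : Fin n → (StratumIndex E p → ℕ) → (Fin n → ℂ) → ℂ)
    (ρ : (StratumIndex E p → ℝ) →ₗ[ℝ] ℝ) (k : Fin n) (z : Fin n → ℂ)
    (T : StratumIndex E p → ℂ) : ℂ :=
  ∑ᶠ σ ∈ {σ : StratumIndex E p → ℕ | weightOf ρ σ = rhoValue ρ (expansionSupport s)},
    s k σ z * monomialAt T σ

/-- Non-degeneracy at `p` (whose coordinates are `0`) with respect to the vector of weights `ρ`: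
the components of the `ρ`-initial form have no common zero over `p` in the complex torus. -/
def NondegenerateWrtWeight (s : Fin n → (StratumIndex E p → ℕ) → (Fin n → ℂ) → ℂ)
    (ρ : (StratumIndex E p → ℝ) →ₗ[ℝ] ℝ) : Prop :=
  ¬ ∃ T : StratumIndex E p → ℂ, (∀ i, T i ≠ 0) ∧ ∀ k, initialForm s ρ k 0 T = 0

/-- Non-degeneracy at `p` with respect to a compact face of the Newton polyhedron. -/
def NondegenerateWrtFace (s : Fin n → (StratumIndex E p → ℕ) → (Fin n → ℂ) → ℂ)
    (Φ : Set (StratumIndex E p → ℝ)) : Prop :=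
  ∀ ρ : (StratumIndex E p → ℝ) →ₗ[ℝ] ℝ, IsWeight ρ → rhoFace (expansionSupport s) ρ = Φ →
    NondegenerateWrtWeight s ρ

/-- Newton non-degeneracy at a point, tested in all the adapted coordinate systems and with all
the logarithmic generators (the condition does not depend on them). -/
def NewtonNondegenerateAt (E : I → Set M) (F : Foliation n M) (p : M) : Prop :=
  ∀ (c : AdaptedCoords n E p) (a : Fin n → (Fin n → ℂ) → ℂ)
    (s : Fin n → (StratumIndex E p → ℕ) → (Fin n → ℂ) → ℂ),
    IsLogGenerator F c a → IsExpansion c a s →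
    ∀ Φ, IsCompactFace (expansionSupport s) Φ → NondegenerateWrtFace s Φ

/-- Newton non-degenerate foliated spaces. -/
def NewtonNondegenerate (E : I → Set M) (F : Foliation n M) : Prop :=
  ∀ p : M, NewtonNondegenerateAt E F p

end LogForms

/-! ## Combinatorial blowing-ups -/

section Blowup

variable {n : ℕ} {M M' I : Type*} [TopologicalSpace M] [ChartedSpace (Fin n → ℂ) M]
  [TopologicalSpace M'] [ChartedSpace (Fin n → ℂ) M']

/-- Over the domain `U` of the adapted coordinates `c` at a point `p` of `E_J`, the map `π` is the
blowing-up with center `E_J`. That is, with `x = (x j) j ∈ J`, `π⁻¹ U` is identified over `U` with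
`{(u, L) ∈ U × ℙ(ℂ^J) | x u ∈ L}`, and where the homogeneous coordinate `ξ j₀` of `L = [ξ]` is
not zero, the functions `x j₀`, the quotients `ξ j / ξ j₀` (`j ∈ J`, `j ≠ j₀`) and the remaining
coordinates of `c` form a holomorphic coordinate system. -/
def IsBlowupOver {E : I → Set M} {p : M} (c : AdaptedCoords n E p) (J : Set I)
    (hp : p ∈ stratumClosure E J) (π : M' → M) : Prop :=
  ∃ L : M' → ℙ ℂ (J → ℂ),
    Set.BijOn (fun q => (π q, L q)) (π ⁻¹' c.chart.source)
      {uL : M × ℙ ℂ (J → ℂ) | uL.1 ∈ c.chart.source ∧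
        (fun j : J => c.chart uL.1 (c.idx ⟨j.1, hp j.1 j.2⟩)) ∈ uL.2.submodule} ∧
    ∀ j₀ : J, ∃ ψ ∈ coordSystems n M',
      ψ.source = {q | π q ∈ c.chart.source ∧ (L q).rep j₀ ≠ 0} ∧
      ∀ q ∈ ψ.source,
        ψ q (c.idx ⟨j₀.1, hp j₀.1 j₀.2⟩) = c.chart (π q) (c.idx ⟨j₀.1, hp j₀.1 j₀.2⟩) ∧
        (∀ j : J, j ≠ j₀ → ψ q (c.idx ⟨j.1, hp j.1 j.2⟩) = (L q).rep j / (L q).rep j₀) ∧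
        ∀ k : Fin n, (∀ j : J, k ≠ c.idx ⟨j.1, hp j.1 j.2⟩) → ψ q k = c.chart (π q) k

/-- `π : M' → M` is the blowing-up of `M` with center `E_J`: a holomorphic map, biholomorphic
over the complement of `E_J`, and given by the usual local equations at the points of `E_J`. -/
structure IsCombinatorialBlowup (n : ℕ) {M M' I : Type*} [TopologicalSpace M]
    [ChartedSpace (Fin n → ℂ) M] [TopologicalSpace M'] [ChartedSpace (Fin n → ℂ) M']
    (E : I → Set M) (J : Set I) (π : M' → M) : Prop where
  holomorphic : ContMDiff 𝓘(ℂ, Fin n → ℂ) 𝓘(ℂ, Fin n → ℂ) ω π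
  bijOn_compl : Set.BijOn π (π ⁻¹' (stratumClosure E J)ᶜ) (stratumClosure E J)ᶜ
  localDiffeo_compl : IsLocalDiffeomorphOn 𝓘(ℂ, Fin n → ℂ) 𝓘(ℂ, Fin n → ℂ) ω π
    (π ⁻¹' (stratumClosure E J)ᶜ)
  over_center : ∀ (p : M) (hp : p ∈ stratumClosure E J),
    ∃ c : AdaptedCoords n E p, IsBlowupOver c J hp π

/-- The components of the divisor `E' = π⁻¹ E`: the exceptional divisor `π⁻¹ E_J`, with index
`none` (the index `∞`), and the strict transforms of the components of `E`. -/
def transformDivisor (E : I → Set M) (J : Set I) (π : M' → M) : Option I → Set M'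
  | none => π ⁻¹' stratumClosure E J
  | some i => closure (π ⁻¹' (E i \ stratumClosure E J))

/-- `t` is a reduced local equation at `q` of the hypersurface `H` (a unit, if `q ∉ H`). -/
structure IsLocalEquation (n : ℕ) {M' : Type*} [TopologicalSpace M']
    [ChartedSpace (Fin n → ℂ) M'] (H : Set M') (q : M') (t : M' → ℂ) : Prop where
  holomorphic : ContMDiffAt 𝓘(ℂ, Fin n → ℂ) 𝓘(ℂ, ℂ) ω t q
  zero_iff : ∀ᶠ r in 𝓝 q, r ∈ H ↔ t r = 0
  differential_ne_zero : q ∈ H → differential (n := n) t q ≠ 0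

/-- `F'` is the transform of `F` by the blowing-up `π` with center `E_J`: at each point of `M'` it
is generated by the pull-back of a local generator of `F`, divided by a power of a local equation
of the exceptional divisor. -/
def IsTransform (E : I → Set M) (J : Set I) (π : M' → M) (F : Foliation n M)
    (F' : Foliation n M') : Prop :=
  ∀ (q : M') (α : OneForm n M), F.IsGenerator (π q) α →
    ∃ (t : M' → ℂ) (m : ℕ) (α' : OneForm n M'),
      IsLocalEquation n (π ⁻¹' stratumClosure E J) q t ∧ F'.IsGenerator q α' ∧
      ∀ᶠ r in 𝓝 q, pullback π α r = t r ^ m • α' r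

end Blowup

end NewtonFoliation

end

/-! Newton non-degeneracy is rewritten as a growth condition that changes of coordinates and
blowing-ups cannot affect. Take a generator of the foliation, with coefficients `f k`, and the
vector of its logarithmic coefficients: `z k * f k` for the divisor coordinates and `f k` for the
others. Let `N` be the norm of this vector, fix weights `w ≥ 0` and a point `z₀` whose divisor
coordinates are non-zero, and follow `N` along the curves `t ↦ (t ^ w i * z i)` for `z` near `z₀` as
`t → 0⁺`. The condition `Harnack` says that the values of `N` on two such curves, at the same `t`,
differ by at most a constant factor.

This is non-degeneracy (`harnack_norm_iff`, `IsExpansion.nondegenerate_iff`). If `ν` is the least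
weight that occurs, `t ^ (-ν) * N` tends to the norm of the initial part `P` at `z`. If `P z₀ ≠ 0`,
the limit is positive and the values are comparable. If `P z₀ = 0`, comparability passes to the
limit and forces `P z = 0` for all `z` near `z₀`; by quasi-homogeneity and the identity theorem `P =
0`, against the choice of `ν`.

The condition has three invariances. A factor which is a monomial in the divisor coordinates times a
unit is harmless (`harnack_mon_mul_iff`), so that a logarithmic generator may be replaced by a
generator, and the pull-back need not be divided by a power of the exceptional equation. A change of
logarithmic chart has a bounded logarithmic Jacobian in both directions (`IsLogChart.harnackIn`). A
chart of the blowing-up is a monomial map, under which the forms `dx / x` pull back by a constant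
unipotent matrix (`IsToricChart.harnack_iff`).

It remains to match the curves. A test curve upstairs maps to a test curve downstairs, weights being
added (`TestPair.toric`). A test curve at a point of `E_J` lifts to the chart of the index `j₀ ∈ J`
of least weight, with weights `w j - w j₀ ≥ 0` for `j ∈ J`, `j ≠ j₀` (`IsBlowupOver.exists_lift`).
Where the difference is zero the coordinate has a non-zero limit, so the lift may end away from the
origin of the chart; for this reason logarithmic charts are not centred and a divisor coordinate may
have weight zero. -/

noncomputable section

namespace NewtonFoliation

/-! ## Power series in several variables, indexed by exponents -/

section Series

variable {ι : Type*} [Fintype ι]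

/-- The monomial `∏ z i ^ α i`. -/
def mon (z : ι → ℂ) (α : ι → ℕ) : ℂ := ∏ i, z i ^ α i

lemma mon_zero_right (z : ι → ℂ) : mon z 0 = 1 := by simp [mon]

lemma mon_add (z : ι → ℂ) (α β : ι → ℕ) : mon z (α + β) = mon z α * mon z β := by
  simp [mon, pow_add, Finset.prod_mul_distrib]

lemma mon_single [DecidableEq ι] (z : ι → ℂ) (j : ι) : mon z (Pi.single j 1) = z j := by
  rw [mon, Finset.prod_eq_single j] <;> simp +contextual

lemma norm_mon (z : ι → ℂ) (α : ι → ℕ) : ‖mon z α‖ = ∏ i, ‖z i‖ ^ α i := by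
  simp [mon]

lemma norm_mon_le {z : ι → ℂ} {r : ℝ} (h : ‖z‖ ≤ r) (α : ι → ℕ) :
    ‖mon z α‖ ≤ r ^ (∑ i, α i) := by
  rw [norm_mon, ← Finset.prod_pow_eq_pow_sum]
  exact Finset.prod_le_prod (fun _ _ => by positivity)
    fun i _ => pow_le_pow_left₀ (norm_nonneg _) ((norm_le_pi_norm z i).trans h) _

/-- `f` is the sum of the power series with coefficients `c`, which converges absolutely on the
closed polydisc of radius `r`. -/
structure HasExpansion (f : (ι → ℂ) → ℂ) (c : (ι → ℕ) → ℂ) (r : ℝ) : Prop where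
  pos : 0 < r
  summable : Summable fun α => ‖c α‖ * r ^ (∑ i, α i)
  hasSum : ∀ z, ‖z‖ ≤ r → HasSum (fun α => c α * mon z α) (f z)

lemma summable_mul_mon {c : (ι → ℕ) → ℂ} {r : ℝ}
    (h : Summable fun α => ‖c α‖ * r ^ (∑ i, α i)) {z : ι → ℂ} (hz : ‖z‖ ≤ r) :
    Summable fun α => c α * mon z α :=
  Summable.of_norm_bounded h fun α => by
    rw [norm_mul]; exact mul_le_mul_of_nonneg_left (norm_mon_le hz α) (norm_nonneg _)

lemma HasExpansion.of_summable {c : (ι → ℕ) → ℂ} {r : ℝ} (hr : 0 < r)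
    (h : Summable fun α => ‖c α‖ * r ^ (∑ i, α i)) :
    HasExpansion (fun z => ∑' α, c α * mon z α) c r :=
  ⟨hr, h, fun _ hz => (summable_mul_mon h hz).hasSum⟩

lemma HasExpansion.mono {f : (ι → ℂ) → ℂ} {c : (ι → ℕ) → ℂ} {r r' : ℝ}
    (h : HasExpansion f c r) (hr' : 0 < r') (hle : r' ≤ r) : HasExpansion f c r' :=
  ⟨hr', h.summable.of_nonneg_of_le (fun _ => by positivity) fun α =>
    mul_le_mul_of_nonneg_left (pow_le_pow_left₀ hr'.le hle _) (norm_nonneg _),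
    fun z hz => h.hasSum z (hz.trans hle)⟩

/-- The exponent of the monomial that corresponds to a word. -/
def content [DecidableEq ι] (x : Σ m, Fin m → ι) : ι → ℕ :=
  fun i => (Finset.univ.filter fun l => x.2 l = i).card

lemma mon_content [DecidableEq ι] (z : ι → ℂ) (x : Σ m, Fin m → ι) :
    mon z (content x) = ∏ l, z (x.2 l) := by
  rw [← Finset.prod_fiberwise' (Finset.univ : Finset (Fin x.1)) x.2 z]
  simp [mon, content]

lemma sum_content [DecidableEq ι] (x : Σ m, Fin m → ι) : ∑ i, content x i = x.1 := by
  have := Finset.card_eq_sum_card_fiberwise (s := (Finset.univ : Finset (Fin x.1)))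
    (t := Finset.univ) (f := x.2) (fun _ _ => Finset.mem_coe.2 (Finset.mem_univ _))
  simpa [content] using this.symm

/-- Expanding the `m`-th multilinear term on the standard basis gives one summand for each word of
length `m`; words with the same letters up to order give the same monomial, and the coefficient of a
monomial is the sum over its words. -/
lemma exists_hasExpansion {f : (ι → ℂ) → ℂ} (hf : AnalyticAt ℂ f 0) :
    ∃ c r, HasExpansion f c r := by
  classical
  obtain ⟨p, R, hp⟩ := hf
  -- There are `card ι ^ m` words of length `m`, each with coefficient at most `‖p m‖`, so the
  -- radius is shrunk by at least this factor. The `+ 1` keeps `K` at least one when `ι` is empty.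
  set K : ℝ := Fintype.card ι + 1 with hK
  have hK0 : 0 < K := by positivity
  obtain ⟨r, hr, hrR⟩ : ∃ r : NNReal, 0 < r ∧ ((K.toNNReal * r : NNReal) : ENNReal) < R := by
    obtain ⟨s, hs, hsR⟩ := ENNReal.lt_iff_exists_nnreal_btwn.1 hp.r_pos
    have hs' : 0 < s := by exact_mod_cast hs
    have hK' : 0 < K.toNNReal := Real.toNNReal_pos.2 hK0
    refine ⟨s / K.toNNReal, div_pos hs' hK', ?_⟩
    rwa [mul_div_cancel₀ _ hK'.ne']
  set coef : (Σ m, Fin m → ι) → ℂ := fun x => p x.1 fun l => Pi.single (x.2 l) 1 with hcoef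
  have hcoef_le : ∀ x, ‖coef x‖ ≤ ‖p x.1‖ := fun x => by
    refine ((p x.1).le_opNorm _).trans ?_
    simp [Pi.norm_single]
  have hr0 : (0 : ℝ) < r := by exact_mod_cast hr
  have hG : Summable fun x : (Σ m, Fin m → ι) => ‖coef x‖ * (r : ℝ) ^ x.1 := by
    rw [summable_sigma_of_nonneg (fun x => by positivity)]
    refine ⟨fun m => (hasSum_fintype _).summable, ?_⟩
    have hs := p.summable_norm_mul_pow (hrR.trans_le hp.r_le)
    refine hs.of_nonneg_of_le (fun m => tsum_nonneg fun _ => by positivity) fun m => ?_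
    rw [tsum_fintype]
    calc ∑ w : Fin m → ι, ‖coef ⟨m, w⟩‖ * (r : ℝ) ^ m
        ≤ ∑ w : Fin m → ι, ‖p m‖ * (r : ℝ) ^ m :=
          Finset.sum_le_sum fun w _ => mul_le_mul_of_nonneg_right (hcoef_le ⟨m, w⟩) (by positivity)
      _ = (Fintype.card ι : ℝ) ^ m * (‖p m‖ * (r : ℝ) ^ m) := by simp
      _ ≤ K ^ m * (‖p m‖ * (r : ℝ) ^ m) := by
          gcongr; simp [hK]
      _ = ‖p m‖ * ((K.toNNReal * r : NNReal) : ℝ) ^ m := by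
          rw [NNReal.coe_mul, Real.coe_toNNReal _ hK0.le, mul_pow]; ring
  have hfib : ∀ α, Summable fun x : {x : (Σ m, Fin m → ι) // content x = α} => coef x := fun α => by
    refine Summable.of_norm ?_
    have h1 := (hG.subtype {x | content x = α}).mul_right (((r : ℝ) ^ (∑ i, α i))⁻¹)
    refine h1.congr fun x => ?_
    have : x.1.1 = ∑ i, α i := by rw [← sum_content, show content x.1 = α from x.2]
    simp only [Function.comp, this]
    field_simp
  refine ⟨fun α => ∑' x : {x : (Σ m, Fin m → ι) // content x = α}, coef x, r, hr0, ?_, ?_⟩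
  · have h1 := (Equiv.sigmaFiberEquiv (content (ι := ι))).summable_iff.2 hG
    refine h1.sigma.of_nonneg_of_le (fun α => by positivity) fun α => ?_
    have h2 : ∀ x : {x : (Σ m, Fin m → ι) // content x = α},
        ‖coef x‖ * (r : ℝ) ^ x.1.1 = ‖coef x‖ * (r : ℝ) ^ (∑ i, α i) := fun x => by
      rw [← sum_content x.1, x.2]
    calc _ ≤ (∑' x : {x : (Σ m, Fin m → ι) // content x = α}, ‖coef x‖) * (r : ℝ) ^ (∑ i, α i) :=
          mul_le_mul_of_nonneg_right (norm_tsum_le_tsum_norm (hfib α).norm) (by positivity)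
      _ = ∑' x : {x : (Σ m, Fin m → ι) // content x = α}, ‖coef x‖ * (r : ℝ) ^ (∑ i, α i) :=
          tsum_mul_right.symm
      _ ≤ _ := le_of_eq (tsum_congr fun x => (h2 x).symm)
  · intro z hz
    set F : (Σ m, Fin m → ι) → ℂ := fun x => coef x * mon z (content x) with hF
    have hFs : Summable F := Summable.of_norm_bounded hG fun x => by
      rw [hF, norm_mul]
      refine mul_le_mul_of_nonneg_left ((norm_mon_le hz _).trans_eq ?_) (norm_nonneg _)
      rw [sum_content]
    have hFf : HasSum F (f z) := by
      have h1 := hFs.hasSum.sigma fun m => hasSum_fintype _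
      have h2 : HasSum (fun m => p m fun _ => z) (f (0 + z)) := by
        refine hp.hasSum ?_
        rw [Metric.mem_eball, edist_zero_right]
        refine lt_of_le_of_lt ?_ hrR
        rw [enorm_le_coe, ← NNReal.coe_le_coe, coe_nnnorm, NNReal.coe_mul,
          Real.coe_toNNReal _ hK0.le]
        refine hz.trans (le_mul_of_one_le_left hr0.le ?_)
        simp [hK]
      have h3 : ∀ m, (p m fun _ => z) = ∑ w : Fin m → ι, F ⟨m, w⟩ := fun m => by
        have hz' : z = ∑ i, z i • (Pi.single i 1 : ι → ℂ) := by
          ext k; simp [Finset.sum_apply, Pi.single_apply]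
        conv_lhs => rw [hz']
        rw [ContinuousMultilinearMap.map_sum]
        refine Finset.sum_congr rfl fun w _ => ?_
        rw [ContinuousMultilinearMap.map_smul_univ, hF]
        simp only [mon_content, hcoef, smul_eq_mul]
        ring
      simp only [h3, zero_add] at h2
      rw [← h1.unique h2]
      exact hFs.hasSum
    have h4 := (Equiv.sigmaFiberEquiv (content (ι := ι))).hasSum_iff.2 hFf
    refine h4.sigma fun α => ?_
    have h5 := (hfib α).hasSum.mul_right (mon z α)
    refine h5.congr_fun ?_ |> id
    intro x
    simp [hF, Equiv.sigmaFiberEquiv, x.2]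

/-- The monomials are restrictions to the diagonal of multilinear maps of norm at most one. -/
lemma exists_multilinear_mon (m : ℕ) (α : ι → ℕ) :
    ∃ M : ContinuousMultilinearMap ℂ (fun _ : Fin m => ι → ℂ) ℂ, ‖M‖ ≤ 1 ∧
      (∑ i, α i = m → ∀ z, M (fun _ => z) = mon z α) := by
  classical
  by_cases hm : ∑ i, α i = m
  swap
  -- The default value in the wrong degree makes the family total, so that it can be chosen for all
  -- `m` and `α`.
  · exact ⟨0, by simp, fun h => absurd h hm⟩
  have hw : ∀ m (α : ι → ℕ), ∑ i, α i = m →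
      ∃ w : Fin m → ι, ∀ z : ι → ℂ, ∏ l, z (w l) = mon z α := by
    intro m
    induction m with
    | zero =>
      intro α h
      refine ⟨Fin.elim0, fun z => ?_⟩
      have : α = 0 := by
        ext i; exact (Finset.sum_eq_zero_iff.1 h) i (Finset.mem_univ i)
      simp [this, mon_zero_right]
    | succ m ih =>
      intro α h
      obtain ⟨i, hi⟩ : ∃ i, α i ≠ 0 := by
        by_contra! h0
        simp [h0] at h
      have hα : α = (α - Pi.single i 1) + Pi.single i 1 := by
        ext k
        by_cases hk : k = i
        · subst hk; simp; omega
        · simp [hk]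
      have hs : ∑ k, (α - Pi.single i 1 : ι → ℕ) k = m := by
        have h1 : ∑ k, α k = ∑ k, (α - Pi.single i 1 : ι → ℕ) k + 1 := by
          conv_lhs => rw [hα]
          simp only [Pi.add_apply, Finset.sum_add_distrib]
          simp
        omega
      obtain ⟨w, hw⟩ := ih _ hs
      refine ⟨Fin.cons i w, fun z => ?_⟩
      rw [Fin.prod_univ_succ]
      conv_rhs => rw [hα]
      simp [mon_add, mon_single, hw, mul_comm]
  obtain ⟨w, hw⟩ := hw m α hm
  refine ⟨(ContinuousMultilinearMap.mkPiAlgebra ℂ (Fin m) ℂ).compContinuousLinearMap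
    fun l => ContinuousLinearMap.proj (w l), ?_, fun _ z => by simpa using hw z⟩
  refine (ContinuousMultilinearMap.norm_compContinuousLinearMap_le _ _).trans ?_
  rw [ContinuousMultilinearMap.norm_mkPiAlgebra, one_mul]
  refine Finset.prod_le_one (fun _ _ => norm_nonneg _) fun l _ => ?_
  exact ContinuousLinearMap.opNorm_le_bound _ zero_le_one fun z => by
    simpa using norm_le_pi_norm z (w l)

/-- The converse passage: the homogeneous parts, written with multilinear maps of norm at most one,
form a formal multilinear series. It gives access to analyticity and to uniqueness of Taylor series.
-/
lemma HasExpansion.exists_hasFPowerSeriesOnBall [DecidableEq ι]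
    {f : (ι → ℂ) → ℂ} {c : (ι → ℕ) → ℂ} {r : ℝ}
    (h : HasExpansion f c r) :
    ∃ p : FormalMultilinearSeries ℂ (ι → ℂ) ℂ, HasFPowerSeriesOnBall f p 0 (ENNReal.ofReal r) ∧
      ∀ m z, p m (fun _ => z) = ∑ α ∈ Finset.piAntidiag Finset.univ m, c α * mon z α := by
  choose M hM1 hM2 using exists_multilinear_mon (ι := ι)
  have hp : ∀ m z, (∑ α ∈ Finset.piAntidiag Finset.univ m, c α • M m α) (fun _ => z) =
      ∑ α ∈ Finset.piAntidiag Finset.univ m, c α * mon z α := fun m z => by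
    rw [_root_.sum_apply]
    refine Finset.sum_congr rfl fun α hα => ?_
    rw [_root_.smul_apply, hM2 m α (Finset.mem_piAntidiag.1 hα).1, smul_eq_mul]
  refine ⟨fun m => ∑ α ∈ Finset.piAntidiag Finset.univ m, c α • M m α, ⟨?_, ?_, ?_⟩, hp⟩
  · have : ENNReal.ofReal r = ((r.toNNReal : NNReal) : ENNReal) := rfl
    rw [this]
    refine FormalMultilinearSeries.le_radius_of_bound _
      (∑' α, ‖c α‖ * r ^ (∑ i, α i)) fun m => ?_
    rw [Real.coe_toNNReal _ h.pos.le]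
    calc _ ≤ (∑ α ∈ Finset.piAntidiag Finset.univ m, ‖c α‖) * r ^ m := by
          refine mul_le_mul_of_nonneg_right ((norm_sum_le _ _).trans ?_) (pow_nonneg h.pos.le _)
          refine Finset.sum_le_sum fun α _ => ?_
          rw [norm_smul]
          exact mul_le_of_le_one_right (norm_nonneg _) (hM1 m α)
      _ = ∑ α ∈ Finset.piAntidiag Finset.univ m, ‖c α‖ * r ^ (∑ i, α i) := by
          rw [Finset.sum_mul]
          exact Finset.sum_congr rfl fun α hα => by rw [(Finset.mem_piAntidiag.1 hα).1]
      _ ≤ _ := h.summable.sum_le_tsum _ fun α _ => by have := h.pos; positivity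
  · simpa using h.pos
  · intro y hy
    have hy' : ‖y‖ ≤ r := by
      rw [Metric.mem_eball, edist_zero_right, ← ofReal_norm,
        ENNReal.ofReal_lt_ofReal_iff h.pos] at hy
      exact hy.le
    simp only [hp, zero_add]
    have h1 := (Equiv.sigmaFiberEquiv (fun α : ι → ℕ => ∑ i, α i)).hasSum_iff.2 (h.hasSum y hy')
    refine h1.sigma fun m => ?_
    have h2 := Finset.hasSum (Finset.piAntidiag Finset.univ m) fun α : ι → ℕ => c α * mon y α
    refine ((Equiv.subtypeEquivRight (fun α : ι → ℕ => (by simp :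
      (∑ i, α i = m) ↔ α ∈ Finset.piAntidiag (Finset.univ : Finset ι) m))).hasSum_iff.2 h2).congr_fun
        ?_ |> id
    intro x
    rfl

lemma HasExpansion.analyticOnNhd {f : (ι → ℂ) → ℂ} {c : (ι → ℕ) → ℂ} {r : ℝ}
    (h : HasExpansion f c r) : AnalyticOnNhd ℂ f (Metric.ball 0 r) := by
  classical
  obtain ⟨p, hp, -⟩ := h.exists_hasFPowerSeriesOnBall
  rw [← Metric.eball_ofReal]
  exact hp.analyticOnNhd

lemma HasExpansion.analyticAt {f : (ι → ℂ) → ℂ} {c : (ι → ℕ) → ℂ} {r : ℝ}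
    (h : HasExpansion f c r) : AnalyticAt ℂ f 0 :=
  h.analyticOnNhd 0 (Metric.mem_ball_self h.pos)

/-- The coefficients of the zero function vanish. -/
lemma HasExpansion.eq_zero {f : (ι → ℂ) → ℂ} {c : (ι → ℕ) → ℂ} {r : ℝ}
    (h : HasExpansion f c r) (hf : ∀ᶠ z in 𝓝 0, f z = 0) : c = 0 := by
  classical
  obtain ⟨p, hp, hpc⟩ := h.exists_hasFPowerSeriesOnBall
  have h0 : HasFPowerSeriesAt 0 p (0 : ι → ℂ) := hp.hasFPowerSeriesAt.congr hf
  funext α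
  set m := ∑ i, α i with hm
  -- The homogeneous part of degree `m` vanishes as a function, hence as a polynomial since `ℂ` is
  -- infinite.
  set P : MvPolynomial ι ℂ := ∑ β ∈ Finset.piAntidiag Finset.univ m,
    MvPolynomial.monomial (Finsupp.equivFunOnFinite.symm β) (c β) with hP
  have hP0 : P = 0 := by
    refine MvPolynomial.funext fun z => ?_
    have := h0.apply_eq_zero m z
    rw [hpc] at this
    rw [map_zero, hP, map_sum, ← this]
    refine Finset.sum_congr rfl fun β _ => ?_
    rw [MvPolynomial.eval_monomial, Finsupp.prod_fintype _ _ (by simp)]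
    rfl
  have h1 := congrArg (MvPolynomial.coeff (Finsupp.equivFunOnFinite.symm α)) hP0
  rw [hP, MvPolynomial.coeff_sum, Finset.sum_eq_single α] at h1
  · simpa using h1
  · intro β _ hβ
    rw [MvPolynomial.coeff_monomial, if_neg]
    simpa using hβ
  · intro hα
    exact absurd (by simp [hm]) hα

/-- The coefficients of a power series, which is only assumed to converge pointwise, are
determined by its sum. -/
lemma coeff_eq_zero_of_hasSum {d : (ι → ℕ) → ℂ} {r : ℝ} (hr : 0 < r)
    (h : ∀ z : ι → ℂ, ‖z‖ < r → HasSum (fun α => d α * mon z α) 0) : d = 0 := by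
  have hr2 : 0 < r / 2 := by positivity
  -- Summability in `ℂ` is absolute, so convergence at the single point with all coordinates `r / 2`
  -- gives absolute convergence on the closed polydisc of that radius.
  have h1 : ‖(fun _ => ((r / 2 : ℝ) : ℂ) : ι → ℂ)‖ < r := by
    refine lt_of_le_of_lt ((pi_norm_le_iff_of_nonneg hr2.le).2 fun i => ?_) (half_lt_self hr)
    rw [Complex.norm_real, Real.norm_of_nonneg hr2.le]
  have h2 : Summable fun α => ‖d α‖ * (r / 2) ^ (∑ i, α i) := by
    refine (h _ h1).summable.norm.congr fun α => ?_
    rw [norm_mul, norm_mon, Complex.norm_real, Real.norm_of_nonneg hr2.le,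
      Finset.prod_pow_eq_pow_sum]
  have h3 : HasExpansion (fun _ => 0) d (r / 2) :=
    ⟨hr2, h2, fun z hz => h z (hz.trans_lt (half_lt_self hr))⟩
  exact h3.eq_zero (Eventually.of_forall fun _ => rfl)

end Series

/-! ## Divisibility by coordinates in rings of germs -/

/-- Germs of holomorphic functions form a domain: near a point where `f ≠ 0` the other factor
vanishes on an open set, hence on a whole ball around `x` by the identity theorem. -/
lemma eventually_eq_zero_or_of_mul {E : Type*} [NormedAddCommGroup E] [NormedSpace ℂ E]
    {f g : E → ℂ} {x : E} (hf : AnalyticAt ℂ f x) (hg : AnalyticAt ℂ g x)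
    (h : ∀ᶠ z in 𝓝 x, f z * g z = 0) : (∀ᶠ z in 𝓝 x, f z = 0) ∨ ∀ᶠ z in 𝓝 x, g z = 0 := by
  by_contra! hne
  obtain ⟨hf0, hg0⟩ := hne
  obtain ⟨r, hr, hball⟩ := Metric.eventually_nhds_iff_ball.1
    ((hf.eventually_analyticAt.and hg.eventually_analyticAt).and h)
  have hev : ∀ᶠ z in 𝓝 x, z ∈ Metric.ball x r := Metric.ball_mem_nhds x hr
  obtain ⟨z, hz, hzr⟩ := (hf0.and_eventually hev).exists
  have hgz : g =ᶠ[𝓝 z] 0 := by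
    filter_upwards [(hball z hzr).1.1.continuousAt.eventually_ne hz,
      Metric.isOpen_ball.mem_nhds hzr] with y hy hyr
    exact (mul_eq_zero.1 (hball y hyr).2).resolve_left hy
  have : AnalyticOnNhd ℂ g (Metric.ball x r) := fun y hy => (hball y hy).1.2
  have h0 := this.eqOn_zero_of_preconnected_of_eventuallyEq_zero
    (convex_ball x r).isPreconnected hzr hgz
  exact hg0 (hev.mono fun y hy => by simpa using h0 hy)

section Germs

variable {ι : Type*} [Fintype ι]

lemma analyticAt_coord (j : ι) (e : ι → ℂ) : AnalyticAt ℂ (fun z : ι → ℂ => z j) e :=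
  (ContinuousLinearMap.proj (R := ℂ) (φ := fun _ : ι => ℂ) j).analyticAt e

lemma analyticAt_mon (α : ι → ℕ) (e : ι → ℂ) : AnalyticAt ℂ (fun z : ι → ℂ => mon z α) e := by
  unfold mon
  exact Finset.analyticAt_fun_prod _ fun i _ => (analyticAt_coord i e).pow _

/-- Arbitrarily close to any point there are points with prescribed non-zero coordinates. -/
lemma frequently_ne_zero (e : ι → ℂ) {P : (ι → ℂ) → Prop} (h : ∀ᶠ z in 𝓝 e, P z) :
    ∃ z, P z ∧ (∀ i, z i ≠ 0) := by
  have hc : Tendsto (fun s : ℂ => fun i => e i + s) (𝓝[≠] 0) (𝓝 e) := by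
    have : Continuous fun s : ℂ => fun i => e i + s := by fun_prop
    have h1 := this.tendsto 0
    simp only [add_zero] at h1
    exact h1.mono_left nhdsWithin_le_nhds
  have h2 : ∀ᶠ s : ℂ in 𝓝[≠] 0, ∀ i, e i + s ≠ 0 := by
    refine eventually_all.2 fun i => ?_
    by_cases hi : e i = 0
    · filter_upwards [self_mem_nhdsWithin] with s hs
      simpa [hi] using hs
    · have : ContinuousAt (fun s : ℂ => e i + s) 0 := by fun_prop
      exact (this.eventually_ne (by simpa using hi)).filter_mono nhdsWithin_le_nhds
  obtain ⟨s, hs1, hs2⟩ := ((hc.eventually h).and h2).exists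
  exact ⟨_, hs1, hs2⟩

lemma not_eventually_mon_eq_zero (α : ι → ℕ) (e : ι → ℂ) : ¬ ∀ᶠ z in 𝓝 e, mon z α = 0 := by
  intro h
  obtain ⟨z, hz, hz0⟩ := frequently_ne_zero e h
  exact Finset.prod_ne_zero_iff.2 (fun i _ => pow_ne_zero _ (hz0 i)) hz

lemma eventually_eq_of_mon_mul {f g : (ι → ℂ) → ℂ} {e : ι → ℂ} (α : ι → ℕ)
    (hf : AnalyticAt ℂ f e) (hg : AnalyticAt ℂ g e)
    (h : ∀ᶠ z in 𝓝 e, mon z α * f z = mon z α * g z) : ∀ᶠ z in 𝓝 e, f z = g z := by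
  have h1 : ∀ᶠ z in 𝓝 e, mon z α * (f z - g z) = 0 := h.mono fun z hz => by
    rw [mul_sub, hz, sub_self]
  refine ((eventually_eq_zero_or_of_mul (analyticAt_mon α e) (hf.sub hg) h1).resolve_left
    (not_eventually_mon_eq_zero α e)).mono fun z hz => sub_eq_zero.1 hz

variable [DecidableEq ι]

lemma eventually_eq_of_coord_mul {f g : (ι → ℂ) → ℂ} {e : ι → ℂ} (j : ι)
    (hf : AnalyticAt ℂ f e) (hg : AnalyticAt ℂ g e)
    (h : ∀ᶠ z in 𝓝 e, z j * f z = z j * g z) : ∀ᶠ z in 𝓝 e, f z = g z :=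
  eventually_eq_of_mon_mul (Pi.single j 1) hf hg (by simpa only [mon_single] using h)

lemma norm_update_zero_le (z : ι → ℂ) (j : ι) : ‖Function.update z j 0‖ ≤ ‖z‖ := by
  refine (pi_norm_le_iff_of_nonneg (norm_nonneg _)).2 fun i => ?_
  by_cases hi : i = j
  · subst hi; simp
  · simpa [hi] using norm_le_pi_norm z i

lemma continuous_update_zero {κ : Type*} [DecidableEq κ] (j : κ) :
    Continuous fun z : κ → ℂ => Function.update z j 0 :=
  continuous_id.update j continuous_const

lemma analyticAt_update_zero (j : ι) (e : ι → ℂ) :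
    AnalyticAt ℂ (fun z : ι → ℂ => Function.update z j 0) e := by
  rw [analyticAt_pi_iff]
  intro i
  by_cases hi : i = j
  · subst hi; simpa using analyticAt_const
  · simpa [hi] using analyticAt_coord i e

lemma update_zero_self {κ : Type*} [DecidableEq κ] {e : κ → ℂ} {j : κ} (he : e j = 0) : Function.update e j 0 = e := by
  rw [← he]; exact Function.update_eq_self j e

/-- Substituting `z j = 0` keeps exactly the monomials free of `z j`, so the coefficients of these
expand the zero germ. -/
lemma HasExpansion.coeff_eq_zero {f : (ι → ℂ) → ℂ} {c : (ι → ℕ) → ℂ} {r : ℝ}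
    (h : HasExpansion f c r) {j : ι} (hf : ∀ᶠ z in 𝓝 0, z j = 0 → f z = 0)
    {α : ι → ℕ} (hα : α j = 0) : c α = 0 := by
  have key : ∀ (z : ι → ℂ) (β : ι → ℕ),
      (if β j = 0 then c β else 0) * mon z β = c β * mon (Function.update z j 0) β := by
    intro z β
    split_ifs with hβ
    · congr 1
      refine Finset.prod_congr rfl fun i _ => ?_
      by_cases hi : i = j
      · subst hi; simp [hβ]
      · simp [hi]
    · rw [zero_mul, mon, Finset.prod_eq_zero (Finset.mem_univ j), mul_zero]
      simp [hβ]
  have h0 : HasExpansion (fun z => f (Function.update z j 0))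
      (fun β => if β j = 0 then c β else 0) r := by
    refine ⟨h.pos, h.summable.of_nonneg_of_le (fun β => by have := h.pos; positivity) fun β => ?_,
      fun z hz => ?_⟩
    · have := h.pos
      split_ifs <;> simp; positivity
    · simp only [key]
      exact h.hasSum _ ((norm_update_zero_le z j).trans hz)
  have h1 := (continuous_update_zero j).tendsto (0 : ι → ℂ)
  rw [update_zero_self (Pi.zero_apply j)] at h1
  have h2 := congrFun (h0.eq_zero ((h1.eventually hf).mono fun z hz => hz (by simp))) α
  simpa [hα] using h2

lemma HasExpansion.div_coord {f : (ι → ℂ) → ℂ} {c : (ι → ℕ) → ℂ} {r : ℝ}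
    (h : HasExpansion f c r) {j : ι} (hc : ∀ α, α j = 0 → c α = 0) :
    ∃ g, HasExpansion g (fun β => c (β + Pi.single j 1)) r ∧ ∀ z, ‖z‖ ≤ r → f z = z j * g z := by
  have hinj : Function.Injective fun β : ι → ℕ => β + Pi.single j 1 := fun _ _ h =>
    add_right_cancel h
  have hs : Summable fun β : ι → ℕ => ‖c (β + Pi.single j 1)‖ * r ^ (∑ i, β i) := by
    refine ((h.summable.comp_injective hinj).mul_right r⁻¹).congr fun β => ?_
    have := h.pos
    simp [Function.comp, Finset.sum_add_distrib, pow_succ]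
    field_simp
  refine ⟨_, HasExpansion.of_summable h.pos hs, fun z hz => ?_⟩
  have h1 := (summable_mul_mon hs hz).hasSum.mul_left (z j)
  refine (h.hasSum z hz).unique ?_
  refine (hinj.hasSum_iff ?_).1 (h1.congr_fun fun β => ?_ : HasSum _ _)
  · intro α hα
    rw [hc α, zero_mul]
    by_contra h0
    refine hα ⟨α - Pi.single j 1, ?_⟩
    ext k
    by_cases hk : k = j
    · subst hk; simp; omega
    · simp [hk]
  · simp [mon_add, mon_single]; ring

/-- A germ that vanishes on a coordinate hyperplane is divisible by the coordinate. -/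
lemma exists_eq_coord_mul {f : (ι → ℂ) → ℂ} {e : ι → ℂ} (hf : AnalyticAt ℂ f e) {j : ι}
    (he : e j = 0) (h : ∀ᶠ z in 𝓝 e, z j = 0 → f z = 0) :
    ∃ g, AnalyticAt ℂ g e ∧ ∀ᶠ z in 𝓝 e, f z = z j * g z := by
  have ht : Tendsto (fun z : ι → ℂ => z + e) (𝓝 0) (𝓝 e) := by
    have : Continuous fun z : ι → ℂ => z + e := by fun_prop
    simpa using this.tendsto 0
  have ht' : Tendsto (fun z : ι → ℂ => z - e) (𝓝 e) (𝓝 0) := by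
    have : Continuous fun z : ι → ℂ => z - e := by fun_prop
    simpa using this.tendsto e
  have hf' : AnalyticAt ℂ (fun z => f (z + e)) 0 :=
    AnalyticAt.comp (g := f) (f := fun z => z + e) (by simpa using hf)
      (analyticAt_id.add analyticAt_const)
  obtain ⟨c, r, hc⟩ := exists_hasExpansion hf'
  obtain ⟨g, hg, hfg⟩ := hc.div_coord fun α hα => hc.coeff_eq_zero (j := j)
    ((ht.eventually h).mono fun z hz hzj => hz (by simp [he, hzj])) hα
  refine ⟨fun z => g (z - e), AnalyticAt.comp (g := g) (f := fun z => z - e)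
    (by simpa using hg.analyticAt) (analyticAt_id.sub analyticAt_const), ?_⟩
  filter_upwards [ht'.eventually (Metric.closedBall_mem_nhds 0 hc.pos)] with z hz
  simpa [he] using hfg (z - e) (by simpa using hz)

lemma eventually_update_zero {κ : Type*} [DecidableEq κ] {e : κ → ℂ} {j : κ} (he : e j = 0)
    {P : (κ → ℂ) → Prop}
    (h : ∀ᶠ z in 𝓝 e, P z) : ∀ᶠ z in 𝓝 e, P (Function.update z j 0) := by
  have h1 := (continuous_update_zero j).tendsto e
  rw [update_zero_self he] at h1
  exact h1.eventually h

/-- The ideal of germs vanishing on a coordinate hyperplane is prime. -/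
lemma vanishes_or_vanishes_of_mul {f g : (ι → ℂ) → ℂ} {e : ι → ℂ} (hf : AnalyticAt ℂ f e)
    (hg : AnalyticAt ℂ g e) {j : ι} (he : e j = 0) (h : ∀ᶠ z in 𝓝 e, z j = 0 → f z * g z = 0) :
    (∀ᶠ z in 𝓝 e, z j = 0 → f z = 0) ∨ ∀ᶠ z in 𝓝 e, z j = 0 → g z = 0 := by
  have hcomp : ∀ {f : (ι → ℂ) → ℂ}, AnalyticAt ℂ f e →
      AnalyticAt ℂ (fun z => f (Function.update z j 0)) e := fun {f} hf =>
    AnalyticAt.comp (g := f) (f := fun z => Function.update z j 0)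
      (by rwa [update_zero_self he]) (analyticAt_update_zero j e)
  refine (eventually_eq_zero_or_of_mul (hcomp hf) (hcomp hg)
    ((eventually_update_zero he h).mono fun z hz => hz (by simp))).imp ?_ ?_ <;>
  · intro h
    filter_upwards [h] with z hz hzj
    rwa [update_zero_self hzj] at hz

lemma not_vanishes_coord {e : ι → ℂ} {j k : ι} (hk : k ≠ j) (he : e j = 0) :
    ¬ ∀ᶠ z in 𝓝 e, z j = 0 → z k = 0 := by
  intro h
  obtain ⟨z, hz, hz0⟩ := frequently_ne_zero e (eventually_update_zero he h)
  exact hz0 k (by simpa [hk] using hz (by simp))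

/-- A germ prime to a monomial that divides a product of the monomial and of another germ
divides the latter. -/
lemma exists_eq_mul_of_mon_mul {X : Finset ι} {e : ι → ℂ} (he : ∀ j ∈ X, e j = 0)
    {g a h : (ι → ℂ) → ℂ} (hg : AnalyticAt ℂ g e) (ha : AnalyticAt ℂ a e) (hh : AnalyticAt ℂ h e)
    (hgX : ∀ j ∈ X, ¬ ∀ᶠ z in 𝓝 e, z j = 0 → g z = 0) (lam : ι → ℕ) (hlam : ∀ j ∉ X, lam j = 0)
    (heq : ∀ᶠ z in 𝓝 e, g z * h z = mon z lam * a z) :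
    ∃ h', AnalyticAt ℂ h' e ∧ ∀ᶠ z in 𝓝 e, a z = g z * h' z := by
  -- Induction on the degree of the monomial: each of its coordinates divides `g * h`, is prime and
  -- does not divide `g`, so it divides `h` and can be cancelled.
  obtain ⟨N, hN⟩ : ∃ N, ∑ i, lam i = N := ⟨_, rfl⟩
  induction N generalizing lam h with
  | zero =>
    have : lam = 0 := by ext i; exact (Finset.sum_eq_zero_iff.1 hN) i (Finset.mem_univ i)
    refine ⟨h, hh, heq.mono fun z hz => ?_⟩
    rw [hz, this, mon_zero_right, one_mul]
  | succ N ih =>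
    obtain ⟨j, hj⟩ : ∃ j, lam j ≠ 0 := by
      by_contra! h0
      simp [h0] at hN
    have hjX : j ∈ X := by by_contra hjX; exact hj (hlam j hjX)
    have hdec : lam = (lam - Pi.single j 1) + Pi.single j 1 := by
      ext k
      by_cases hk : k = j
      · subst hk; simp; omega
      · simp [hk]
    have hmon : ∀ z : ι → ℂ, mon z lam = z j * mon z (lam - Pi.single j 1) := fun z => by
      conv_lhs => rw [hdec]
      rw [mon_add, mon_single, mul_comm]
    have hvan := (vanishes_or_vanishes_of_mul hg hh (he j hjX)
      (heq.mono fun z hz hzj => by rw [hz, hmon, hzj, zero_mul, zero_mul])).resolve_left (hgX j hjX)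
    obtain ⟨h1, hh1, hhh1⟩ := exists_eq_coord_mul hh (he j hjX) hvan
    refine ih hh1 (lam - Pi.single j 1) (fun k hk => by simp [hlam k hk]) ?_ ?_
    · refine eventually_eq_of_coord_mul j (hg.mul hh1) ((analyticAt_mon _ e).mul ha) ?_
      filter_upwards [heq, hhh1] with z hz1 hz2
      calc z j * (g z * h1 z) = g z * h z := by rw [hz2]; ring
        _ = z j * (mon z (lam - Pi.single j 1) * a z) := by rw [hz1, hmon]; ring
    · have h1 : ∑ k, lam k = ∑ k, (lam - Pi.single j 1 : ι → ℕ) k + 1 := by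
        conv_lhs => rw [hdec]
        simp only [Pi.add_apply, Finset.sum_add_distrib]
        simp
      omega

/-- A family of germs, not all zero, is the product of a monomial and of a family of germs without
common monomial factor. -/
lemma exists_eq_mon_mul (X : Finset ι) {κ : Type*} {b : κ → (ι → ℂ) → ℂ}
    (hb : ∀ k, AnalyticAt ℂ (b k) 0) (hne : ∃ k, ¬ ∀ᶠ z in 𝓝 0, b k z = 0) :
    ∃ μ : ι → ℕ, (∀ i ∉ X, μ i = 0) ∧ ∃ a : κ → (ι → ℂ) → ℂ, (∀ k, AnalyticAt ℂ (a k) 0) ∧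
      (∀ k, ∀ᶠ z in 𝓝 0, b k z = mon z μ * a k z) ∧
      ∀ j ∈ X, ∃ k, ¬ ∀ᶠ z in 𝓝 0, z j = 0 → a k z = 0 := by
  obtain ⟨k₀, hk₀⟩ := hne
  obtain ⟨c, r, hc⟩ := exists_hasExpansion (hb k₀)
  obtain ⟨α, hα⟩ : ∃ α, c α ≠ 0 := by
    by_contra! h0
    refine hk₀ ?_
    filter_upwards [Metric.closedBall_mem_nhds 0 hc.pos] with z hz
    have := hc.hasSum z (by simpa using hz)
    simp only [h0, zero_mul] at this
    exact this.unique hasSum_zero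
  -- The degree of a non-zero coefficient of one member `b k₀` bounds the number of divisions:
  -- dividing the family by a coordinate lowers it by one, and in degree zero `b k₀` has a non-zero
  -- constant term.
  obtain ⟨N, hN⟩ : ∃ N, ∑ i, α i = N := ⟨_, rfl⟩
  clear hk₀
  induction N generalizing b c r α with
  | zero =>
    refine ⟨0, by simp, b, hb, fun k => by simp [mon_zero_right], fun j _ => ⟨k₀, fun h => hα ?_⟩⟩
    exact hc.coeff_eq_zero h ((Finset.sum_eq_zero_iff.1 hN) j (Finset.mem_univ j))
  | succ N ih =>
    by_cases hX : ∀ j ∈ X, ∃ k, ¬ ∀ᶠ z in 𝓝 0, z j = 0 → b k z = 0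
    · exact ⟨0, by simp, b, hb, fun k => by simp [mon_zero_right], hX⟩
    · push Not at hX
      obtain ⟨j, hjX, hj⟩ := hX
      have hd : ∀ k, ∃ g, (∃ c' r', HasExpansion g c' r' ∧ (k = k₀ → ∃ β, c' β ≠ 0 ∧ ∑ i, β i = N)) ∧
          ∀ᶠ z in 𝓝 0, b k z = z j * g z := by
        intro k
        by_cases hk : k = k₀
        · subst hk
          obtain ⟨g, hg, hfg⟩ := hc.div_coord fun β hβ => hc.coeff_eq_zero (hj k) hβ
          have hαj : α j ≠ 0 := fun h => hα (hc.coeff_eq_zero (hj k) h)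
          have hdec : (α - Pi.single j 1) + Pi.single j 1 = α := by
            ext k
            by_cases hk : k = j
            · subst hk; simp; omega
            · simp [hk]
          refine ⟨g, ⟨_, r, hg, fun _ => ⟨α - Pi.single j 1, by rwa [hdec], ?_⟩⟩, ?_⟩
          · have h1 : ∑ k, α k = ∑ k, (α - Pi.single j 1 : ι → ℕ) k + 1 := by
              conv_lhs => rw [← hdec]
              simp only [Pi.add_apply, Finset.sum_add_distrib]
              simp
            omega
          · filter_upwards [Metric.closedBall_mem_nhds 0 hc.pos] with z hz
            exact hfg z (by simpa using hz)
        · obtain ⟨g, hg, hfg⟩ := exists_eq_coord_mul (hb k) (Pi.zero_apply j) (hj k)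
          obtain ⟨c', r', hc'⟩ := exists_hasExpansion hg
          exact ⟨g, ⟨c', r', hc', fun h => absurd h hk⟩, hfg⟩
      choose g hg hbg using hd
      obtain ⟨c', r', hc', hβ⟩ := hg k₀
      obtain ⟨β, hβ, hβN⟩ := hβ rfl
      obtain ⟨μ, hμ, a, ha, hga, haX⟩ := ih (b := g)
        (fun k => by obtain ⟨c', r', hc', -⟩ := hg k; exact hc'.analyticAt) _ _ hc' β hβ hβN
      refine ⟨μ + Pi.single j 1, fun i hi => ?_, a, ha, fun k => ?_, haX⟩
      · have : i ≠ j := fun h => hi (h ▸ hjX)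
        simp [hμ i hi, this]
      · filter_upwards [hbg k, hga k] with z h1 h2
        rw [h1, h2, mon_add, mon_single]; ring

end Germs

/-! ## Weighted dilations and a Harnack property -/

section Dilation

variable {ι : Type*}

/-- The weighted dilation `z i ↦ t ^ w i * z i`. -/
def dil (w : ι → ℝ) (t : ℝ) (z : ι → ℂ) : ι → ℂ := fun i => ((t ^ w i : ℝ) : ℂ) * z i

lemma continuous_dil (w : ι → ℝ) (t : ℝ) : Continuous (dil w t) := by
  unfold dil; fun_prop

lemma dil_inv_dil {w : ι → ℝ} {t : ℝ} (ht : 0 < t) (z : ι → ℂ) : dil w t⁻¹ (dil w t z) = z := by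
  funext i
  have := (Real.rpow_pos_of_pos ht (w i)).ne'
  simp only [dil, Real.inv_rpow ht.le, Complex.ofReal_inv]
  rw [← mul_assoc, inv_mul_cancel₀ (by exact_mod_cast this), one_mul]

lemma dil_dil_inv {w : ι → ℝ} {t : ℝ} (ht : 0 < t) (z : ι → ℂ) : dil w t (dil w t⁻¹ z) = z := by
  conv_lhs => rw [← inv_inv t]
  rw [inv_inv t⁻¹]
  exact dil_inv_dil (inv_pos.2 ht) z

/-- The function `N` is comparable with itself along the curves `t ↦ dil w t z` for `z` near `z₀`:
its values at two such points with the same parameter differ by at most a constant factor. -/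
def Harnack (N : (ι → ℂ) → ℝ) (w : ι → ℝ) (z₀ : ι → ℂ) : Prop :=
  ∃ C : ℝ, ∀ᶠ q : ℝ × (ι → ℂ) × (ι → ℂ) in 𝓝[>] 0 ×ˢ (𝓝 z₀ ×ˢ 𝓝 z₀),
    N (dil w q.1 q.2.1) ≤ C * N (dil w q.1 q.2.2)

/-- The curves `t ↦ dil w t z₀`, with exponents that are positive only for coordinates in `X`,
tend to `e` and are contained in the complement of the hyperplanes `z i = 0`, `i ∈ X`. -/
structure TestPair (X : Finset ι) (e : ι → ℂ) (w : ι → ℝ) (z₀ : ι → ℂ) : Prop where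
  nonneg : ∀ i, 0 ≤ w i
  mem : ∀ i, 0 < w i → i ∈ X
  ne_zero : ∀ i ∈ X, z₀ i ≠ 0
  limit : ∀ i, (if w i = 0 then z₀ i else 0) = e i

lemma tendsto_rpow_nhdsGT_zero {s : ℝ} (hs : 0 < s) :
    Tendsto (fun t : ℝ => t ^ s) (𝓝[>] 0) (𝓝 0) := by
  have := (Real.continuousAt_rpow_const 0 s (Or.inr hs.le)).tendsto
  rw [Real.zero_rpow hs.ne'] at this
  exact this.mono_left nhdsWithin_le_nhds

lemma tendsto_dil {w : ι → ℝ} (hw : ∀ i, 0 ≤ w i) (z₀ : ι → ℂ) :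
    Tendsto (fun q : ℝ × (ι → ℂ) => dil w q.1 q.2) (𝓝[>] 0 ×ˢ 𝓝 z₀)
      (𝓝 fun i => if w i = 0 then z₀ i else 0) := by
  refine tendsto_pi_nhds.2 fun i => ?_
  have h2 : Tendsto (fun q : ℝ × (ι → ℂ) => q.2 i) (𝓝[>] 0 ×ˢ 𝓝 z₀) (𝓝 (z₀ i)) :=
    ((continuous_apply i).tendsto z₀).comp tendsto_snd
  by_cases hi : w i = 0
  · simpa [dil, hi] using h2
  · have h1 := (tendsto_rpow_nhdsGT_zero ((hw i).lt_of_ne' hi)).comp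
      (tendsto_fst (f := 𝓝[>] (0 : ℝ)) (g := 𝓝 z₀))
    have h3 := (Complex.continuous_ofReal.tendsto _).comp h1
    have h4 := h3.mul h2
    simpa [dil, hi] using h4

lemma TestPair.tendsto {X : Finset ι} {e : ι → ℂ} {w : ι → ℝ} {z₀ : ι → ℂ}
    (h : TestPair X e w z₀) :
    Tendsto (fun q : ℝ × (ι → ℂ) => dil w q.1 q.2) (𝓝[>] 0 ×ˢ 𝓝 z₀) (𝓝 e) := by
  have := tendsto_dil h.nonneg z₀
  rwa [funext h.limit] at this

lemma eventually_pos_prod (z₀ : ι → ℂ) :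
    ∀ᶠ q : ℝ × (ι → ℂ) in 𝓝[>] 0 ×ˢ 𝓝 z₀, 0 < q.1 :=
  tendsto_fst.eventually (self_mem_nhdsWithin : ∀ᶠ t : ℝ in 𝓝[>] 0, 0 < t)

lemma tendsto_prod_left (z₀ : ι → ℂ) :
    Tendsto (fun q : ℝ × (ι → ℂ) × (ι → ℂ) => (q.1, q.2.1)) (𝓝[>] 0 ×ˢ (𝓝 z₀ ×ˢ 𝓝 z₀))
      (𝓝[>] 0 ×ˢ 𝓝 z₀) :=
  tendsto_fst.prodMk (tendsto_fst.comp tendsto_snd)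

lemma tendsto_prod_right (z₀ : ι → ℂ) :
    Tendsto (fun q : ℝ × (ι → ℂ) × (ι → ℂ) => (q.1, q.2.2)) (𝓝[>] 0 ×ˢ (𝓝 z₀ ×ˢ 𝓝 z₀))
      (𝓝[>] 0 ×ˢ 𝓝 z₀) :=
  tendsto_fst.prodMk (tendsto_snd.comp tendsto_snd)

lemma Harnack.exists_nonneg {N : (ι → ℂ) → ℝ} {w : ι → ℝ} {z₀ : ι → ℂ} (hN : ∀ z, 0 ≤ N z)
    (h : Harnack N w z₀) : ∃ C : ℝ, 0 ≤ C ∧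
      ∀ᶠ q : ℝ × (ι → ℂ) × (ι → ℂ) in 𝓝[>] 0 ×ˢ (𝓝 z₀ ×ˢ 𝓝 z₀),
        N (dil w q.1 q.2.1) ≤ C * N (dil w q.1 q.2.2) := by
  obtain ⟨C, hC⟩ := h
  exact ⟨|C|, abs_nonneg C, hC.mono fun q hq =>
    hq.trans (mul_le_mul_of_nonneg_right (le_abs_self C) (hN _))⟩

/-- Invariance of the Harnack property under a map which intertwines the dilations, up to
constant factors. -/
lemma Harnack.of_comparable {ι' : Type*} {N₁ : (ι → ℂ) → ℝ} {N₂ : (ι' → ℂ) → ℝ}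
    (hN₁ : ∀ z, 0 ≤ N₁ z) (hN₂ : ∀ z, 0 ≤ N₂ z)
    {w₁ : ι → ℝ} {w₂ : ι' → ℝ} {z₁ : ι → ℂ} {z₂ : ι' → ℂ} {Φ : (ι → ℂ) → ι' → ℂ}
    (Φt : ℝ × (ι → ℂ) → ι' → ℂ) (hΦt : Tendsto Φt (𝓝[>] 0 ×ˢ 𝓝 z₁) (𝓝 z₂))
    (hcomm : ∀ᶠ q in 𝓝[>] 0 ×ˢ 𝓝 z₁, dil w₂ q.1 (Φt q) = Φ (dil w₁ q.1 q.2))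
    (h₁ : ∃ K, ∀ᶠ q : ℝ × (ι → ℂ) in 𝓝[>] 0 ×ˢ 𝓝 z₁,
      N₁ (dil w₁ q.1 q.2) ≤ K * N₂ (Φ (dil w₁ q.1 q.2)))
    (h₂ : ∃ K, ∀ᶠ q : ℝ × (ι → ℂ) in 𝓝[>] 0 ×ˢ 𝓝 z₁,
      N₂ (Φ (dil w₁ q.1 q.2)) ≤ K * N₁ (dil w₁ q.1 q.2))
    (H : Harnack N₂ w₂ z₂) : Harnack N₁ w₁ z₁ := by
  obtain ⟨C, hC0, hC⟩ := H.exists_nonneg hN₂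
  obtain ⟨K₁, hK₁⟩ := h₁
  obtain ⟨K₂, hK₂⟩ := h₂
  -- Both base points are transported with the same `t`. The transported point `Φt` may itself
  -- depend on `t`, provided it converges to `z₂`.
  have ht : Tendsto (fun q : ℝ × (ι → ℂ) × (ι → ℂ) => (q.1, Φt (q.1, q.2.1), Φt (q.1, q.2.2)))
      (𝓝[>] 0 ×ˢ (𝓝 z₁ ×ˢ 𝓝 z₁)) (𝓝[>] 0 ×ˢ (𝓝 z₂ ×ˢ 𝓝 z₂)) :=
    tendsto_fst.prodMk ((hΦt.comp (tendsto_prod_left z₁)).prodMk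
      (hΦt.comp (tendsto_prod_right z₁)))
  refine ⟨|K₁| * (C * |K₂|), ?_⟩
  filter_upwards [ht.eventually hC, (tendsto_prod_left z₁).eventually (hcomm.and hK₁),
    (tendsto_prod_right z₁).eventually (hcomm.and hK₂)] with q h0 h1 h2
  rw [h1.1, h2.1] at h0
  calc N₁ (dil w₁ q.1 q.2.1) ≤ K₁ * N₂ (Φ (dil w₁ q.1 q.2.1)) := h1.2
    _ ≤ |K₁| * N₂ (Φ (dil w₁ q.1 q.2.1)) :=
      mul_le_mul_of_nonneg_right (le_abs_self _) (hN₂ _)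
    _ ≤ |K₁| * (C * N₂ (Φ (dil w₁ q.1 q.2.2))) :=
      mul_le_mul_of_nonneg_left h0 (abs_nonneg _)
    _ ≤ |K₁| * (C * (|K₂| * N₁ (dil w₁ q.1 q.2.2))) := by
      refine mul_le_mul_of_nonneg_left (mul_le_mul_of_nonneg_left ?_ hC0) (abs_nonneg _)
      exact h2.2.trans (mul_le_mul_of_nonneg_right (le_abs_self _) (hN₁ _))
    _ = _ := by ring

/-- The curves of a test pair converge to `e`, so only the germ of the function at `e` matters. -/
lemma Harnack.congr {N₁ N₂ : (ι → ℂ) → ℝ} {X : Finset ι} {e : ι → ℂ} {w : ι → ℝ} {z₀ : ι → ℂ}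
    (hp : TestPair X e w z₀) (hN : ∀ᶠ z in 𝓝 e, N₁ z = N₂ z) (H : Harnack N₂ w z₀) :
    Harnack N₁ w z₀ := by
  obtain ⟨C, hC⟩ := H
  refine ⟨C, ?_⟩
  filter_upwards [hC, (tendsto_prod_left z₀).eventually (hp.tendsto.eventually hN),
    (tendsto_prod_right z₀).eventually (hp.tendsto.eventually hN)] with q h0 h1 h2
  rwa [h1, h2]

/-- The limit is joint in `t` and in the base point, so `N` lies between `L / 2 * t ^ ν` and `2 * L
* t ^ ν` on all nearby curves. -/
lemma harnack_of_tendsto {N : (ι → ℂ) → ℝ} {w : ι → ℝ} {z₀ : ι → ℂ} {ν L : ℝ} (hL : 0 < L)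
    (h : Tendsto (fun q : ℝ × (ι → ℂ) => q.1 ^ (-ν) * N (dil w q.1 q.2)) (𝓝[>] 0 ×ˢ 𝓝 z₀) (𝓝 L)) :
    Harnack N w z₀ ∧ ∀ᶠ q : ℝ × (ι → ℂ) in 𝓝[>] 0 ×ˢ 𝓝 z₀, 0 < N (dil w q.1 q.2) := by
  have hlow := (h.eventually (lt_mem_nhds (half_lt_self hL))).and (eventually_pos_prod z₀)
  have hup := h.eventually (gt_mem_nhds (show L < 2 * L by linarith))
  -- The quotient of the bounds `2 * L` and `L / 2`.
  refine ⟨⟨4, ?_⟩, ?_⟩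
  · filter_upwards [(tendsto_prod_left z₀).eventually hup,
      (tendsto_prod_right z₀).eventually hlow] with q h1 h2
    have ht := Real.rpow_pos_of_pos h2.2 (-ν)
    refine le_of_mul_le_mul_left ?_ ht
    have := h2.1
    linarith
  · filter_upwards [hlow] with q h1
    have ht := Real.rpow_pos_of_pos h1.2 (-ν)
    refine pos_of_mul_pos_right ((half_pos hL).trans h1.1) ht.le

/-- Multiplication by a positive function with the Harnack property. -/
lemma harnack_mul_iff {m N : (ι → ℂ) → ℝ} {w : ι → ℝ} {z₀ : ι → ℂ} (hm0 : ∀ z, 0 ≤ m z)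
    (hN0 : ∀ z, 0 ≤ N z) (hm : Harnack m w z₀)
    (hpos : ∀ᶠ q : ℝ × (ι → ℂ) in 𝓝[>] 0 ×ˢ 𝓝 z₀, 0 < m (dil w q.1 q.2)) :
    Harnack (fun z => m z * N z) w z₀ ↔ Harnack N w z₀ := by
  obtain ⟨C', hC'0, hC'⟩ := hm.exists_nonneg hm0
  -- To cancel `m` at the first point, its value at the second point must be bounded by the one at
  -- the first: the Harnack bound for `m` is used with the points exchanged.
  have hsw : Tendsto (fun q : ℝ × (ι → ℂ) × (ι → ℂ) => (q.1, q.2.2, q.2.1))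
      (𝓝[>] 0 ×ˢ (𝓝 z₀ ×ˢ 𝓝 z₀)) (𝓝[>] 0 ×ˢ (𝓝 z₀ ×ˢ 𝓝 z₀)) :=
    tendsto_fst.prodMk ((tendsto_snd.comp tendsto_snd).prodMk (tendsto_fst.comp tendsto_snd))
  constructor
  · intro H
    obtain ⟨C, hC0, hC⟩ := H.exists_nonneg fun z => mul_nonneg (hm0 z) (hN0 z)
    refine ⟨C * C', ?_⟩
    filter_upwards [hC, hsw.eventually hC', (tendsto_prod_left z₀).eventually hpos]
      with q h1 h2 h3
    refine le_of_mul_le_mul_left ?_ h3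
    calc _ ≤ C * (m (dil w q.1 q.2.2) * N (dil w q.1 q.2.2)) := h1
      _ ≤ C * ((C' * m (dil w q.1 q.2.1)) * N (dil w q.1 q.2.2)) :=
        mul_le_mul_of_nonneg_left (mul_le_mul_of_nonneg_right h2 (hN0 _)) hC0
      _ = _ := by ring
  · intro H
    obtain ⟨C, hC0, hC⟩ := H.exists_nonneg hN0
    refine ⟨C' * C, ?_⟩
    filter_upwards [hC, hC'] with q h1 h2
    calc _ ≤ (C' * m (dil w q.1 q.2.2)) * (C * N (dil w q.1 q.2.2)) :=
        mul_le_mul h2 h1 (hN0 _) (mul_nonneg hC'0 (hm0 _))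
      _ = _ := by ring

end Dilation

/-! ### Initial parts of power series along weighted curves -/

section Weights

variable {ι : Type*} [Fintype ι]

/-- The weight of an exponent. -/
def wt (w : ι → ℝ) (α : ι → ℕ) : ℝ := ∑ i, w i * α i

lemma mon_dil (w : ι → ℝ) {t : ℝ} (ht : 0 < t) (z : ι → ℂ) (α : ι → ℕ) :
    mon (dil w t z) α = ((t ^ wt w α : ℝ) : ℂ) * mon z α := by
  simp only [mon, dil, mul_pow, Finset.prod_mul_distrib, wt]
  congr 1
  rw [Real.rpow_sum_of_pos ht, Complex.ofReal_prod]
  refine Finset.prod_congr rfl fun i _ => ?_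
  rw [Real.rpow_mul_natCast ht.le, Complex.ofReal_pow]

lemma continuous_mon (α : ι → ℕ) : Continuous fun z : ι → ℂ => mon z α := by
  unfold mon; fun_prop

lemma TestPair.mon_ne_zero {X : Finset ι} {e : ι → ℂ} {w : ι → ℝ} {z₀ : ι → ℂ}
    (hp : TestPair X e w z₀) {μ : ι → ℕ} (hμ : ∀ i ∉ X, μ i = 0) : mon z₀ μ ≠ 0 := by
  refine Finset.prod_ne_zero_iff.2 fun i _ => ?_
  by_cases hi : i ∈ X
  · exact pow_ne_zero _ (hp.ne_zero i hi)
  · simp [hμ i hi]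

/-- Multiplication by a monomial and a unit does not affect the Harnack property. -/
lemma harnack_mon_mul_iff {X : Finset ι} {e : ι → ℂ} {w : ι → ℝ} {z₀ : ι → ℂ}
    (hp : TestPair X e w z₀) {μ : ι → ℕ} (hμ : ∀ i ∉ X, μ i = 0) {u : (ι → ℂ) → ℂ}
    (hu : ContinuousAt u e) (hu0 : u e ≠ 0) {N : (ι → ℂ) → ℝ} (hN0 : ∀ z, 0 ≤ N z) :
    Harnack (fun z => ‖mon z μ * u z‖ * N z) w z₀ ↔ Harnack N w z₀ := by
  have hL : 0 < ‖mon z₀ μ * u e‖ := norm_pos_iff.2 (mul_ne_zero (hp.mon_ne_zero hμ) hu0)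
  have h1 : Tendsto (fun q : ℝ × (ι → ℂ) => mon q.2 μ) (𝓝[>] 0 ×ˢ 𝓝 z₀) (𝓝 (mon z₀ μ)) :=
    ((continuous_mon μ).tendsto z₀).comp tendsto_snd
  have h2 := (h1.mul (hu.tendsto.comp hp.tendsto)).norm
  have h3 : Tendsto (fun q : ℝ × (ι → ℂ) => q.1 ^ (-wt w μ) *
      ‖mon (dil w q.1 q.2) μ * u (dil w q.1 q.2)‖) (𝓝[>] 0 ×ˢ 𝓝 z₀) (𝓝 ‖mon z₀ μ * u e‖) := by
    refine h2.congr' ?_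
    filter_upwards [eventually_pos_prod z₀] with q hq
    have ht := Real.rpow_pos_of_pos hq (wt w μ)
    rw [mon_dil w hq, mul_assoc, norm_mul _ (_ * _), Complex.norm_real, Real.norm_of_nonneg ht.le,
      Real.rpow_neg hq.le, ← mul_assoc, inv_mul_cancel₀ ht.ne', one_mul]
    rfl
  obtain ⟨h4, h5⟩ := harnack_of_tendsto (N := fun z => ‖mon z μ * u z‖) hL h3
  exact harnack_mul_iff (fun _ => norm_nonneg _) hN0 h4 h5

/-- The part of weight `ν` of the power series with coefficients `c`. -/
def weightPart (c : (ι → ℕ) → ℂ) (w : ι → ℝ) (ν : ℝ) (α : ι → ℕ) : ℂ :=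
  open scoped Classical in if wt w α = ν then c α else 0

lemma summable_weightPart {c : (ι → ℕ) → ℂ} {r : ℝ} (hr : 0 < r)
    (h : Summable fun α => ‖c α‖ * r ^ (∑ i, α i)) (w : ι → ℝ) (ν : ℝ) :
    Summable fun α => ‖weightPart c w ν α‖ * r ^ (∑ i, α i) := by
  refine h.of_nonneg_of_le (fun α => by positivity) fun α => ?_
  unfold weightPart
  split_ifs
  · exact le_rfl
  · simp; positivity

/-- Along the curves each monomial picks up `t ^ wt w α`; after multiplication by `t ^ (-ν)` the
exponents are non-negative and only the terms of weight `ν` survive. Since some weights may be zero,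
infinitely many terms can survive, whence the infinite sum in the limit and the smallness condition
on `z₀`. -/
lemma tendsto_initial {f : (ι → ℂ) → ℂ} {c : (ι → ℕ) → ℂ} {r : ℝ} (h : HasExpansion f c r)
    {w : ι → ℝ} (hw : ∀ i, 0 ≤ w i) {ν : ℝ} (hν : ∀ α, c α ≠ 0 → ν ≤ wt w α) {z₀ : ι → ℂ}
    (hz₀ : ∀ i, w i = 0 → ‖z₀ i‖ < r) :
    Tendsto (fun q : ℝ × (ι → ℂ) => ((q.1 ^ (-ν) : ℝ) : ℂ) * f (dil w q.1 q.2))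
      (𝓝[>] 0 ×ˢ 𝓝 z₀) (𝓝 (∑' α, weightPart c w ν α * mon z₀ α)) := by
  have hball : ∀ᶠ q : ℝ × (ι → ℂ) in 𝓝[>] 0 ×ˢ 𝓝 z₀, ‖dil w q.1 q.2‖ ≤ r := by
    refine ((tendsto_dil hw z₀).norm.eventually (gt_mem_nhds ?_)).mono fun q hq => le_of_lt hq
    refine (pi_norm_lt_iff h.pos).2 fun i => ?_
    split_ifs with hi
    · exact hz₀ i hi
    · simpa using h.pos
  -- A fixed time at which all nearby curves are already in the polydisc of convergence. As `t ^ (wt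
  -- w α - ν)` increases with `t`, the terms at time `t₀` dominate those at all earlier times.
  obtain ⟨t₀, ht₀, ht₀pos⟩ := (hball.curry.and self_mem_nhdsWithin).exists
  have hterm : ∀ {t : ℝ} (_ : 0 < t) (z : ι → ℂ) (α : ι → ℕ),
      ((t ^ (-ν) : ℝ) : ℂ) * (c α * mon (dil w t z) α) =
        ((t ^ (wt w α - ν) : ℝ) : ℂ) * (c α * mon z α) := by
    intro t ht z α
    rw [mon_dil w ht, sub_eq_add_neg, Real.rpow_add ht]
    push_cast; ring
  have hdom : Tendsto (fun q : ℝ × (ι → ℂ) =>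
      ∑' α, ((q.1 ^ (wt w α - ν) : ℝ) : ℂ) * (c α * mon q.2 α))
      (𝓝[>] 0 ×ˢ 𝓝 z₀) (𝓝 (∑' α, weightPart c w ν α * mon z₀ α)) := by
    refine tendsto_tsum_of_dominated_convergence
      (bound := fun α => t₀ ^ (-ν) * (‖c α‖ * r ^ (∑ i, α i))) (h.summable.mul_left _) ?_ ?_
    · intro α
      have hz : Tendsto (fun q : ℝ × (ι → ℂ) => c α * mon q.2 α) (𝓝[>] 0 ×ˢ 𝓝 z₀)
          (𝓝 (c α * mon z₀ α)) :=
        (((continuous_mon α).tendsto z₀).comp tendsto_snd).const_mul (c α)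
      by_cases hc : c α = 0
      · simp [hc, weightPart]
      rcases (hν α hc).eq_or_lt with heq | hlt
      · simpa [weightPart, ← heq] using hz
      · have h1 := (Complex.continuous_ofReal.tendsto _).comp
          ((tendsto_rpow_nhdsGT_zero (sub_pos.2 hlt)).comp
            (tendsto_fst (f := 𝓝[>] (0 : ℝ)) (g := 𝓝 z₀)))
        simpa [weightPart, hlt.ne'] using h1.mul hz
    · have hlt : ∀ᶠ t : ℝ in 𝓝[>] 0, t < t₀ := nhdsWithin_le_nhds (gt_mem_nhds ht₀pos)
      filter_upwards [eventually_pos_prod z₀, tendsto_fst.eventually hlt,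
        tendsto_snd.eventually ht₀] with q hq hqt hqz α
      by_cases hc : c α = 0
      · simp [hc]
      have h1 : ‖mon (dil w t₀ q.2) α‖ ≤ r ^ (∑ i, α i) := norm_mon_le hqz α
      rw [mon_dil w ht₀pos, norm_mul, Complex.norm_real,
        Real.norm_of_nonneg (Real.rpow_pos_of_pos ht₀pos _).le] at h1
      rw [norm_mul, norm_mul, Complex.norm_real,
        Real.norm_of_nonneg (Real.rpow_pos_of_pos hq _).le]
      have h2 : q.1 ^ (wt w α - ν) ≤ t₀ ^ (wt w α - ν) :=
        Real.rpow_le_rpow hq.le hqt.le (sub_nonneg.2 (hν α hc))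
      calc q.1 ^ (wt w α - ν) * (‖c α‖ * ‖mon q.2 α‖)
          ≤ t₀ ^ (wt w α - ν) * (‖c α‖ * ‖mon q.2 α‖) :=
            mul_le_mul_of_nonneg_right h2 (by positivity)
        _ = t₀ ^ (-ν) * (‖c α‖ * (t₀ ^ wt w α * ‖mon q.2 α‖)) := by
            rw [sub_eq_add_neg, Real.rpow_add ht₀pos]; ring
        _ ≤ _ := by
            have := Real.rpow_pos_of_pos ht₀pos (-ν)
            gcongr
  refine hdom.congr' ?_
  filter_upwards [hball, eventually_pos_prod z₀] with q hq hq0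
  rw [← (h.hasSum _ hq).tsum_eq, ← tsum_mul_left]
  exact tsum_congr fun α => (hterm hq0 _ _).symm

/-- For a family of germs, the Harnack property along the curves `t ↦ dil w t z` means that the
initial part of the family does not vanish at `z₀`. -/
lemma harnack_norm_iff {κ : Type*} [Fintype κ] {a : κ → (ι → ℂ) → ℂ} {c : κ → (ι → ℕ) → ℂ} {r : ℝ}
    (h : ∀ k, HasExpansion (a k) (c k) r) {X : Finset ι} {w : ι → ℝ} {z₀ : ι → ℂ}
    (hp : TestPair X 0 w z₀) {ν : ℝ} (hν : ∀ k α, c k α ≠ 0 → ν ≤ wt w α)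
    (hνe : ∃ k α, c k α ≠ 0 ∧ wt w α = ν) :
    Harnack (fun z => ‖fun k => a k z‖) w z₀ ↔
      ∃ k, ∑' α, weightPart (c k) w ν α * mon z₀ α ≠ 0 := by
  obtain ⟨k₀, α₀, hα₀, hα₀ν⟩ := hνe
  have hr := (h k₀).pos
  have hz₀ : ∀ i, w i = 0 → z₀ i = 0 := fun i hi => by simpa [hi] using hp.limit i
  have hlim : ∀ z : ι → ℂ, (∀ i, w i = 0 → ‖z i‖ < r) →
      Tendsto (fun q : ℝ × (ι → ℂ) => q.1 ^ (-ν) * ‖fun k => a k (dil w q.1 q.2)‖)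
      (𝓝[>] 0 ×ˢ 𝓝 z) (𝓝 ‖fun k => ∑' α, weightPart (c k) w ν α * mon z α‖) := by
    intro z hz
    refine (tendsto_pi_nhds.2 fun k => tendsto_initial (h k) hp.nonneg (hν k) hz).norm.congr' ?_
    filter_upwards [eventually_pos_prod z] with q hq
    have : (fun k => ((q.1 ^ (-ν) : ℝ) : ℂ) * a k (dil w q.1 q.2)) =
      ((q.1 ^ (-ν) : ℝ) : ℂ) • fun k => a k (dil w q.1 q.2) := rfl
    rw [this, norm_smul, Complex.norm_real, Real.norm_of_nonneg (Real.rpow_pos_of_pos hq _).le]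
  constructor
  · rintro ⟨C, hC⟩
    by_contra! h0
    have hP0 : ‖fun k => ∑' α, weightPart (c k) w ν α * mon z₀ α‖ = 0 := by
      rw [norm_eq_zero]; exact funext h0
    have hsmall : ∀ᶠ z in 𝓝 z₀, ∀ i, w i = 0 → ‖z i‖ < r := by
      refine eventually_all.2 fun i => ?_
      by_cases hi : w i = 0
      · have : Tendsto (fun z : ι → ℂ => ‖z i‖) (𝓝 z₀) (𝓝 ‖z₀ i‖) :=
          ((continuous_apply i).tendsto z₀).norm
        refine (this.eventually (gt_mem_nhds ?_)).mono fun z hz _ => hz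
        simpa [hz₀ i hi] using hr
      · exact Eventually.of_forall fun z h => absurd h hi
    -- With `z` and `z₀` fixed, let `t → 0` in the Harnack inequality: the initial part at `z` is
    -- bounded by `C` times its value at `z₀`, which is zero.
    have hvan : ∀ᶠ z in 𝓝 z₀, ∀ k, ∑' α, weightPart (c k) w ν α * mon z α = 0 := by
      obtain ⟨pa, hpa, pb, hpb, hab⟩ := eventually_prod_iff.1 hC
      have hpb' : ∀ᶠ z in 𝓝 z₀, pb (z, z₀) := hpb.curry.mono fun z hz => hz.self_of_nhds
      filter_upwards [hpb', hsmall] with z hz hzr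
      have ht : ∀ y : ι → ℂ, Tendsto (fun t : ℝ => (t, y)) (𝓝[>] 0) (𝓝[>] 0 ×ˢ 𝓝 y) := fun y =>
        tendsto_id.prodMk tendsto_const_nhds
      have h1 := (hlim z hzr).comp (ht z)
      have h2 := ((hlim z₀ fun i hi => by simpa [hz₀ i hi] using hr).comp (ht z₀)).const_mul C
      have h3 := le_of_tendsto_of_tendsto h1 h2 (by
        filter_upwards [hpa, self_mem_nhdsWithin] with t hpt ht0
        have h4 := hab hpt hz
        have h5 := Real.rpow_pos_of_pos ht0 (-ν)
        simp only [Function.comp] at h4 ⊢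
        calc _ ≤ _ := mul_le_mul_of_nonneg_left h4 h5.le
          _ = _ := by ring)
      rw [hP0, mul_zero] at h3
      exact fun k => congrFun (norm_le_zero_iff.1 h3) k
    have hexp := HasExpansion.of_summable hr (summable_weightPart hr (h k₀).summable w ν)
    -- The point `z₀` may lie outside the polydisc where the initial series is known to be analytic.
    -- Quasi-homogeneity moves the vanishing to a neighbourhood of `dil w t z₀`, which is inside it.
    obtain ⟨t, ht, ht0⟩ : ∃ t : ℝ, ‖dil w t z₀‖ < r ∧ 0 < t := by
      have h1 : ∀ᶠ q : ℝ × (ι → ℂ) in 𝓝[>] 0 ×ˢ 𝓝 z₀, ‖dil w q.1 q.2‖ < r :=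
        hp.tendsto.norm.eventually (gt_mem_nhds (by simpa using hr))
      obtain ⟨t, ht, ht0⟩ := (h1.curry.and self_mem_nhdsWithin).exists
      exact ⟨t, ht.self_of_nhds, ht0⟩
    have hvan' : (fun z => ∑' α, weightPart (c k₀) w ν α * mon z α) =ᶠ[𝓝 (dil w t z₀)] 0 := by
      have h1 := (continuous_dil w t⁻¹).tendsto (dil w t z₀)
      rw [dil_inv_dil ht0] at h1
      filter_upwards [h1.eventually hvan] with y hy
      have h2 := hy k₀
      rw [← dil_dil_inv (w := w) ht0 y]
      have h3 : ∀ α, weightPart (c k₀) w ν α * mon (dil w t (dil w t⁻¹ y)) α =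
          ((t ^ ν : ℝ) : ℂ) * (weightPart (c k₀) w ν α * mon (dil w t⁻¹ y) α) := fun α => by
        rw [mon_dil w ht0]
        unfold weightPart
        split_ifs with hα
        · rw [hα]; ring
        · ring
      simp only [h3, tsum_mul_left, h2, mul_zero, Pi.zero_apply]
    have hzero := hexp.analyticOnNhd.eqOn_zero_of_preconnected_of_eventuallyEq_zero
      (convex_ball 0 r).isPreconnected (by simpa using ht) hvan'
    have hc := congrFun (hexp.eq_zero (by
      filter_upwards [Metric.ball_mem_nhds (0 : ι → ℂ) hr] with z hz
      exact hzero hz)) α₀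
    exact hα₀ (by simpa [weightPart, hα₀ν] using hc)
  · rintro ⟨k, hk⟩
    refine (harnack_of_tendsto (norm_pos_iff.2 ?_) (hlim z₀ fun i hi => by
      simpa [hz₀ i hi] using hr)).1
    exact fun h0 => hk (congrFun h0 k)

end Weights

/-! ## Expansions with respect to some of the variables -/

section Partial

variable {ι S : Type*} (idx : S ↪ ι)

/-- Extension by zero of an exponent. -/
def extendZero {R : Type*} [Zero R] (σ : S → R) : ι → R := Function.extend idx σ 0

variable {idx}

@[simp] lemma extendZero_apply {R : Type*} [Zero R] (σ : S → R) (s : S) :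
    extendZero idx σ (idx s) = σ s := idx.injective.extend_apply _ _ _

lemma extendZero_of_notMem {R : Type*} [Zero R] (σ : S → R) {i : ι} (hi : i ∉ Set.range idx) :
    extendZero idx σ i = 0 := Function.extend_apply' _ _ _ hi

lemma sub_add_extendZero {α : ι → ℕ} {σ : S → ℕ} (h : ∀ s, α (idx s) = σ s) :
    α - extendZero idx σ + extendZero idx σ = α := by
  ext i
  by_cases hi : i ∈ Set.range idx
  · obtain ⟨s, rfl⟩ := hi
    simp [h s]
  · simp [extendZero_of_notMem σ hi]

variable [Fintype ι] [Fintype S]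

lemma prod_of_eq_one {R : Type*} [CommMonoid R] {f : ι → R} (hf : ∀ i ∉ Set.range idx, f i = 1) :
    ∏ i, f i = ∏ s, f (idx s) := by
  classical
  rw [← Finset.prod_map Finset.univ idx f]
  refine (Finset.prod_subset (Finset.subset_univ _) fun i _ hi => hf i ?_).symm
  simpa using hi

lemma mon_extendZero (z : ι → ℂ) (σ : S → ℕ) :
    mon z (extendZero idx σ) = mon (fun s => z (idx s)) σ := by
  unfold mon
  rw [prod_of_eq_one (idx := idx) fun i hi => by rw [extendZero_of_notMem σ hi, pow_zero]]
  simp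

variable (idx) in
/-- The coefficients of the `σ`-th coefficient, with respect to the variables `idx`, of a power
series. -/
def partialCoeff (c : (ι → ℕ) → ℂ) (σ : S → ℕ) (β : ι → ℕ) : ℂ :=
  open scoped Classical in if ∀ s, β (idx s) = 0 then c (β + extendZero idx σ) else 0

variable (idx) in
/-- The `σ`-th coefficient, with respect to the variables `idx`, of a power series. -/
def partialSum (c : (ι → ℕ) → ℂ) (σ : S → ℕ) (z : ι → ℂ) : ℂ :=
  ∑' β, partialCoeff idx c σ β * mon z β

lemma HasExpansion.partialSum {f : (ι → ℂ) → ℂ} {c : (ι → ℕ) → ℂ} {r : ℝ}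
    (h : HasExpansion f c r) (σ : S → ℕ) :
    HasExpansion (partialSum idx c σ) (partialCoeff idx c σ) r := by
  refine HasExpansion.of_summable h.pos ?_
  have hinj : Function.Injective fun β : ι → ℕ => β + extendZero idx σ := fun _ _ h =>
    add_right_cancel h
  have h0 := h.pos
  refine ((h.summable.comp_injective hinj).mul_right
    ((r ^ (∑ i, extendZero idx σ i))⁻¹)).of_nonneg_of_le (fun β => by positivity) fun β => ?_
  unfold partialCoeff
  simp only [Function.comp, Pi.add_apply, Finset.sum_add_distrib, pow_add]
  split_ifs
  · apply le_of_eq; field_simp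
  · simp; positivity

lemma partialSum_congr (c : (ι → ℕ) → ℂ) (σ : S → ℕ) {z z' : ι → ℂ}
    (h : ∀ i ∉ Set.range idx, z i = z' i) : partialSum idx c σ z = partialSum idx c σ z' := by
  refine tsum_congr fun β => ?_
  unfold partialCoeff
  split_ifs with hβ
  · congr 1
    refine Finset.prod_congr rfl fun i _ => ?_
    by_cases hi : i ∈ Set.range idx
    · obtain ⟨s, rfl⟩ := hi
      simp [hβ s]
    · rw [h i hi]
  · simp

/-- The monomials are grouped by their exponents in the variables `idx`. Subtracting the extension
of `σ` identifies a group with the exponents free of these variables. -/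
lemma HasExpansion.hasSum_partialSum {f : (ι → ℂ) → ℂ} {c : (ι → ℕ) → ℂ} {r : ℝ}
    (h : HasExpansion f c r) {z : ι → ℂ} (hz : ‖z‖ ≤ r) :
    HasSum (fun σ => NewtonFoliation.partialSum idx c σ z * mon (fun s => z (idx s)) σ) (f z) := by
  have h1 := (Equiv.sigmaFiberEquiv
    (fun (α : ι → ℕ) (s : S) => α (idx s))).hasSum_iff.2 (h.hasSum z hz)
  refine h1.sigma fun σ => ?_
  have h2 := (summable_mul_mon (h.partialSum (idx := idx) σ).summable hz).hasSum.mul_right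
    (mon (fun s => z (idx s)) σ)
  let g : {α : ι → ℕ // (fun s => α (idx s)) = σ} → (ι → ℕ) := fun α => α.1 - extendZero idx σ
  have hg : Function.Injective g := fun α β hαβ => Subtype.ext (by
    rw [← sub_add_extendZero (fun s => congrFun α.2 s), ← sub_add_extendZero
      (fun s => congrFun β.2 s)]
    exact congrArg (· + extendZero idx σ) hαβ)
  refine ((hg.hasSum_iff ?_).2 h2).congr_fun ?_ |> id
  · intro β hβ
    have : ¬ ∀ s, β (idx s) = 0 := fun h0 => hβ
      ⟨⟨β + extendZero idx σ, funext fun s => by simp [h0 s]⟩, by simp [g]⟩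
    simp [partialCoeff, this]
  · intro α
    have h0 : ∀ s, (α.1 - extendZero idx σ) (idx s) = 0 := fun s => by
      have := congrFun α.2 s
      simp only [Pi.sub_apply, extendZero_apply]
      exact Nat.sub_eq_zero_of_le this.le
    simp only [Function.comp, g, Equiv.sigmaFiberEquiv, Equiv.coe_fn_mk, partialCoeff, if_pos h0]
    rw [sub_add_extendZero (fun s => congrFun α.2 s), mul_assoc, ← mon_extendZero, ← mon_add,
      sub_add_extendZero (fun s => congrFun α.2 s)]

/-- The coefficients of the expansion with respect to the variables `idx` are unique. -/
lemma HasExpansion.eq_partialSum {f : (ι → ℂ) → ℂ} {c : (ι → ℕ) → ℂ} {r : ℝ}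
    (h : HasExpansion f c r) {s : (S → ℕ) → (ι → ℂ) → ℂ} {r' : ℝ} (hr' : 0 < r')
    (hs : ∀ σ z z', (∀ l ∉ Set.range idx, z l = z' l) → s σ z = s σ z')
    (hsum : ∀ z ∈ Metric.ball (0 : ι → ℂ) r',
      HasSum (fun σ => s σ z * mon (fun i => z (idx i)) σ) (f z))
    {z : ι → ℂ} (hz : ‖z‖ < min r r') (σ : S → ℕ) :
    s σ z = NewtonFoliation.partialSum idx c σ z := by
  classical
  have key : (fun σ => s σ z - NewtonFoliation.partialSum idx c σ z) = 0 := by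
    refine coeff_eq_zero_of_hasSum (lt_min h.pos hr') fun x hx => ?_
    -- The variables `idx` are replaced by a free point `x` and the others are kept. Both families
    -- of coefficients are unchanged, so their differences are the coefficients of a series in `x`
    -- with sum zero.
    set z' : ι → ℂ := fun i => if i ∈ Set.range idx then extendZero idx x i else z i with hz'
    have hz'n : ‖z'‖ < min r r' := by
      refine (pi_norm_lt_iff (lt_min h.pos hr')).2 fun i => ?_
      by_cases hi : i ∈ Set.range idx
      · obtain ⟨t, rfl⟩ := hi
        simpa [hz'] using (norm_le_pi_norm x t).trans_lt hx
      · simp only [hz', if_neg hi]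
        exact (norm_le_pi_norm z i).trans_lt hz
    have hx' : (fun t => z' (idx t)) = x := by ext t; simp [hz']
    have hzz' : ∀ l ∉ Set.range idx, z l = z' l := fun l hl => by
      simp only [hz', if_neg hl]
    have h1 := hsum z' (by simpa using hz'n.trans_le (min_le_right _ _))
    have h2 := h.hasSum_partialSum (idx := idx) (hz'n.trans_le (min_le_left _ _)).le
    have h3 := h1.sub h2
    rw [sub_self] at h3
    refine h3.congr_fun ?_ |> id
    intro τ
    rw [hs τ z z' hzz', partialSum_congr c τ hzz', hx', sub_mul]
  exact sub_eq_zero.1 (congrFun key σ)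

lemma wt_extendZero (v : S → ℝ) (α : ι → ℕ) :
    wt (extendZero idx v) α = ∑ s, v s * α (idx s) := by
  classical
  unfold wt
  rw [← Finset.sum_subset (Finset.subset_univ (Finset.univ.map idx))]
  · simp [Finset.sum_map]
  · intro i _ hi
    rw [extendZero_of_notMem v (by simpa using hi), zero_mul]

end Partial

/-! ### Minimum of a vector of weights on a set of exponents -/

section WeightOf

variable {S : Type*} [DecidableEq S]

lemma linear_eq_sum [Fintype S] (ρ : (S → ℝ) →ₗ[ℝ] ℝ) (v : S → ℝ) :
    ρ v = ∑ s, ρ (Pi.single s 1) * v s := by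
  conv_lhs => rw [pi_eq_sum_univ' v]
  simp [mul_comm]

lemma IsWeight.single_pos {ρ : (S → ℝ) →ₗ[ℝ] ℝ} (h : IsWeight ρ) (s : S) :
    0 < ρ (Pi.single s 1) :=
  h _ (fun h0 => by simpa using congrFun h0 s) fun i => by
    by_cases hi : i = s
    · subst hi; simp
    · simp [hi]

variable [Fintype S]

/-- Every basis vector has positive weight, so a bound on the weight bounds each entry of the
exponent. It makes the infimum in `rhoValue` a minimum and the initial forms finite sums. -/
lemma IsWeight.finite_le {ρ : (S → ℝ) →ₗ[ℝ] ℝ} (h : IsWeight ρ) (C : ℝ) :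
    {σ : S → ℕ | weightOf ρ σ ≤ C}.Finite := by
  refine (Set.finite_Iic fun s => ⌊C / ρ (Pi.single s 1)⌋₊).subset fun σ hσ s => ?_
  refine Nat.le_floor ((le_div_iff₀ (h.single_pos s)).2 ?_)
  have h1 : weightOf ρ σ ≤ C := hσ
  rw [weightOf, linear_eq_sum] at h1
  refine le_trans ?_ h1
  rw [mul_comm]
  exact Finset.single_le_sum (f := fun s => ρ (Pi.single s 1) * (σ s : ℝ))
    (fun s _ => mul_nonneg (h.single_pos s).le (Nat.cast_nonneg _)) (Finset.mem_univ s)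

lemma IsWeight.isLeast_rhoValue {ρ : (S → ℝ) →ₗ[ℝ] ℝ} (h : IsWeight ρ) {A : Set (S → ℕ)}
    (hA : A.Nonempty) : IsLeast (weightOf ρ '' A) (rhoValue ρ A) := by
  obtain ⟨σ₀, hσ₀⟩ := hA
  obtain ⟨σ, hσ, hmin⟩ := ((h.finite_le (weightOf ρ σ₀)).inter_of_right A).exists_minimalFor
    (weightOf ρ) _ ⟨σ₀, hσ₀, le_refl (weightOf ρ σ₀)⟩
  have hl : IsLeast (weightOf ρ '' A) (weightOf ρ σ) := by
    refine ⟨mem_image_of_mem _ hσ.1, ?_⟩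
    rintro _ ⟨τ, hτ, rfl⟩
    by_contra! hlt
    exact absurd (hmin ⟨hτ, (hlt.le.trans hσ.2)⟩ hlt.le) (not_le.2 hlt)
  rwa [rhoValue, hl.csInf_eq]

end WeightOf

/-! ## Newton non-degeneracy as a Harnack property -/

lemma exists_hasExpansion_family {ι κ : Type*} [Fintype ι] [Finite κ] {a : κ → (ι → ℂ) → ℂ}
    (ha : ∀ k, AnalyticAt ℂ (a k) 0) : ∃ (c : κ → (ι → ℕ) → ℂ) (r : ℝ),
      0 < r ∧ ∀ k, HasExpansion (a k) (c k) r := by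
  choose c r h using fun k => exists_hasExpansion (ha k)
  have h1 : ∀ᶠ ε : ℝ in 𝓝[>] 0, ∀ k, ε ≤ r k := eventually_all.2 fun k =>
    nhdsWithin_le_nhds ((gt_mem_nhds (h k).pos).mono fun _ => le_of_lt)
  obtain ⟨ε, hε, hε0⟩ := (h1.and self_mem_nhdsWithin).exists
  exact ⟨c, ε, hε0, fun k => (h k).mono hε0 (hε k)⟩

section Adapted

variable {n : ℕ} {M I : Type*} [TopologicalSpace M] [ChartedSpace (Fin n → ℂ) M]
  {E : I → Set M} {p : M}


lemma AdaptedCoords.mem_divisorIdx (c : AdaptedCoords n E p) {k : Fin n} :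
    k ∈ c.divisorIdx ↔ k ∈ Set.range c.idx := by
  simp [AdaptedCoords.divisorIdx]

variable [Fintype I]

open scoped Classical in
lemma monomialAt_eq_mon {M I : Type*} {E : I → Set M} {p : M} [Fintype I]
    (T : StratumIndex E p → ℂ) (σ : StratumIndex E p → ℕ) : monomialAt T σ = mon T σ := rfl

lemma exists_isExpansion (c : AdaptedCoords n E p) {a : Fin n → (Fin n → ℂ) → ℂ}
    (ha : ∀ k, AnalyticAt ℂ (a k) 0) : ∃ s, IsExpansion c a s := by
  classical
  obtain ⟨cc, r, hr, h⟩ := exists_hasExpansion_family ha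
  refine ⟨fun k σ => partialSum c.idx (cc k) σ, r, hr, fun k => ⟨fun σ =>
    ((h k).partialSum σ).analyticOnNhd, fun σ z z' hz => partialSum_congr _ _ hz, fun z hz => ?_⟩⟩
  exact (h k).hasSum_partialSum (by simpa using (mem_ball_zero_iff.1 hz).le)

open scoped Classical in
lemma IsExpansion.exists_eq_partialSum {c : AdaptedCoords n E p} {a : Fin n → (Fin n → ℂ) → ℂ}
    {s : Fin n → (StratumIndex E p → ℕ) → (Fin n → ℂ) → ℂ} (hs : IsExpansion c a s)
    {cc : Fin n → (Fin n → ℕ) → ℂ} {r : ℝ} (hr : 0 < r) (h : ∀ k, HasExpansion (a k) (cc k) r) :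
    ∃ ε > 0, ∀ z : Fin n → ℂ, ‖z‖ < ε → ∀ k σ, s k σ z = partialSum c.idx (cc k) σ z := by
  obtain ⟨r', hr', hs⟩ := hs
  exact ⟨min r r', lt_min hr hr', fun z hz k σ =>
    (h k).eq_partialSum hr' (hs k).2.1 (hs k).2.2 hz σ⟩

lemma partialSum_zero {ι S : Type*} [Fintype ι] [Fintype S] {idx : S ↪ ι} (c : (ι → ℕ) → ℂ) (σ : S → ℕ) :
    partialSum idx c σ 0 = c (extendZero idx σ) := by
  rw [partialSum, tsum_eq_single 0]
  · simp [partialCoeff, mon_zero_right]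
  · intro β hβ
    obtain ⟨i, hi⟩ : ∃ i, β i ≠ 0 := by
      by_contra! h; exact hβ (funext h)
    rw [mon, Finset.prod_eq_zero (Finset.mem_univ i), mul_zero]
    simp [hi]

-- Near the origin `s k σ` is a power series in the remaining variables, and it is the zero germ
-- only if its coefficients vanish. The support is thus the projection to the divisor variables of
-- the exponents of the full expansion.
open scoped Classical in
lemma IsExpansion.mem_expansionSupport_iff {c : AdaptedCoords n E p}
    {a : Fin n → (Fin n → ℂ) → ℂ}
    {s : Fin n → (StratumIndex E p → ℕ) → (Fin n → ℂ) → ℂ} (hs : IsExpansion c a s)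
    {cc : Fin n → (Fin n → ℕ) → ℂ} {r : ℝ} (hr : 0 < r) (h : ∀ k, HasExpansion (a k) (cc k) r)
    (σ : StratumIndex E p → ℕ) :
    σ ∈ expansionSupport s ↔ ∃ k α, (∀ i, α (c.idx i) = σ i) ∧ cc k α ≠ 0 := by
  obtain ⟨ε, hε, heq⟩ := hs.exists_eq_partialSum hr h
  have hev : ∀ᶠ z in 𝓝 (0 : Fin n → ℂ), ∀ k σ, s k σ z = partialSum c.idx (cc k) σ z := by
    filter_upwards [Metric.ball_mem_nhds (0 : Fin n → ℂ) hε] with z hz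
    exact heq z (by simpa using hz)
  constructor
  · rintro ⟨k, hk⟩
    by_contra! h0
    refine hk (hev.mono fun z hz => ?_)
    rw [hz, partialSum, ← tsum_zero]
    refine tsum_congr fun β => ?_
    unfold partialCoeff
    split_ifs with hβ
    · rw [h0 k _ fun i => by simp [hβ i], zero_mul]
    · rw [zero_mul]
  · rintro ⟨k, α, hα, hne⟩
    refine ⟨k, fun h0 => hne ?_⟩
    have h1 := ((h k).partialSum (idx := c.idx) σ).eq_zero ((h0.and hev).mono fun z hz => by
      rw [← hz.2, hz.1])
    have h2 := congrFun h1 (α - extendZero c.idx σ)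
    have h3 : ∀ i, (α - extendZero c.idx σ) (c.idx i) = 0 := fun i => by simp [hα i]
    rwa [partialCoeff, if_pos h3, sub_add_extendZero hα] at h2

-- The weights and the torus point are extended by zero to the variables `y`. The minimal weight is
-- then the same in all the variables, and the monomials involving some `y` vanish at the extended
-- point, so the initial part there is the initial form over `p`.
open scoped Classical in
lemma IsExpansion.initialForm_ne_zero_iff {c : AdaptedCoords n E p} {a : Fin n → (Fin n → ℂ) → ℂ}
    {s : Fin n → (StratumIndex E p → ℕ) → (Fin n → ℂ) → ℂ} (hs : IsExpansion c a s)
    (ha : ∀ k, AnalyticAt ℂ (a k) 0) (hne : ∃ k, ¬ ∀ᶠ z in 𝓝 0, a k z = 0)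
    {ρ : (StratumIndex E p → ℝ) →ₗ[ℝ] ℝ} (hρ : IsWeight ρ) (T : StratumIndex E p → ℂ)
    (hp : TestPair c.divisorIdx 0 (extendZero c.idx fun i => ρ (Pi.single i 1))
      (extendZero c.idx T)) :
    Harnack (fun z => ‖fun k => a k z‖) (extendZero c.idx fun i => ρ (Pi.single i 1))
      (extendZero c.idx T) ↔ ∃ k, initialForm s ρ k 0 T ≠ 0 := by
  obtain ⟨cc, r, hr, h⟩ := exists_hasExpansion_family ha
  set w : Fin n → ℝ := extendZero c.idx fun i => ρ (Pi.single i 1) with hw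
  set ν := rhoValue ρ (expansionSupport s) with hν
  have hwt : ∀ α : Fin n → ℕ, wt w α = weightOf ρ fun i => α (c.idx i) := fun α => by
    rw [hw, wt_extendZero, weightOf, linear_eq_sum]
  have hsupp := hs.mem_expansionSupport_iff hr h
  obtain ⟨k₀, α₀, hα₀⟩ : ∃ k α, cc k α ≠ 0 := by
    by_contra! h0
    obtain ⟨k, hk⟩ := hne
    refine hk ?_
    filter_upwards [Metric.closedBall_mem_nhds 0 hr] with z hz
    have := (h k).hasSum z (by simpa using hz)
    simp only [h0, zero_mul] at this
    exact this.unique hasSum_zero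
  have hleast := hρ.isLeast_rhoValue (A := expansionSupport s)
    ⟨_, (hsupp _).2 ⟨k₀, α₀, fun _ => rfl, hα₀⟩⟩
  rw [harnack_norm_iff h hp (ν := ν)]
  · obtain ⟨ε, hε, heq⟩ := hs.exists_eq_partialSum hr h
    refine exists_congr fun k => not_congr (Eq.congr_left ?_)
    have hs0 : ∀ σ, s k σ 0 = cc k (extendZero c.idx σ) := fun σ => by
      rw [heq 0 (by simpa using hε), partialSum_zero]
    have hinj : Function.Injective fun σ : StratumIndex E p → ℕ => extendZero c.idx σ :=
      fun σ τ hστ => funext fun i => by simpa using congrFun hστ (c.idx i)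
    -- Only exponents supported on the divisor variables contribute; the second goal checks that
    -- every other term contains a vanishing factor.
    rw [← hinj.tsum_eq]
    · have hterm : ∀ σ : StratumIndex E p → ℕ, weightPart (cc k) w ν (extendZero c.idx σ) *
          mon (extendZero c.idx T) (extendZero c.idx σ) =
          {σ : StratumIndex E p → ℕ | weightOf ρ σ = ν}.indicator
            (fun σ => s k σ 0 * monomialAt T σ) σ := fun σ => by
        rw [mon_extendZero, weightPart, hwt, Set.indicator_apply]
        simp only [extendZero_apply, monomialAt_eq_mon, Set.mem_ofPred_eq, hs0, ite_mul, zero_mul]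
      simp only [hterm]
      rw [initialForm, tsum_eq_finsum, finsum_mem_def]
      exact ((hρ.finite_le ν).subset fun σ hσ => le_of_eq hσ).subset
        Set.support_indicator_subset
    · intro α hα
      refine ⟨fun i => α (c.idx i), funext fun i => ?_⟩
      by_cases hi : i ∈ Set.range c.idx
      · obtain ⟨j, rfl⟩ := hi
        simp
      · simp only [extendZero_of_notMem _ hi]
        by_contra h0
        refine hα ?_
        beta_reduce
        rw [mon, Finset.prod_eq_zero (Finset.mem_univ i), mul_zero]
        simp [extendZero_of_notMem T hi, Ne.symm h0]
  · intro k α hα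
    rw [hwt]
    exact hleast.2 ⟨_, (hsupp _).2 ⟨k, α, fun _ => rfl, hα⟩, rfl⟩
  · obtain ⟨σ, hσ, hσν⟩ := hleast.1
    obtain ⟨k, α, hα, hne⟩ := (hsupp σ).1 hσ
    refine ⟨k, α, hne, ?_⟩
    rw [hwt, funext hα, hσν]

/-- The Newton non-degeneracy conditions for a family of coefficients mean that the family has the
Harnack property along all the test curves. -/
theorem IsExpansion.nondegenerate_iff {c : AdaptedCoords n E p} {a : Fin n → (Fin n → ℂ) → ℂ}
    {s : Fin n → (StratumIndex E p → ℕ) → (Fin n → ℂ) → ℂ} (hs : IsExpansion c a s)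
    (ha : ∀ k, AnalyticAt ℂ (a k) 0) (hne : ∃ k, ¬ ∀ᶠ z in 𝓝 0, a k z = 0) :
    (∀ Φ, IsCompactFace (expansionSupport s) Φ → NondegenerateWrtFace s Φ) ↔
      ∀ w z₀, TestPair c.divisorIdx 0 w z₀ → Harnack (fun z => ‖fun k => a k z‖) w z₀ := by
  classical
  constructor
  · intro H w z₀ hp
    set ρ : (StratumIndex E p → ℝ) →ₗ[ℝ] ℝ :=
      ∑ i, w (c.idx i) • LinearMap.proj i with hρdef
    -- A divisor coordinate of weight zero would keep its non-zero value in the limit, but here the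
    -- limit is the origin.
    have hwpos : ∀ i, 0 < w (c.idx i) := fun i => by
      refine (hp.nonneg _).lt_of_ne' fun h0 => ?_
      have := hp.limit (c.idx i)
      rw [if_pos h0] at this
      exact hp.ne_zero _ (c.mem_divisorIdx.2 ⟨i, rfl⟩) this
    have hρv : ∀ v, ρ v = ∑ i, w (c.idx i) * v i := fun v => by simp [hρdef]
    have hρ : IsWeight ρ := by
      intro v hv hv0
      rw [hρv]
      obtain ⟨i, hi⟩ : ∃ i, v i ≠ 0 := by
        by_contra! h; exact hv (funext h)
      exact Finset.sum_pos' (fun i _ => mul_nonneg (hwpos i).le (hv0 i))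
        ⟨i, Finset.mem_univ i, mul_pos (hwpos i) ((hv0 i).lt_of_ne' hi)⟩
    have hwe : w = extendZero c.idx fun i => ρ (Pi.single i 1) := by
      funext k
      by_cases hk : k ∈ Set.range c.idx
      · obtain ⟨i, rfl⟩ := hk
        simp [hρv, Pi.single_apply]
      · rw [extendZero_of_notMem _ hk]
        by_contra h0
        exact hk (c.mem_divisorIdx.1 (hp.mem k ((hp.nonneg k).lt_of_ne' h0)))
    -- The other coordinates have weight zero and limit zero, so they vanish at `z₀`. The test pairs
    -- at the origin are therefore exactly the pairs of a vector of weights and a torus point,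
    -- extended by zero.
    have hze : z₀ = extendZero c.idx fun i => z₀ (c.idx i) := by
      funext k
      by_cases hk : k ∈ Set.range c.idx
      · obtain ⟨i, rfl⟩ := hk
        simp
      · rw [extendZero_of_notMem _ hk]
        have h1 := hp.limit k
        rwa [hwe, extendZero_of_notMem _ hk, if_pos rfl] at h1
    have hT := hp.ne_zero
    rw [hwe, hze] at hp ⊢
    rw [hs.initialForm_ne_zero_iff ha hne hρ _ hp]
    by_contra! h0
    exact H _ ⟨ρ, hρ, rfl⟩ ρ hρ rfl
      ⟨_, fun i => hT _ (c.mem_divisorIdx.2 ⟨i, rfl⟩), h0⟩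
  · rintro H Φ - ρ hρ - ⟨T, hT, h0⟩
    have hp : TestPair c.divisorIdx 0 (extendZero c.idx fun i => ρ (Pi.single i 1))
        (extendZero c.idx T) := by
      refine ⟨fun k => ?_, fun k hk => ?_, fun k hk => ?_, fun k => ?_⟩
      · by_cases hk : k ∈ Set.range c.idx
        · obtain ⟨i, rfl⟩ := hk
          simpa using (hρ.single_pos i).le
        · rw [extendZero_of_notMem _ hk]
      · by_contra h1
        rw [extendZero_of_notMem _ (mt c.mem_divisorIdx.2 h1)] at hk
        exact hk.false
      · obtain ⟨i, rfl⟩ := c.mem_divisorIdx.1 hk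
        simpa using hT i
      · by_cases hk : k ∈ Set.range c.idx
        · obtain ⟨i, rfl⟩ := hk
          simp [(hρ.single_pos i).ne']
        · simp [extendZero_of_notMem _ hk]
    obtain ⟨k, hk⟩ := (hs.initialForm_ne_zero_iff ha hne hρ T hp).1 (H _ _ hp)
    exact hk (h0 k)

end Adapted

/-! ## Coefficients of one-forms in a chart -/

lemma ContMDiffAt.analyticAt_vectorSpace {V W : Type*} [NormedAddCommGroup V] [NormedSpace ℂ V]
    [NormedAddCommGroup W] [NormedSpace ℂ W] [CompleteSpace W] {f : V → W} {x : V}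
    (h : ContMDiffAt 𝓘(ℂ, V) 𝓘(ℂ, W) ω f x) : AnalyticAt ℂ f x := by
  have h1 : ContDiffAt ℂ ω f x := contMDiffAt_iff_contDiffAt.1 h
  rw [← contDiffWithinAt_univ, contDiffWithinAt_omega_iff_analyticWithinAt,
    analyticWithinAt_univ] at h1
  exact h1

section Coeff

variable {n : ℕ} {M M' : Type*} [TopologicalSpace M] [ChartedSpace (Fin n → ℂ) M]
  [TopologicalSpace M'] [ChartedSpace (Fin n → ℂ) M']

/-- The coefficients of a one-form in a chart, as functions of the coordinates. -/
def coeff (φ : OpenPartialHomeomorph M (Fin n → ℂ)) (α : OneForm n M) (k : Fin n)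
    (z : Fin n → ℂ) : ℂ :=
  α (φ.symm z) (mfderiv 𝓘(ℂ, Fin n → ℂ) 𝓘(ℂ, Fin n → ℂ) φ.symm z (Pi.single k (1 : ℂ) : Fin n → ℂ))

variable {φ : OpenPartialHomeomorph M (Fin n → ℂ)} {φ' : OpenPartialHomeomorph M' (Fin n → ℂ)}

lemma contMDiffAt_chart (hφ : φ ∈ coordSystems n M) {q : M} (hq : q ∈ φ.source) :
    ContMDiffAt 𝓘(ℂ, Fin n → ℂ) 𝓘(ℂ, Fin n → ℂ) ω φ q :=
  contMDiffAt_of_mem_maximalAtlas hφ hq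

lemma contMDiffAt_chart_symm (hφ : φ ∈ coordSystems n M) {z : Fin n → ℂ} (hz : z ∈ φ.target) :
    ContMDiffAt 𝓘(ℂ, Fin n → ℂ) 𝓘(ℂ, Fin n → ℂ) ω φ.symm z :=
  contMDiffAt_symm_of_mem_maximalAtlas hφ hz

lemma coordSystems_mdifferentiable (hφ : φ ∈ coordSystems n M) :
    φ.MDifferentiable 𝓘(ℂ, Fin n → ℂ) 𝓘(ℂ, Fin n → ℂ) :=
  ⟨fun _ hq => ((contMDiffAt_chart hφ hq).mdifferentiableAt (by simp)).mdifferentiableWithinAt,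
   fun _ hz => ((contMDiffAt_chart_symm hφ hz).mdifferentiableAt
    (by simp)).mdifferentiableWithinAt⟩

lemma analyticAt_writtenIn (hφ : φ ∈ coordSystems n M) (hφ' : φ' ∈ coordSystems n M')
    {π : M' → M} {q : M'} (hπ : ContMDiffAt 𝓘(ℂ, Fin n → ℂ) 𝓘(ℂ, Fin n → ℂ) ω π q)
    (hq : q ∈ φ'.source) (hπq : π q ∈ φ.source) :
    AnalyticAt ℂ (fun z => φ (π (φ'.symm z))) (φ' q) := by
  have h1 := contMDiffAt_chart_symm hφ' (φ'.map_source hq)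
  have h2 : ContMDiffAt 𝓘(ℂ, Fin n → ℂ) 𝓘(ℂ, Fin n → ℂ) ω π (φ'.symm (φ' q)) := by
    rwa [φ'.left_inv hq]
  have h3 : ContMDiffAt 𝓘(ℂ, Fin n → ℂ) 𝓘(ℂ, Fin n → ℂ) ω φ (π (φ'.symm (φ' q))) := by
    rw [φ'.left_inv hq]; exact contMDiffAt_chart hφ hπq
  exact ContMDiffAt.analyticAt_vectorSpace (ContMDiffAt.comp (f := fun z => π (φ'.symm z)) (φ' q) h3
    (h2.comp (φ' q) h1))

lemma analyticAt_comp_symm (hφ : φ ∈ coordSystems n M) {h : M → ℂ} {q : M}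
    (hh : ContMDiffAt 𝓘(ℂ, Fin n → ℂ) 𝓘(ℂ, ℂ) ω h q) (hq : q ∈ φ.source) :
    AnalyticAt ℂ (fun z => h (φ.symm z)) (φ q) := by
  have h1 := contMDiffAt_chart_symm hφ (φ.map_source hq)
  have h2 : ContMDiffAt 𝓘(ℂ, Fin n → ℂ) 𝓘(ℂ, ℂ) ω h (φ.symm (φ q)) := by
    rwa [φ.left_inv hq]
  exact ContMDiffAt.analyticAt_vectorSpace (h2.comp _ h1)

lemma contMDiffAt_comp_chart (hφ : φ ∈ coordSystems n M) {g : (Fin n → ℂ) → ℂ} {q : M}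
    (hg : AnalyticAt ℂ g (φ q)) (hq : q ∈ φ.source) :
    ContMDiffAt 𝓘(ℂ, Fin n → ℂ) 𝓘(ℂ, ℂ) ω (fun r => g (φ r)) q :=
  (contMDiffAt_iff_contDiffAt.2 hg.contDiffAt).comp q (contMDiffAt_chart hφ hq)

lemma tendsto_symm {M V : Type*} [TopologicalSpace M] [TopologicalSpace V]
    {φ : OpenPartialHomeomorph M V} {q : M} (hq : q ∈ φ.source) : Tendsto φ.symm (𝓝 (φ q)) (𝓝 q) := by
  have := (φ.continuousAt_symm (φ.map_source hq)).tendsto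
  rwa [φ.left_inv hq] at this

lemma eventually_mem_target {M V : Type*} [TopologicalSpace M] [TopologicalSpace V]
    {φ : OpenPartialHomeomorph M V} {q : M} (hq : q ∈ φ.source) : ∀ᶠ z in 𝓝 (φ q), z ∈ φ.target :=
  φ.open_target.mem_nhds (φ.map_source hq)

/-- Linear algebra kept apart from the tangent spaces: with `A` and `B` the derivatives of an
inverse chart and of the chart, this is the expansion of a linear form in the coordinate coframe. -/
lemma apply_eq_sum_of_comp_eq_id (L : (Fin n → ℂ) →L[ℂ] ℂ) {A B : (Fin n → ℂ) →L[ℂ] (Fin n → ℂ)}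
    (h : A.comp B = ContinuousLinearMap.id ℂ _) (v : Fin n → ℂ) :
    L v = ∑ l, L (A (Pi.single l 1)) * B v l := by
  have h2 : A (B v) = v := DFunLike.congr_fun h v
  conv_lhs => rw [← h2, ← Finset.univ_sum_single (B v)]
  rw [map_sum, map_sum]
  refine Finset.sum_congr rfl fun l _ => ?_
  have h5 : (Pi.single l (B v l) : Fin n → ℂ) = B v l • (Pi.single l 1 : Fin n → ℂ) := by
    rw [← Pi.single_smul, smul_eq_mul, mul_one]
  rw [h5, map_smul, map_smul, smul_eq_mul, mul_comm]

lemma sum_smul_proj_apply (f : Fin n → ℂ) {A B : (Fin n → ℂ) →L[ℂ] (Fin n → ℂ)}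
    (h : B.comp A = ContinuousLinearMap.id ℂ _) (k : Fin n) :
    (∑ l, f l • (ContinuousLinearMap.proj (R := ℂ) (φ := fun _ : Fin n => ℂ) l).comp B)
      (A (Pi.single k 1)) = f k := by
  have h2 : B (A (Pi.single k 1)) = Pi.single k 1 :=
    DFunLike.congr_fun h (Pi.single k (1 : ℂ) : Fin n → ℂ)
  simp [h2, Pi.single_apply, _root_.sum_apply]

lemma apply_congr (α : OneForm n M) {q r : M} (h : r = q) (v : Fin n → ℂ) :
    (α r : (Fin n → ℂ) →L[ℂ] ℂ) v = (α q : (Fin n → ℂ) →L[ℂ] ℂ) v := by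
  rw [h]

lemma apply_eq_sum_coeff (hφ : φ ∈ coordSystems n M) (α : OneForm n M) {q : M}
    (hq : q ∈ φ.source) (v : Fin n → ℂ) :
    α q v = ∑ l, coeff φ α l (φ q) *
      (mfderiv 𝓘(ℂ, Fin n → ℂ) 𝓘(ℂ, Fin n → ℂ) φ q v : Fin n → ℂ) l := by
  have h1 := (coordSystems_mdifferentiable hφ).symm_comp_deriv hq
  refine (apply_eq_sum_of_comp_eq_id (α q)
    (A := mfderiv 𝓘(ℂ, Fin n → ℂ) 𝓘(ℂ, Fin n → ℂ) φ.symm (φ q))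
    (B := mfderiv 𝓘(ℂ, Fin n → ℂ) 𝓘(ℂ, Fin n → ℂ) φ q) h1 v).trans ?_
  exact Finset.sum_congr rfl fun l _ =>
    congrArg (· * _) (apply_congr α (φ.left_inv hq) _).symm

lemma coeff_coordForm (hφ : φ ∈ coordSystems n M) (f : Fin n → (Fin n → ℂ) → ℂ) (k : Fin n)
    {z : Fin n → ℂ} (hz : z ∈ φ.target) : coeff φ (coordForm φ f) k z = f k z := by
  have hmd := coordSystems_mdifferentiable hφ
  have hq := φ.map_target hz
  have h3 : ∀ l, differential (n := n) (fun r => φ r l) (φ.symm z) =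
      (ContinuousLinearMap.proj (R := ℂ) (φ := fun _ : Fin n => ℂ) l).comp
        (mfderiv 𝓘(ℂ, Fin n → ℂ) 𝓘(ℂ, Fin n → ℂ) φ (φ.symm z)) := fun l => by
    have h4 : HasMFDerivAt 𝓘(ℂ, Fin n → ℂ) 𝓘(ℂ, ℂ)
        (ContinuousLinearMap.proj (R := ℂ) (φ := fun _ : Fin n => ℂ) l) (φ (φ.symm z))
        (ContinuousLinearMap.proj (R := ℂ) (φ := fun _ : Fin n => ℂ) l) :=
      (ContinuousLinearMap.proj (R := ℂ) (φ := fun _ : Fin n => ℂ) l).hasMFDerivAt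
    exact (h4.comp (φ.symm z) (hmd.mdifferentiableAt hq).hasMFDerivAt).mfderiv
  have h5 := sum_smul_proj_apply (fun l => f l z)
    (A := mfderiv 𝓘(ℂ, Fin n → ℂ) 𝓘(ℂ, Fin n → ℂ) φ.symm z)
    (B := mfderiv 𝓘(ℂ, Fin n → ℂ) 𝓘(ℂ, Fin n → ℂ) φ (φ.symm z)) (hmd.comp_symm_deriv hz) k
  refine Eq.trans ?_ h5
  unfold coeff coordForm
  simp only [h3, φ.right_inv hz]
  rfl

lemma coeff_smul {α β : OneForm n M} {h : M → ℂ} {r : M} (hr : r ∈ φ.source)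
    (hα : β r = h r • α r) (k : Fin n) :
    coeff φ β k (φ r) = h r * coeff φ α k (φ r) := by
  unfold coeff
  rw [φ.left_inv hr, hα]
  rfl

lemma eventually_coeff_smul {α β : OneForm n M} {h : M → ℂ} {q : M} (hq : q ∈ φ.source)
    (hα : ∀ᶠ r in 𝓝 q, β r = h r • α r) :
    ∀ᶠ z in 𝓝 (φ q), ∀ k, coeff φ β k z = h (φ.symm z) * coeff φ α k z := by
  filter_upwards [(tendsto_symm hq).eventually hα, eventually_mem_target hq] with z hz hzt k
  have := coeff_smul (φ.map_target hzt) hz k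
  rwa [φ.right_inv hzt] at this

/-- The coefficients of a pull-back. -/
lemma coeff_pullback (hφ : φ ∈ coordSystems n M) (hφ' : φ' ∈ coordSystems n M')
    {π : M' → M} (α : OneForm n M) {z : Fin n → ℂ} (hz : z ∈ φ'.target)
    (hπ : ContMDiffAt 𝓘(ℂ, Fin n → ℂ) 𝓘(ℂ, Fin n → ℂ) ω π (φ'.symm z))
    (hπz : π (φ'.symm z) ∈ φ.source) (k : Fin n) :
    coeff φ' (pullback π α) k z = ∑ l, coeff φ α l (φ (π (φ'.symm z))) *
      fderiv ℂ (fun z => φ (π (φ'.symm z))) z (Pi.single k 1) l := by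
  have hmd := (coordSystems_mdifferentiable hφ).mdifferentiableAt hπz
  have hmd' := (coordSystems_mdifferentiable hφ').mdifferentiableAt_symm hz
  have h1 := (HasMFDerivAt.comp (f := π ∘ φ'.symm) z hmd.hasMFDerivAt
    ((hπ.mdifferentiableAt (by simp)).hasMFDerivAt.comp z hmd'.hasMFDerivAt)).mfderiv
  rw [mfderiv_eq_fderiv] at h1
  have h2 : (fun z => φ (π (φ'.symm z))) = φ ∘ π ∘ φ'.symm := rfl
  rw [h2, h1]
  exact apply_eq_sum_coeff hφ α hπz _

/-- The change of the coefficients under a change of charts. -/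
lemma coeff_change {ψ : OpenPartialHomeomorph M (Fin n → ℂ)}
    (hφ : φ ∈ coordSystems n M) (hψ : ψ ∈ coordSystems n M) (α : OneForm n M) {z : Fin n → ℂ}
    (hz : z ∈ ψ.target) (hz' : ψ.symm z ∈ φ.source) (k : Fin n) :
    coeff ψ α k z = ∑ l, coeff φ α l (φ (ψ.symm z)) *
      fderiv ℂ (fun z => φ (ψ.symm z)) z (Pi.single k 1) l := by
  have h := coeff_pullback hφ hψ (π := id) α hz contMDiffAt_id hz' k
  have h2 : pullback id α = α := by
    funext r
    change (α r).comp (mfderiv 𝓘(ℂ, Fin n → ℂ) 𝓘(ℂ, Fin n → ℂ) id r) = α r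
    rw [mfderiv_id]
    rfl
  rw [h2] at h
  exact h

end Coeff

/-! ## Generators and logarithmic generators -/

section NoCommonFactor

variable {n : ℕ}

lemma NoCommonFactor.exists_ne_zero {f : Fin n → (Fin n → ℂ) → ℂ} {e : Fin n → ℂ}
    (h : NoCommonFactor f e) : ∃ k, ¬ ∀ᶠ z in 𝓝 e, f k z = 0 := by
  by_contra! h0
  exact h (fun _ => 0) analyticAt_const (fun k => ⟨fun _ => 0, analyticAt_const,
    (h0 k).mono fun z hz => by rw [hz, zero_mul]⟩) rfl

lemma analyticAt_partial {Φ : (Fin n → ℂ) → (Fin n → ℂ)} {e : Fin n → ℂ} (h : AnalyticAt ℂ Φ e)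
    (k l : Fin n) : AnalyticAt ℂ (fun z => fderiv ℂ Φ z (Pi.single k 1) l) e :=
  (((ContinuousLinearMap.proj (R := ℂ) (φ := fun _ : Fin n => ℂ) l).comp
    (ContinuousLinearMap.apply ℂ (Fin n → ℂ)
      (Pi.single k (1 : ℂ) : Fin n → ℂ))).analyticAt _).comp h.fderiv

/-- The `f l` are holomorphic combinations of the `f' k ∘ Ψ`, so a common factor `g` of the `f' k`
gives the common factor `g ∘ Ψ` of the `f l`, and `g (Ψ e) ≠ 0`. -/
lemma NoCommonFactor.of_change {f f' : Fin n → (Fin n → ℂ) → ℂ} {e e' : Fin n → ℂ}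
    (h : NoCommonFactor f e) {Ψ : (Fin n → ℂ) → (Fin n → ℂ)} (hΨ : AnalyticAt ℂ Ψ e)
    (he : Ψ e = e')
    (hf : ∀ᶠ z in 𝓝 e, ∀ l, f l z = ∑ k, f' k (Ψ z) * fderiv ℂ Ψ z (Pi.single l 1) k) :
    NoCommonFactor f' e' := by
  subst he
  intro g hg hdiv
  choose q hq hfq using hdiv
  refine h (fun z => g (Ψ z)) (AnalyticAt.comp hg hΨ) fun l =>
    ⟨fun z => ∑ k, q k (Ψ z) * fderiv ℂ Ψ z (Pi.single l 1) k,
      Finset.analyticAt_fun_sum _ fun k _ =>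
        (AnalyticAt.comp (hq k) hΨ).fun_mul (analyticAt_partial hΨ l k), ?_⟩
  filter_upwards [hf, hΨ.continuousAt.eventually (eventually_all.2 hfq)] with z h1 h2
  rw [h1, Finset.mul_sum]
  exact Finset.sum_congr rfl fun k _ => by rw [h2, mul_assoc]

end NoCommonFactor

section Generators

variable {n : ℕ} {M : Type*} [TopologicalSpace M] [ChartedSpace (Fin n → ℂ) M]

lemma coordForm_mul (φ : OpenPartialHomeomorph M (Fin n → ℂ)) (g : (Fin n → ℂ) → ℂ)
    (f : Fin n → (Fin n → ℂ) → ℂ) (r : M) :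
    coordForm φ (fun k z => g z * f k z) r = g (φ r) • coordForm φ f r := by
  unfold coordForm
  rw [Finset.smul_sum]
  exact Finset.sum_congr rfl fun k _ => mul_smul _ _ _

lemma Foliation.exists_isGenerator_coordForm (F : Foliation n M) (p : M) :
    ∃ φ ∈ coordSystems n M, p ∈ φ.source ∧ ∃ f : Fin n → (Fin n → ℂ) → ℂ,
      (∀ k, AnalyticAt ℂ (f k) (φ p)) ∧ NoCommonFactor f (φ p) ∧
      F.IsGenerator p (coordForm φ f) := by
  obtain ⟨φ, hφ, hp, f, hf, -, hnc, hst⟩ := F.locally_generated p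
  refine ⟨φ, hφ, hp, f, fun k => hf k _ (φ.map_source hp), hnc _ (φ.map_source hp), fun β => ?_⟩
  rw [hst p hp]
  constructor
  · rintro ⟨g, hg, hβ⟩
    exact ⟨fun r => g (φ r), contMDiffAt_comp_chart hφ hg hp, hβ.mono fun r hr => by
      rw [hr, coordForm_mul]⟩
  · rintro ⟨h, hh, hβ⟩
    refine ⟨fun z => h (φ.symm z), analyticAt_comp_symm hφ hh hp, ?_⟩
    filter_upwards [hβ, φ.open_source.mem_nhds hp] with r hr hrs
    rw [hr, coordForm_mul, φ.left_inv hrs]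

lemma Foliation.exists_isGenerator (F : Foliation n M) (p : M) : ∃ α, F.IsGenerator p α := by
  obtain ⟨φ, -, -, f, -, -, h⟩ := F.exists_isGenerator_coordForm p
  exact ⟨_, h⟩

lemma Foliation.IsGenerator.mem {F : Foliation n M} {p : M} {α : OneForm n M}
    (h : F.IsGenerator p α) : α ∈ F.stalk p :=
  (h α).2 ⟨fun _ => 1, contMDiffAt_const, Eventually.of_forall fun r => (one_smul ℂ (α r)).symm⟩

/-- The coefficients of a generator in a chart are holomorphic and have no common factor. -/
lemma Foliation.IsGenerator.coeff {F : Foliation n M} {p : M} {α : OneForm n M}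
    (hα : F.IsGenerator p α) {φ : OpenPartialHomeomorph M (Fin n → ℂ)}
    (hφ : φ ∈ coordSystems n M) (hp : p ∈ φ.source) :
    (∀ k, AnalyticAt ℂ (coeff φ α k) (φ p)) ∧ NoCommonFactor (coeff φ α) (φ p) := by
  obtain ⟨φ₀, hφ₀, hp₀, f, hf, hnc, hgen⟩ := F.exists_isGenerator_coordForm p
  obtain ⟨h₁, hh₁, h₁α⟩ := (hgen α).1 hα.mem
  -- The two generators are multiples of each other: `h₁` carries holomorphy to the coefficients of
  -- `α`, and `h₂` turns a factor of these into a factor of `f`. Both facts are then moved from `φ₀`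
  -- to `φ`.
  obtain ⟨h₂, hh₂, h₂α⟩ := (hα _).1 hgen.mem
  have hc₁ := eventually_coeff_smul hp₀ h₁α
  have hc₂ := eventually_coeff_smul hp₀ h₂α
  have hg₁ := analyticAt_comp_symm hφ₀ hh₁ hp₀
  have hg₂ := analyticAt_comp_symm hφ₀ hh₂ hp₀
  have hcf : ∀ᶠ z in 𝓝 (φ₀ p), ∀ k, NewtonFoliation.coeff φ₀ (coordForm φ₀ f) k z = f k z := by
    filter_upwards [eventually_mem_target hp₀] with z hz k
    exact coeff_coordForm hφ₀ f k hz
  have han : ∀ k, AnalyticAt ℂ (NewtonFoliation.coeff φ₀ α k) (φ₀ p) := fun k =>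
    (hg₁.fun_mul (hf k)).congr (by
      filter_upwards [hc₁, hcf] with z h1 h2
      rw [h1, h2])
  have hnc₀ : NoCommonFactor (NewtonFoliation.coeff φ₀ α) (φ₀ p) := by
    intro g hg hdiv
    refine hnc g hg fun k => ?_
    obtain ⟨q, hq, hgq⟩ := hdiv k
    refine ⟨fun z => h₂ (φ₀.symm z) * q z, hg₂.fun_mul hq, ?_⟩
    filter_upwards [hgq, hc₂, hcf] with z h1 h2 h3
    rw [← h3, h2, h1]; ring
  have hsrc : ∀ {φ ψ : OpenPartialHomeomorph M (Fin n → ℂ)}, p ∈ φ.source → p ∈ ψ.source →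
      ∀ᶠ z in 𝓝 (ψ p), z ∈ ψ.target ∧ ψ.symm z ∈ φ.source := fun {φ ψ} h1 h2 =>
    (eventually_mem_target h2).and ((tendsto_symm h2).eventually (φ.open_source.mem_nhds h1))
  have hΦ := analyticAt_writtenIn (π := id) hφ₀ hφ contMDiffAt_id hp hp₀
  have hΨ := analyticAt_writtenIn (π := id) hφ hφ₀ contMDiffAt_id hp₀ hp
  simp only [id] at hΦ hΨ
  have hΦp : φ₀ (φ.symm (φ p)) = φ₀ p := by rw [φ.left_inv hp]
  refine ⟨fun k => ?_, hnc₀.of_change hΨ (by rw [φ₀.left_inv hp₀]) ?_⟩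
  · have : AnalyticAt ℂ (fun z => ∑ l, NewtonFoliation.coeff φ₀ α l (φ₀ (φ.symm z)) *
        fderiv ℂ (fun z => φ₀ (φ.symm z)) z (Pi.single k 1) l) (φ p) :=
      Finset.analyticAt_fun_sum _ fun l _ =>
        (AnalyticAt.comp (g := NewtonFoliation.coeff φ₀ α l) (f := fun z => φ₀ (φ.symm z))
          (by rw [hΦp]; exact han l) hΦ).fun_mul (analyticAt_partial hΦ k l)
    refine this.congr ?_
    filter_upwards [hsrc hp₀ hp] with z hz
    exact (coeff_change hφ₀ hφ α hz.1 hz.2 k).symm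
  · filter_upwards [hsrc hp hp₀] with z hz l
    exact coeff_change hφ hφ₀ α hz.1 hz.2 l

/-- The logarithmic coefficients of a one-form with respect to the coordinates in `X`: the
coefficients of `dz k / z k` for `k ∈ X` and of `dz k` for `k ∉ X`. -/
def logCoeff (X : Finset (Fin n)) (φ : OpenPartialHomeomorph M (Fin n → ℂ)) (α : OneForm n M)
    (k : Fin n) (z : Fin n → ℂ) : ℂ :=
  (if k ∈ X then z k else 1) * coeff φ α k z

/-- The norm of the family of the logarithmic coefficients. -/
def logNorm (X : Finset (Fin n)) (φ : OpenPartialHomeomorph M (Fin n → ℂ)) (α : OneForm n M)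
    (z : Fin n → ℂ) : ℝ :=
  ‖fun k => logCoeff X φ α k z‖

lemma logNorm_nonneg (X : Finset (Fin n)) (φ : OpenPartialHomeomorph M (Fin n → ℂ))
    (α : OneForm n M) (z : Fin n → ℂ) : 0 ≤ logNorm X φ α z := norm_nonneg _

lemma norm_logCoeff_le (X : Finset (Fin n)) (φ : OpenPartialHomeomorph M (Fin n → ℂ))
    (α : OneForm n M) (k : Fin n) (z : Fin n → ℂ) : ‖logCoeff X φ α k z‖ ≤ logNorm X φ α z :=
  norm_le_pi_norm (fun k => logCoeff X φ α k z) k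

end Generators

lemma mon_indicator {ι : Type*} [Fintype ι] [DecidableEq ι] (X : Finset ι) (z : ι → ℂ) :
    mon z (fun i => if i ∈ X then 1 else 0) = ∏ i ∈ X, z i := by
  simp [mon, pow_ite, Finset.prod_ite_mem]

/-! ### Logarithmic generators compared with logarithmic coefficients -/

section LogGenerators

variable {n : ℕ} {M I : Type*} [TopologicalSpace M] [ChartedSpace (Fin n → ℂ) M]
  {E : I → Set M} {p : M} {F : Foliation n M} {α : OneForm n M}

lemma analyticAt_ite_coord (X : Finset (Fin n)) (k : Fin n) (e : Fin n → ℂ) :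
    AnalyticAt ℂ (fun z : Fin n → ℂ => if k ∈ X then z k else 1) e := by
  split_ifs
  · exact analyticAt_coord k e
  · exact analyticAt_const

lemma analyticAt_logCoeff (hα : F.IsGenerator p α) (c : AdaptedCoords n E p) (k : Fin n) :
    AnalyticAt ℂ (logCoeff c.divisorIdx c.chart α k) 0 := by
  have := (hα.coeff c.chart_mem c.mem_source).1 k
  rw [c.chart_center] at this
  exact (analyticAt_ite_coord _ _ _).fun_mul this

lemma ite_mul_prod_erase (X : Finset (Fin n)) (k : Fin n) (z : Fin n → ℂ) :
    (if k ∈ X then z k else 1) * ∏ l ∈ X.erase k, z l = ∏ l ∈ X, z l := by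
  split_ifs with hk
  · exact Finset.mul_prod_erase X z hk
  · rw [Finset.erase_eq_of_notMem hk, one_mul]

/-- A logarithmic generator is, up to a monomial and a unit, the family of the logarithmic
coefficients of a generator. -/
lemma IsLogGenerator.exists_mon_mul {c : AdaptedCoords n E p} {a : Fin n → (Fin n → ℂ) → ℂ}
    (ha : IsLogGenerator F c a) (hα : F.IsGenerator p α) :
    ∃ (χ μ : Fin n → ℕ) (u : (Fin n → ℂ) → ℂ), (∀ i ∉ c.divisorIdx, χ i = 0) ∧
      (∀ i ∉ c.divisorIdx, μ i = 0) ∧ AnalyticAt ℂ u 0 ∧ u 0 ≠ 0 ∧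
      ∀ᶠ z in 𝓝 0, ∀ k, mon z χ * a k z = mon z μ * u z * logCoeff c.divisorIdx c.chart α k z := by
  classical
  set X := c.divisorIdx with hX
  have hX0 : ∀ j ∈ X, (0 : Fin n → ℂ) j = 0 := fun _ _ => rfl
  -- The exponent of the product of the divisor coordinates, that is, of the denominators cleared in
  -- a logarithmic form.
  set χ : Fin n → ℕ := fun i => if i ∈ X then 1 else 0 with hχ
  have hχX : ∀ i ∉ X, χ i = 0 := fun i hi => if_neg hi
  obtain ⟨h, hh, hhα⟩ := (hα _).1 ha.defines
  have hg := analyticAt_comp_symm c.chart_mem hh c.mem_source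
  have hc := eventually_coeff_smul c.mem_source hhα
  have ht := eventually_mem_target c.mem_source
  rw [c.chart_center] at hg hc ht
  set g : (Fin n → ℂ) → ℂ := fun z => h (c.chart.symm z) with hgdef
  have heq : ∀ᶠ z in 𝓝 0, ∀ k, mon z χ * a k z = g z * logCoeff X c.chart α k z := by
    filter_upwards [hc, ht] with z hz hzt k
    have h1 := hz k
    rw [AdaptedCoords.clearedLogForm, coeff_coordForm c.chart_mem _ _ hzt] at h1
    rw [hχ, mon_indicator, ← ite_mul_prod_erase X k z, logCoeff, mul_assoc, h1]
    ring
  have hg0 : ¬ ∀ᶠ z in 𝓝 0, g z = 0 := by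
    intro h0
    obtain ⟨k, hk⟩ := ha.noCommonFactor.exists_ne_zero
    refine hk (eventually_eq_of_mon_mul (g := fun _ => 0) χ (ha.analytic k) analyticAt_const ?_)
    filter_upwards [heq, h0] with z h1 h2
    rw [h1, h2]; ring
  -- All monomial factors are extracted from `g`. The remaining `u` is prime to the divisor
  -- coordinates and divides their product times each `a k`; hence it divides every `a k` and is a
  -- unit.
  obtain ⟨μ, hμ, u, hu, hgu, huX⟩ := exists_eq_mon_mul X (κ := Unit) (b := fun _ => g)
    (fun _ => hg) ⟨(), hg0⟩
  refine ⟨χ, μ, u (), hχX, hμ, hu (), ?_, ?_⟩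
  · refine ha.noCommonFactor (u ()) (hu ()) fun k => ?_
    refine exists_eq_mul_of_mon_mul hX0 (hu ()) (ha.analytic k)
      ((analyticAt_mon μ 0).fun_mul (analyticAt_logCoeff hα c k)) (fun j hj => ?_) χ hχX ?_
    · obtain ⟨_, h1⟩ := huX j hj
      exact h1
    · filter_upwards [heq, hgu ()] with z h1 h2
      rw [h1, h2, hX]; ring
  · filter_upwards [heq, hgu ()] with z h1 h2 k
    rw [h1, h2]

/-- The two families agree up to monomials in the divisor coordinates and a unit, which the Harnack
property does not see. -/
lemma IsLogGenerator.harnack_iff {c : AdaptedCoords n E p} {a : Fin n → (Fin n → ℂ) → ℂ}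
    (ha : IsLogGenerator F c a) (hα : F.IsGenerator p α) {w : Fin n → ℝ} {z₀ : Fin n → ℂ}
    (hp : TestPair c.divisorIdx 0 w z₀) :
    Harnack (fun z => ‖fun k => a k z‖) w z₀ ↔
      Harnack (logNorm c.divisorIdx c.chart α) w z₀ := by
  obtain ⟨χ, μ, u, hχ, hμ, hu, hu0, heq⟩ := ha.exists_mon_mul hα
  have h1 := harnack_mon_mul_iff hp hχ (u := fun _ => 1) continuousAt_const one_ne_zero
    (N := fun z => ‖fun k => a k z‖) fun _ => norm_nonneg _
  have h2 := harnack_mon_mul_iff hp hμ hu.continuousAt hu0 (logNorm_nonneg c.divisorIdx c.chart α)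
  have h3 : ∀ᶠ z in 𝓝 0, ‖mon z χ * 1‖ * ‖fun k => a k z‖ =
      ‖mon z μ * u z‖ * logNorm c.divisorIdx c.chart α z := by
    filter_upwards [heq] with z hz
    rw [logNorm, ← norm_smul, ← norm_smul]
    congr 1
    funext k
    simpa using hz k
  rw [← h1, ← h2]
  exact ⟨fun H => H.congr hp (h3.mono fun z hz => hz.symm), fun H => H.congr hp h3⟩

/-- Logarithmic generators exist. -/
lemma exists_isLogGenerator (hα : F.IsGenerator p α) (c : AdaptedCoords n E p) :
    ∃ a, IsLogGenerator F c a := by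
  classical
  set X := c.divisorIdx with hX
  have hX0 : ∀ j ∈ X, (0 : Fin n → ℂ) j = 0 := fun _ _ => rfl
  obtain ⟨hf, hnc⟩ := hα.coeff c.chart_mem c.mem_source
  have ht := eventually_mem_target c.mem_source
  rw [c.chart_center] at hf hnc ht
  set f := coeff c.chart α with hfdef
  have hne : ∃ k, ¬ ∀ᶠ z in 𝓝 0, logCoeff X c.chart α k z = 0 := by
    obtain ⟨k, hk⟩ := hnc.exists_ne_zero
    refine ⟨k, fun h0 => hk ?_⟩
    by_cases hkX : k ∈ X
    · refine eventually_eq_of_coord_mul (g := fun _ => 0) k (hf k) analyticAt_const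
        (h0.mono fun z hz => ?_)
      rw [logCoeff, if_pos hkX] at hz
      rw [hz, mul_zero]
    · refine h0.mono fun z hz => ?_
      rwa [logCoeff, if_neg hkX, one_mul] at hz
  obtain ⟨μ, hμ, a, ha, hba, haX⟩ := exists_eq_mon_mul X (analyticAt_logCoeff hα c) hne
  -- If the square of a divisor coordinate divided all the logarithmic coefficients, the coordinate
  -- itself would divide all the ordinary ones. With this bound, clearing the denominators of the
  -- divided form gives a holomorphic multiple of `α`, by the monomial with exponent `χ - μ`.
  have hμ1 : ∀ j, μ j ≤ 1 := by
    intro j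
    by_contra! hj
    have hjX : j ∈ X := by
      by_contra h; rw [hμ j h] at hj; omega
    have hdec : μ = (μ - Pi.single j 2) + (Pi.single j 1 + Pi.single j 1) := by
      ext k
      by_cases hk : k = j
      · subst hk; simp; omega
      · simp [hk]
    have hmon : ∀ z : Fin n → ℂ, mon z μ = z j * (z j * mon z (μ - Pi.single j 2)) := fun z => by
      conv_lhs => rw [hdec]
      rw [mon_add, mon_add, mon_single]; ring
    refine hnc (fun z => z j) (analyticAt_coord j 0) (fun k => ?_) rfl
    refine exists_eq_coord_mul (hf k) rfl ?_
    by_cases hkj : k = j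
    · subst hkj
      have h1 := eventually_eq_of_coord_mul (e := 0) k (hf k) (((analyticAt_coord k 0).fun_mul
        (analyticAt_mon (μ - Pi.single k 2) 0)).fun_mul (ha k)) (by
          filter_upwards [hba k] with z hz
          rw [logCoeff, if_pos hjX, hmon] at hz
          rw [hz]; ring)
      exact h1.mono fun z hz hzk => by rw [hz, hzk]; ring
    · refine (vanishes_or_vanishes_of_mul (analyticAt_ite_coord X k 0) (hf k) (hX0 j hjX)
        ((hba k).mono fun z hz hzj => ?_)).resolve_left ?_
      · rw [logCoeff] at hz
        rw [hz, hmon, hzj]; ring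
      · by_cases hkX : k ∈ X
        · simpa only [if_pos hkX] using not_vanishes_coord hkj (hX0 j hjX)
        · simp only [if_neg hkX, one_ne_zero, imp_false]
          intro h0
          obtain ⟨z, hz⟩ := (eventually_update_zero (hX0 j hjX) h0).exists
          exact hz (by simp)
  set χ : Fin n → ℕ := fun i => if i ∈ X then 1 else 0 with hχ
  have hχμ : χ = (χ - μ) + μ := by
    ext k
    by_cases hk : k ∈ X
    · have := hμ1 k
      simp [hχ, hk]; omega
    · simp [hχ, hk, hμ k hk]
  refine ⟨a, ha, ?_, ?_⟩
  · intro g hg hdiv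
    choose q hq haq using hdiv
    refine hnc g hg fun k => ?_
    -- A common factor `g` of the `a k` divides the `k`-th logarithmic coefficient. It contains no
    -- divisor coordinate, since some `a k'` is prime to it, so it divides `f k` itself; the
    -- exponent supplied encodes the factor `z k` or `1`.
    refine exists_eq_mul_of_mon_mul hX0 hg (hf k)
      ((analyticAt_mon μ 0).fun_mul (hq k)) (fun j hj hvan => ?_)
      (fun i => if i = k ∧ k ∈ X then 1 else 0) (fun j hj => ?_) ?_
    · obtain ⟨k', hk'⟩ := haX j hj
      refine hk' ?_
      filter_upwards [hvan, haq k'] with z h1 h2 hz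
      rw [h2, h1 hz, zero_mul]
    · rw [if_neg]
      rintro ⟨rfl, h⟩
      exact hj h
    · filter_upwards [haq k, hba k] with z h1 h2
      have h3 : mon z (fun i => if i = k ∧ k ∈ X then 1 else 0) = if k ∈ X then z k else 1 := by
        by_cases hkX : k ∈ X
        · simp only [hkX, and_true, if_true]
          rw [← mon_single z k]
          congr 1
          ext i; simp [Pi.single_apply]
        · simp [hkX, mon]
      rw [h3]
      rw [logCoeff] at h2
      rw [h2, h1]; ring
  · refine (hα _).2 ⟨fun r => mon (c.chart r) (χ - μ), contMDiffAt_comp_chart c.chart_mem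
      (analyticAt_mon _ _) c.mem_source, ?_⟩
    have hcoef : ∀ᶠ z in 𝓝 0, ∀ k, (∏ l ∈ X.erase k, z l) * a k z = mon z (χ - μ) * f k z := by
      refine eventually_all.2 fun k => ?_
      have h2 : AnalyticAt ℂ (fun z : Fin n → ℂ => ∏ l ∈ X.erase k, z l) 0 :=
        Finset.analyticAt_fun_prod _ fun l _ => analyticAt_coord l 0
      refine eventually_eq_of_mon_mul χ (h2.fun_mul (ha k)) ((analyticAt_mon _ 0).fun_mul (hf k)) ?_
      filter_upwards [hba k] with z hz
      rw [logCoeff] at hz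
      have h3 : mon z χ = mon z (χ - μ) * mon z μ := by
        conv_lhs => rw [hχμ]
        rw [mon_add]
      have h4 := ite_mul_prod_erase X k z
      rw [← mon_indicator X] at h4
      calc mon z χ * ((∏ l ∈ X.erase k, z l) * a k z)
          = mon z (χ - μ) * (mon z μ * a k z) * ∏ l ∈ X.erase k, z l := by rw [h3]; ring
        _ = mon z (χ - μ) * f k z * ((if k ∈ X then z k else 1) * ∏ l ∈ X.erase k, z l) := by
          rw [← hz]; ring
        _ = _ := by rw [h4]; ring
    have hcont := (c.chart.continuousAt c.mem_source).tendsto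
    rw [c.chart_center] at hcont
    filter_upwards [hcont.eventually hcoef, c.chart.open_source.mem_nhds c.mem_source] with r hr hrs
    refine ContinuousLinearMap.ext fun v => ?_
    have h5 := apply_eq_sum_coeff c.chart_mem (c.clearedLogForm a) hrs v
    have h6 := apply_eq_sum_coeff c.chart_mem α hrs v
    refine h5.trans ?_
    change _ = mon (c.chart r) (χ - μ) * α r v
    rw [h6, Finset.mul_sum]
    refine Finset.sum_congr rfl fun l _ => ?_
    rw [AdaptedCoords.clearedLogForm, coeff_coordForm c.chart_mem _ _ (c.chart.map_source hrs), hr l]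
    ring

variable [Fintype I]

/-- The Newton non-degeneracy conditions in a system of adapted coordinates, in terms of a
generator of the foliation. -/
theorem nondegenerate_iff_harnack (hα : F.IsGenerator p α) (c : AdaptedCoords n E p) :
    (∀ a s, IsLogGenerator F c a → IsExpansion c a s →
      ∀ Φ, IsCompactFace (expansionSupport s) Φ → NondegenerateWrtFace s Φ) ↔
    ∀ w z₀, TestPair c.divisorIdx 0 w z₀ → Harnack (logNorm c.divisorIdx c.chart α) w z₀ := by
  constructor
  · intro H w z₀ hp
    obtain ⟨a, ha⟩ := exists_isLogGenerator hα c
    obtain ⟨s, hs⟩ := exists_isExpansion c ha.analytic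
    rw [← ha.harnack_iff hα hp]
    exact (hs.nondegenerate_iff ha.analytic ha.noCommonFactor.exists_ne_zero).1 (H a s ha hs) w z₀ hp
  · intro H a s ha hs
    refine (hs.nondegenerate_iff ha.analytic ha.noCommonFactor.exists_ne_zero).2 fun w z₀ hp => ?_
    rw [ha.harnack_iff hα hp]
    exact H w z₀ hp

end LogGenerators

/-! ## Logarithmic charts and independence of the coordinates -/

section LogChart

variable {n : ℕ} {M I : Type*} [TopologicalSpace M] [ChartedSpace (Fin n → ℂ) M]

/-- A chart `φ` at `p`, not necessarily centred, such that the coordinates with number in `X` that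
vanish at `p` are local equations of the components of the divisor through `p`. -/
structure IsLogChart (E : I → Set M) (p : M) (φ : OpenPartialHomeomorph M (Fin n → ℂ))
    (X : Finset (Fin n)) (idx : StratumIndex E p ↪ Fin n) : Prop where
  chart_mem : φ ∈ coordSystems n M
  mem_source : p ∈ φ.source
  mem_range : ∀ k, k ∈ Set.range idx ↔ k ∈ X ∧ φ p k = 0
  mem_iff : ∀ i : StratumIndex E p, ∀ᶠ q in 𝓝 p, q ∈ E i.1 ↔ φ q (idx i) = 0
  not_mem : ∀ i, p ∉ E i → ∀ᶠ q in 𝓝 p, q ∉ E i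

variable {E : I → Set M} {p : M}

lemma AdaptedCoords.isLogChart (c : AdaptedCoords n E p) :
    IsLogChart E p c.chart c.divisorIdx c.idx where
  chart_mem := c.chart_mem
  mem_source := c.mem_source
  mem_range k := by simp [c.mem_divisorIdx, c.chart_center]
  mem_iff i := mem_of_superset (c.chart.open_source.mem_nhds c.mem_source) (c.mem_iff i)
  not_mem i hi := mem_of_superset (c.chart.open_source.mem_nhds c.mem_source) (c.not_mem i hi)

/-- Since `I` is finite, the germ conditions hold on a common open set. Translating `p` to the
origin does not change the coordinates that cut out the divisor, because they vanish at `p`. -/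
lemma IsLogChart.nonempty_adaptedCoords [Finite I] [IsManifold 𝓘(ℂ, Fin n → ℂ) ω M]
    {φ : OpenPartialHomeomorph M (Fin n → ℂ)} {X : Finset (Fin n)}
    {idx : StratumIndex E p ↪ Fin n} (h : IsLogChart E p φ X idx) :
    Nonempty (AdaptedCoords n E p) := by
  have hev : ∀ᶠ q in 𝓝 p, (∀ i : StratumIndex E p, q ∈ E i.1 ↔ φ q (idx i) = 0) ∧
      ∀ i, p ∉ E i → q ∉ E i :=
    (eventually_all.2 h.mem_iff).and (eventually_all.2 fun i => by
      by_cases hi : p ∈ E i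
      · exact Eventually.of_forall fun q h => absurd hi h
      · exact (h.not_mem i hi).mono fun q hq _ => hq)
  obtain ⟨U, hU, hUo, hpU⟩ := mem_nhds_iff.1 hev
  let ψ : OpenPartialHomeomorph M (Fin n → ℂ) :=
    (φ.restrOpen U hUo).transHomeomorph (Homeomorph.addRight (-φ p))
  have hsrc : ψ.source = φ.source ∩ U := by simp [ψ]
  have happ : ∀ q, ψ q = φ q + -φ p := fun q => rfl
  have hsymm : ∀ z, ψ.symm z = φ.symm (z + φ p) := fun z => by
    simp [ψ, OpenPartialHomeomorph.transHomeomorph, Homeomorph.addRight_symm]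
  have hadd : ∀ e : Fin n → ℂ, ContMDiff 𝓘(ℂ, Fin n → ℂ) 𝓘(ℂ, Fin n → ℂ) ω fun z => z + e :=
    fun e => contMDiff_iff_contDiff.2 (contDiff_id.add contDiff_const)
  have hψ : ψ ∈ coordSystems n M := by
    refine OpenPartialHomeomorph.mem_maximalAtlas_of_contMDiffOn ψ (fun q hq => ?_) fun z hz => ?_
    · rw [hsrc] at hq
      exact ((hadd (-φ p)).contMDiffAt.comp q (contMDiffAt_chart h.chart_mem hq.1)).contMDiffWithinAt
    · have h1 := ψ.map_target hz
      rw [hsrc, hsymm] at h1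
      have h2 : z + φ p ∈ φ.target := by
        have h3 : ψ (ψ.symm z) = z := ψ.right_inv hz
        rw [happ, hsymm] at h3
        have h4 : z + φ p = φ (φ.symm (z + φ p)) := by
          conv_lhs => rw [← h3]
          simp
        rw [h4]
        exact φ.map_source h1.1
      have h5 := (contMDiffAt_chart_symm h.chart_mem h2).comp z (hadd (φ p)).contMDiffAt
      exact (h5.congr_of_eventuallyEq (Eventually.of_forall hsymm)).contMDiffWithinAt
  have h0 : ∀ i q, φ q (idx i) = ψ q (idx i) := fun i q => by
    have := ((h.mem_range (idx i)).1 ⟨i, rfl⟩).2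
    simp [happ, this]
  exact ⟨⟨ψ, hψ, by rw [hsrc]; exact ⟨h.mem_source, hpU⟩, by simp [happ], idx,
    fun i q hq => by rw [← h0]; exact (hU (hsrc ▸ hq).2).1 i,
    fun i hi q hq => (hU (hsrc ▸ hq).2).2 i hi⟩⟩

end LogChart

/-! ### Comparison of two logarithmic charts at a point -/

section Compare

variable {n : ℕ} {M I : Type*} [TopologicalSpace M] [ChartedSpace (Fin n → ℂ) M]
  {E : I → Set M} {p : M} {φ φ' : OpenPartialHomeomorph M (Fin n → ℂ)} {X X' : Finset (Fin n)}
  {idx idx' : StratumIndex E p ↪ Fin n}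

lemma IsLogChart.eventually_symm_mem (h : IsLogChart E p φ X idx) (h' : IsLogChart E p φ' X' idx') :
    ∀ᶠ z in 𝓝 (φ p), z ∈ φ.target ∧ φ.symm z ∈ φ'.source :=
  (eventually_mem_target h.mem_source).and
    ((tendsto_symm h.mem_source).eventually (φ'.open_source.mem_nhds h'.mem_source))

lemma IsLogChart.analyticAt_change (h : IsLogChart E p φ X idx)
    (h' : IsLogChart E p φ' X' idx') : AnalyticAt ℂ (fun z => φ' (φ.symm z)) (φ p) :=
  analyticAt_writtenIn (π := id) h'.chart_mem h.chart_mem contMDiffAt_id h.mem_source h'.mem_source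

lemma IsLogChart.exists_eq_mul (h : IsLogChart E p φ X idx) (h' : IsLogChart E p φ' X' idx')
    (i : StratumIndex E p) : ∃ u, AnalyticAt ℂ u (φ p) ∧
      ∀ᶠ z in 𝓝 (φ p), φ' (φ.symm z) (idx' i) = z (idx i) * u z := by
  refine exists_eq_coord_mul (analyticAt_pi_iff.1 (h.analyticAt_change h') (idx' i))
    ((h.mem_range _).1 ⟨i, rfl⟩).2 ?_
  filter_upwards [eventually_mem_target h.mem_source,
    (tendsto_symm h.mem_source).eventually ((h.mem_iff i).and (h'.mem_iff i))] with z hz h1 hz0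
  rw [φ.right_inv hz] at h1
  exact h1.2.1 (h1.1.2 hz0)

/-- The equations of a component of the divisor in two logarithmic charts differ by a unit. -/
lemma IsLogChart.exists_unit (h : IsLogChart E p φ X idx) (h' : IsLogChart E p φ' X' idx')
    (i : StratumIndex E p) : ∃ u, AnalyticAt ℂ u (φ p) ∧ u (φ p) ≠ 0 ∧
      ∀ᶠ z in 𝓝 (φ p), φ' (φ.symm z) (idx' i) = z (idx i) * u z := by
  obtain ⟨u, hu, hΦu⟩ := h.exists_eq_mul h' i
  obtain ⟨v, hv, hΨv⟩ := h'.exists_eq_mul h i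
  refine ⟨u, hu, fun hu0 => ?_, hΦu⟩
  have hΦ := h.analyticAt_change h'
  have hpp : φ' (φ.symm (φ p)) = φ' p := by rw [φ.left_inv h.mem_source]
  have hΦt : Tendsto (fun z => φ' (φ.symm z)) (𝓝 (φ p)) (𝓝 (φ' p)) := by
    have := hΦ.continuousAt.tendsto
    rwa [hpp] at this
  have hvΦ : AnalyticAt ℂ (fun z => v (φ' (φ.symm z))) (φ p) :=
    AnalyticAt.comp (g := v) (f := fun z => φ' (φ.symm z)) (by rwa [hpp]) hΦ
  -- Going to the other chart and back multiplies the equation by `u` and then by `v`; cancelling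
  -- the coordinate gives `1 = u * (v ∘ Φ)` near `φ p`.
  have h1 := eventually_eq_of_coord_mul (e := φ p) (idx i) (f := fun _ => 1) analyticAt_const
    (hu.fun_mul hvΦ) (by
      filter_upwards [hΦu, hΦt.eventually hΨv, h.eventually_symm_mem h'] with z h1 h2 h3
      rw [φ'.left_inv h3.2, φ.right_inv h3.1, h1] at h2
      rw [mul_one, ← mul_assoc]; exact h2)
  have h2 := h1.self_of_nhds
  simp [hu0] at h2

lemma continuousAt_ite_coord (X : Finset (Fin n)) (k : Fin n) (e : Fin n → ℂ) :
    ContinuousAt (fun z : Fin n → ℂ => if k ∈ X then z k else 1) e :=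
  (analyticAt_ite_coord X k e).continuousAt

/-- The logarithmic Jacobian matrix of a change of logarithmic charts is bounded. -/
lemma IsLogChart.exists_logJacobian (h : IsLogChart E p φ X idx) (h' : IsLogChart E p φ' X' idx')
    (k l : Fin n) : ∃ G : (Fin n → ℂ) → ℂ, ContinuousAt G (φ p) ∧ ∀ᶠ z in 𝓝 (φ p),
      (if k ∈ X then z k else 1) * fderiv ℂ (fun z => φ' (φ.symm z)) z (Pi.single k 1) l =
        (if l ∈ X' then φ' (φ.symm z) l else 1) * G z := by
  have hΦ := h.analyticAt_change h'
  have hJ : ContinuousAt (fun z : Fin n → ℂ => (if k ∈ X then z k else 1) *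
      fderiv ℂ (fun z => φ' (φ.symm z)) z (Pi.single k 1) l) (φ p) :=
    (continuousAt_ite_coord X k (φ p)).mul (analyticAt_partial hΦ k l).continuousAt
  by_cases hl : l ∈ X'
  swap
  · exact ⟨_, hJ, Eventually.of_forall fun z => by rw [if_neg hl, one_mul]⟩
  by_cases hl0 : φ' p l = 0
  swap
  -- The new coordinate does not vanish at `p`, so one may divide by it.
  · have hΦl := (analyticAt_pi_iff.1 hΦ l).continuousAt
    have hne : φ' (φ.symm (φ p)) l ≠ 0 := by rwa [φ.left_inv h.mem_source]
    refine ⟨fun z => (if k ∈ X then z k else 1) *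
      fderiv ℂ (fun z => φ' (φ.symm z)) z (Pi.single k 1) l / φ' (φ.symm z) l,
      hJ.div hΦl hne, ?_⟩
    filter_upwards [hΦl.eventually_ne hne] with z hz
    simp only [if_pos hl]
    field_simp
  · obtain ⟨i, rfl⟩ := (h'.mem_range l).2 ⟨hl, hl0⟩
    obtain ⟨u, hu, hu0, hΦu⟩ := h.exists_unit h' i
    have hjX := ((h.mem_range (idx i)).1 ⟨i, rfl⟩).1
    have hdu : ContinuousAt (fun z => fderiv ℂ u z (Pi.single k 1)) (φ p) :=
      hu.fderiv.continuousAt.clm_apply continuousAt_const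
    -- From `x' = x * u` one has `dx' / x' = dx / x + du / u`, with no pole left in the second term.
    refine ⟨fun z => (if idx i = k then 1 else 0) +
      (if k ∈ X then z k else 1) * fderiv ℂ u z (Pi.single k 1) / u z, ?_, ?_⟩
    · exact continuousAt_const.add (((continuousAt_ite_coord X k (φ p)).mul hdu).div
        hu.continuousAt hu0)
    · filter_upwards [hΦu.eventually_nhds, hu.eventually_analyticAt, hΦ.eventually_analyticAt,
        hu.continuousAt.eventually_ne hu0] with z h1 h2 h3 h4
      have h5 : fderiv ℂ (fun z => φ' (φ.symm z)) z (Pi.single k 1) (idx' i) =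
          fderiv ℂ (fun z => φ' (φ.symm z) (idx' i)) z (Pi.single k 1) := by
        have h7 : HasFDerivAt (ContinuousLinearMap.proj (R := ℂ) (φ := fun _ : Fin n => ℂ) (idx' i))
          _ (φ' (φ.symm z)) :=
          (ContinuousLinearMap.proj (R := ℂ) (φ := fun _ : Fin n => ℂ) (idx' i)).hasFDerivAt
        exact (DFunLike.congr_fun
          (h7.comp z h3.differentiableAt.hasFDerivAt).fderiv (Pi.single k 1)).symm
      have h6 : HasFDerivAt (fun z : Fin n → ℂ => z (idx i))
          (ContinuousLinearMap.proj (R := ℂ) (φ := fun _ : Fin n => ℂ) (idx i)) z :=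
        (ContinuousLinearMap.proj (R := ℂ) (φ := fun _ : Fin n => ℂ) (idx i)).hasFDerivAt
      have h8 : HasFDerivAt (fun z : Fin n → ℂ => z (idx i) * u z) _ z :=
        h6.mul h2.differentiableAt.hasFDerivAt
      rw [h5, EventuallyEq.fderiv_eq (f := fun z => z (idx i) * u z) h1, h8.fderiv, if_pos hl,
        h1.self_of_nhds]
      simp only [_root_.add_apply, _root_.smul_apply,
        ContinuousLinearMap.proj_apply, smul_eq_mul, Pi.single_apply]
      by_cases hk : idx i = k
      · subst hk
        simp only [if_pos hjX, if_true]
        field_simp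
        ring
      · simp only [if_neg hk]
        field_simp
        ring

/-- The norms of the logarithmic coefficients in two logarithmic charts are comparable. -/
lemma IsLogChart.exists_logNorm_le (h : IsLogChart E p φ X idx) (h' : IsLogChart E p φ' X' idx')
    (α : OneForm n M) : ∃ K : ℝ, ∀ᶠ z in 𝓝 (φ p),
      logNorm X φ α z ≤ K * logNorm X' φ' α (φ' (φ.symm z)) := by
  choose G hG hGeq using h.exists_logJacobian h'
  -- The `+ 1` is the room left by continuity for the entries of the matrix near `φ p`.
  refine ⟨∑ k, ∑ l, (‖G k l (φ p)‖ + 1), ?_⟩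
  have hbound : ∀ᶠ z in 𝓝 (φ p), ∀ k l, ‖G k l z‖ ≤ ‖G k l (φ p)‖ + 1 :=
    eventually_all.2 fun k => eventually_all.2 fun l =>
      ((hG k l).norm.eventually (gt_mem_nhds (lt_add_one _))).mono fun z hz => hz.le
  filter_upwards [hbound, eventually_all.2 fun k => eventually_all.2 (hGeq k),
    h.eventually_symm_mem h'] with z h1 h2 h3
  have hpos : 0 ≤ logNorm X' φ' α (φ' (φ.symm z)) := logNorm_nonneg _ _ _ _
  have hsum0 : ∀ k, 0 ≤ ∑ l, (‖G k l (φ p)‖ + 1) := fun k =>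
    Finset.sum_nonneg fun l _ => by positivity
  refine (pi_norm_le_iff_of_nonneg (mul_nonneg (Finset.sum_nonneg fun k _ => hsum0 k) hpos)).2
    fun k => ?_
  have h4 : logCoeff X φ α k z = ∑ l, logCoeff X' φ' α l (φ' (φ.symm z)) * G k l z := by
    rw [logCoeff, coeff_change h'.chart_mem h.chart_mem α h3.1 h3.2, Finset.mul_sum]
    refine Finset.sum_congr rfl fun l _ => ?_
    rw [logCoeff, mul_left_comm, h2 k l]
    ring
  rw [h4]
  calc ‖∑ l, logCoeff X' φ' α l (φ' (φ.symm z)) * G k l z‖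
      ≤ ∑ l, (‖G k l (φ p)‖ + 1) * logNorm X' φ' α (φ' (φ.symm z)) := by
        refine (norm_sum_le _ _).trans (Finset.sum_le_sum fun l _ => ?_)
        rw [norm_mul, mul_comm]
        exact mul_le_mul (h1 k l) (norm_logCoeff_le _ _ _ _ _) (norm_nonneg _) (by positivity)
    _ = (∑ l, (‖G k l (φ p)‖ + 1)) * logNorm X' φ' α (φ' (φ.symm z)) := by rw [Finset.sum_mul]
    _ ≤ _ := mul_le_mul_of_nonneg_right
        (Finset.single_le_sum (fun k _ => hsum0 k) (Finset.mem_univ k)) hpos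

/-- The Harnack property along all the test curves, in a chart. -/
def HarnackIn (X : Finset (Fin n)) (φ : OpenPartialHomeomorph M (Fin n → ℂ)) (p : M)
    (α : OneForm n M) : Prop :=
  ∀ w z₀, TestPair X (φ p) w z₀ → Harnack (logNorm X φ α) w z₀

/-- The Harnack property does not depend on the logarithmic chart. -/
theorem IsLogChart.harnackIn (h : IsLogChart E p φ X idx) (h' : IsLogChart E p φ' X' idx')
    {α : OneForm n M} (H : HarnackIn X' φ' p α) : HarnackIn X φ p α := by
  classical
  have : Finite (StratumIndex E p) := Finite.of_injective idx idx.injective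
  intro w z₀ hp
  choose u hu hu0 hΦu using h.exists_unit h'
  have hX : ∀ i, idx i ∈ X ∧ φ p (idx i) = 0 := fun i => (h.mem_range _).1 ⟨i, rfl⟩
  have hX' : ∀ i, idx' i ∈ X' ∧ φ' p (idx' i) = 0 := fun i => (h'.mem_range _).1 ⟨i, rfl⟩
  have hwi : ∀ i, w (idx i) ≠ 0 := fun i hi => by
    have := hp.limit (idx i)
    rw [if_pos hi, (hX i).2] at this
    exact hp.ne_zero _ (hX i).1 this
  -- Only the components through `p` need weights in the new chart. The new base point has
  -- coordinates `z₀ (idx i) * u i (φ p)` there, and those of `p` elsewhere.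
  set w' : Fin n → ℝ := extendZero idx' fun i => w (idx i) with hw'
  set z₀' : Fin n → ℂ := fun k => if k ∈ Set.range idx' then
    extendZero idx' (fun i => z₀ (idx i) * u i (φ p)) k else φ' p k with hz₀'
  have hp' : TestPair X' (φ' p) w' z₀' := by
    refine ⟨fun k => ?_, fun k hk => ?_, fun k hk => ?_, fun k => ?_⟩ <;>
    by_cases hkr : k ∈ Set.range idx'
    · obtain ⟨i, rfl⟩ := hkr
      simpa [hw'] using hp.nonneg (idx i)
    · rw [hw', extendZero_of_notMem _ hkr]
    · exact ((h'.mem_range k).1 hkr).1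
    · rw [hw', extendZero_of_notMem _ hkr] at hk
      exact absurd hk (lt_irrefl _)
    · obtain ⟨i, rfl⟩ := hkr
      simp only [hz₀', Set.mem_range_self, if_true, extendZero_apply]
      exact mul_ne_zero (hp.ne_zero _ (hX i).1) (hu0 i)
    · simp only [hz₀', if_neg hkr]
      exact fun h0 => hkr ((h'.mem_range k).2 ⟨hk, h0⟩)
    · obtain ⟨i, rfl⟩ := hkr
      simp [hw', hwi, (hX' i).2]
    · simp only [hz₀', if_neg hkr, hw', extendZero_of_notMem _ hkr, if_true]
  have hΦ := h.analyticAt_change h'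
  have hpp : φ' (φ.symm (φ p)) = φ' p := by rw [φ.left_inv h.mem_source]
  have hΦt : Tendsto (fun z => φ' (φ.symm z)) (𝓝 (φ p)) (𝓝 (φ' p)) := by
    have := hΦ.continuousAt.tendsto
    rwa [hpp] at this
  refine Harnack.of_comparable (logNorm_nonneg X φ α) (logNorm_nonneg X' φ' α)
    (Φ := fun z => φ' (φ.symm z)) (z₂ := z₀') (w₂ := w')
    -- The new coordinates of the moving point, with the power of `t` removed from the divisor
    -- coordinates: they converge because the units `u i` do.
    (fun q k => if k ∈ Set.range idx' then
      extendZero idx' (fun i => q.2 (idx i) * u i (dil w q.1 q.2)) k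
      else φ' (φ.symm (dil w q.1 q.2)) k) ?_ ?_ ?_ ?_ (H w' z₀' hp')
  · refine tendsto_pi_nhds.2 fun k => ?_
    by_cases hkr : k ∈ Set.range idx'
    · obtain ⟨i, rfl⟩ := hkr
      simp only [hz₀', Set.mem_range_self, if_true, extendZero_apply]
      exact (((continuous_apply (idx i)).tendsto z₀).comp tendsto_snd).mul
        ((hu i).continuousAt.tendsto.comp hp.tendsto)
    · simp only [hz₀', if_neg hkr]
      exact ((continuous_apply k).tendsto _).comp (hΦt.comp hp.tendsto)
  · filter_upwards [hp.tendsto.eventually (eventually_all.2 hΦu)] with q hq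
    funext k
    by_cases hkr : k ∈ Set.range idx'
    · obtain ⟨i, rfl⟩ := hkr
      simp only [dil, hw', Set.mem_range_self, if_true, extendZero_apply]
      refine Eq.trans ?_ (hq i).symm
      simp only [dil]
      ring
    · simp only [dil, hw', if_neg hkr, extendZero_of_notMem _ hkr, Real.rpow_zero,
        Complex.ofReal_one, one_mul]
  · obtain ⟨K, hK⟩ := h.exists_logNorm_le h' α
    exact ⟨K, hp.tendsto.eventually hK⟩
  · obtain ⟨K, hK⟩ := h'.exists_logNorm_le h α
    refine ⟨K, ?_⟩
    filter_upwards [hp.tendsto.eventually ((hΦt.eventually hK).and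
      (h.eventually_symm_mem h'))] with q hq
    have := hq.1
    rwa [φ'.left_inv hq.2.2, φ.right_inv hq.2.1] at this

variable [Fintype I] [IsManifold 𝓘(ℂ, Fin n → ℂ) ω M]

/-- Newton non-degeneracy at a point, in terms of a generator and of a logarithmic chart. -/
theorem newtonNondegenerateAt_iff {F : Foliation n M} {α : OneForm n M} (hα : F.IsGenerator p α)
    (h : IsLogChart E p φ X idx) : NewtonNondegenerateAt E F p ↔ HarnackIn X φ p α := by
  have hc : ∀ c : AdaptedCoords n E p,
      (∀ a s, IsLogGenerator F c a → IsExpansion c a s →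
        ∀ Φ, IsCompactFace (expansionSupport s) Φ → NondegenerateWrtFace s Φ) ↔
      HarnackIn c.divisorIdx c.chart p α := fun c => by
    rw [nondegenerate_iff_harnack hα c, HarnackIn, c.chart_center]
  constructor
  · intro H
    obtain ⟨c⟩ := h.nonempty_adaptedCoords
    exact h.harnackIn c.isLogChart ((hc c).1 (H c))
  · intro H c
    exact (hc c).2 (c.isLogChart.harnackIn h H)

end Compare

/-! ## The monomial maps that describe a combinatorial blowing-up -/

section Toric

variable {n : ℕ}

/-- The map that multiplies the coordinates in `A` by the coordinate `k₀`. -/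
def toric (A : Finset (Fin n)) (k₀ : Fin n) (z : Fin n → ℂ) : Fin n → ℂ :=
  fun k => if k ∈ A then z k₀ * z k else z k

/-- The map that divides the coordinates in `A` by the coordinate `k₀`. -/
def toricInv (A : Finset (Fin n)) (k₀ : Fin n) (z : Fin n → ℂ) : Fin n → ℂ :=
  fun k => if k ∈ A then z k / z k₀ else z k

/-- The weights of the coordinates of `toric A k₀ z`, in terms of those of `z`. -/
def toricWeight (A : Finset (Fin n)) (k₀ : Fin n) (w : Fin n → ℝ) : Fin n → ℝ :=
  fun k => if k ∈ A then w k₀ + w k else w k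

variable {A X : Finset (Fin n)} {k₀ : Fin n}

lemma toric_toricInv (hk₀ : k₀ ∉ A) {z : Fin n → ℂ} (hz : A.Nonempty → z k₀ ≠ 0) :
    toric A k₀ (toricInv A k₀ z) = z := by
  funext k
  by_cases hk : k ∈ A
  · simp [toric, toricInv, hk, hk₀, mul_div_cancel₀ _ (hz ⟨k, hk⟩)]
  · simp [toric, toricInv, hk]

lemma toricInv_toric (hk₀ : k₀ ∉ A) {z : Fin n → ℂ} (hz : A.Nonempty → z k₀ ≠ 0) :
    toricInv A k₀ (toric A k₀ z) = z := by
  funext k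
  by_cases hk : k ∈ A
  · simp [toric, toricInv, hk, hk₀, mul_div_cancel_left₀ _ (hz ⟨k, hk⟩)]
  · simp [toric, toricInv, hk]

lemma dil_toric {w : Fin n → ℝ} {t : ℝ} (ht : 0 < t) (z : Fin n → ℂ) :
    dil (toricWeight A k₀ w) t (toric A k₀ z) = toric A k₀ (dil w t z) := by
  funext k
  by_cases hk : k ∈ A
  · simp only [dil, toric, toricWeight, if_pos hk, Real.rpow_add ht, Complex.ofReal_mul]; ring
  · simp only [dil, toric, toricWeight, if_neg hk]

lemma continuous_toric : Continuous (toric A k₀) := by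
  refine continuous_pi fun k => ?_
  unfold toric
  split_ifs <;> fun_prop

lemma continuousAt_toricInv {z : Fin n → ℂ} (hz : A.Nonempty → z k₀ ≠ 0) :
    ContinuousAt (toricInv A k₀) z := by
  refine continuousAt_pi.2 fun k => ?_
  unfold toricInv
  split_ifs with hk
  · exact (continuous_apply k).continuousAt.div (continuous_apply k₀).continuousAt (hz ⟨k, hk⟩)
  · exact (continuous_apply k).continuousAt

/-- Multiplying coordinates adds weights. A sum of two non-negative weights is zero only if both
are, which is when the product of the two coordinates keeps a non-zero limit. -/
lemma TestPair.toric {e w z} (h : TestPair X e w z) (hA : A ⊆ X) (hk₀A : A.Nonempty → k₀ ∈ X) :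
    TestPair X (toric A k₀ e) (toricWeight A k₀ w) (toric A k₀ z) := by
  refine ⟨fun k => ?_, fun k hk => ?_, fun k hk => ?_, fun k => ?_⟩ <;>
  by_cases hkA : k ∈ A
  · simpa only [toricWeight, if_pos hkA] using add_nonneg (h.nonneg k₀) (h.nonneg k)
  · simpa only [toricWeight, if_neg hkA] using h.nonneg k
  · exact hA hkA
  · simp only [toricWeight, if_neg hkA] at hk
    exact h.mem k hk
  · simpa only [NewtonFoliation.toric, if_pos hkA] using
      mul_ne_zero (h.ne_zero k₀ (hk₀A ⟨k, hkA⟩)) (h.ne_zero k hk)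
  · simpa only [NewtonFoliation.toric, if_neg hkA] using h.ne_zero k hk
  · have h1 := h.nonneg k₀
    have h2 := h.nonneg k
    simp only [toricWeight, NewtonFoliation.toric, if_pos hkA, ← h.limit,
      add_eq_zero_iff_of_nonneg h1 h2]
    by_cases h3 : w k₀ = 0 <;> by_cases h4 : w k = 0 <;> simp [h3, h4]
  · simpa only [toricWeight, NewtonFoliation.toric, if_neg hkA] using h.limit k

lemma hasFDerivAt_coord (k : Fin n) (z : Fin n → ℂ) : HasFDerivAt (fun z : Fin n → ℂ => z k)
    (ContinuousLinearMap.proj (R := ℂ) (φ := fun _ : Fin n => ℂ) k) z :=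
  (ContinuousLinearMap.proj (R := ℂ) (φ := fun _ : Fin n => ℂ) k).hasFDerivAt

lemma fderiv_toric (z : Fin n → ℂ) (k l : Fin n) :
    fderiv ℂ (toric A k₀) z (Pi.single k 1) l =
      if l ∈ A then z l * (if k₀ = k then 1 else 0) + z k₀ * (if l = k then 1 else 0)
      else if l = k then 1 else 0 := by
  have h : HasFDerivAt (toric A k₀) (ContinuousLinearMap.pi fun l =>
      if l ∈ A then z k₀ • ContinuousLinearMap.proj (R := ℂ) (φ := fun _ : Fin n => ℂ) l +
        z l • ContinuousLinearMap.proj (R := ℂ) (φ := fun _ : Fin n => ℂ) k₀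
      else ContinuousLinearMap.proj (R := ℂ) (φ := fun _ : Fin n => ℂ) l) z := by
    refine hasFDerivAt_pi.2 fun l => ?_
    by_cases hl : l ∈ A
    · simp only [toric, if_pos hl]
      exact (hasFDerivAt_coord k₀ z).mul (hasFDerivAt_coord l z)
    · simp only [toric, if_neg hl]
      exact hasFDerivAt_coord l z
  rw [h.fderiv, ContinuousLinearMap.coe_pi']
  split_ifs <;> simp_all

end Toric

/-! ### Pull-back of logarithmic coefficients by the monomial maps -/

section ToricChart

variable {n : ℕ} {M M' : Type*} [TopologicalSpace M] [ChartedSpace (Fin n → ℂ) M]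
  [TopologicalSpace M'] [ChartedSpace (Fin n → ℂ) M']

/-- The map `π` is given by `toric A k₀` in the charts `φ'` and `φ`. -/
structure IsToricChart (π : M' → M) (φ' : OpenPartialHomeomorph M' (Fin n → ℂ))
    (φ : OpenPartialHomeomorph M (Fin n → ℂ)) (X A : Finset (Fin n)) (k₀ : Fin n) : Prop where
  chart_mem' : φ' ∈ coordSystems n M'
  chart_mem : φ ∈ coordSystems n M
  mapsTo : ∀ r ∈ φ'.source, π r ∈ φ.source
  apply_eq : ∀ r ∈ φ'.source, φ (π r) = toric A k₀ (φ' r)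
  subset : A ⊆ X
  notMem : k₀ ∉ A
  mem_of_nonempty : A.Nonempty → k₀ ∈ X

variable {π : M' → M} {φ' : OpenPartialHomeomorph M' (Fin n → ℂ)}
  {φ : OpenPartialHomeomorph M (Fin n → ℂ)} {X A : Finset (Fin n)} {k₀ : Fin n}

/-- For `l ∈ A` the form `dx l / x l` pulls back to `dz l / z l + dz k₀ / z k₀`, the other basic
forms being unchanged. The matrix is constant and unipotent: only the coefficient number `k₀`
changes, by the sum over `A`. -/
lemma IsToricChart.logCoeff_of_ne (h : IsToricChart π φ' φ X A k₀)
    (hπ : ContMDiff 𝓘(ℂ, Fin n → ℂ) 𝓘(ℂ, Fin n → ℂ) ω π) (α : OneForm n M) {z : Fin n → ℂ}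
    (hz : z ∈ φ'.target) (k : Fin n) :
    logCoeff X φ' (pullback π α) k z = logCoeff X φ α k (toric A k₀ z) +
      if k = k₀ then ∑ l ∈ A, logCoeff X φ α l (toric A k₀ z) else 0 := by
  have hsrc := φ'.map_target hz
  have hev : (fun z => φ (π (φ'.symm z))) =ᶠ[𝓝 z] toric A k₀ := by
    filter_upwards [φ'.open_target.mem_nhds hz] with y hy
    rw [h.apply_eq _ (φ'.map_target hy), φ'.right_inv hy]
  have h0 : coeff φ' (pullback π α) k z = ∑ l, coeff φ α l (toric A k₀ z) *
      if l ∈ A then z l * (if k₀ = k then 1 else 0) + z k₀ * (if l = k then 1 else 0)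
      else if l = k then 1 else 0 := by
    rw [coeff_pullback h.chart_mem h.chart_mem' α hz hπ.contMDiffAt (h.mapsTo _ hsrc),
      hev.fderiv_eq]
    refine Finset.sum_congr rfl fun l _ => ?_
    rw [fderiv_toric, h.apply_eq _ hsrc, φ'.right_inv hz]
  have h1 : coeff φ' (pullback π α) k z =
      (if k ∈ A then z k₀ else 1) * coeff φ α k (toric A k₀ z) +
      if k = k₀ then ∑ l ∈ A, z l * coeff φ α l (toric A k₀ z) else 0 := by
    rw [h0]
    have h2 : ∀ l, coeff φ α l (toric A k₀ z) *
        (if l ∈ A then z l * (if k₀ = k then 1 else 0) + z k₀ * (if l = k then 1 else 0)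
        else if l = k then 1 else 0) =
        (if l = k then (if k ∈ A then z k₀ else 1) * coeff φ α k (toric A k₀ z) else 0) +
        (if l ∈ A then (if k = k₀ then z l * coeff φ α l (toric A k₀ z) else 0) else 0) := by
      intro l
      by_cases hl : l = k
      · subst hl
        by_cases hlA : l ∈ A <;> by_cases hlk : k₀ = l <;> simp [hlA, hlk, eq_comm] <;> ring
      · by_cases hlA : l ∈ A <;> by_cases hkk : k₀ = k <;> simp [hl, hlA, hkk, eq_comm]
        ring
    rw [Finset.sum_congr rfl fun l _ => h2 l, Finset.sum_add_distrib]
    congr 1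
    · simp
    · rw [Finset.sum_ite_mem, Finset.univ_inter]
      split_ifs <;> simp
  rw [logCoeff, h1, logCoeff]
  by_cases hk : k = k₀
  · subst hk
    simp only [if_neg h.notMem, one_mul, if_true, toric]
    rw [mul_add]
    congr 1
    by_cases hA : A.Nonempty
    · rw [if_pos (h.mem_of_nonempty hA), Finset.mul_sum]
      refine Finset.sum_congr rfl fun l hl => ?_
      rw [logCoeff, if_pos (h.subset hl)]
      simp only [toric, if_pos hl]
      ring
    · rw [Finset.not_nonempty_iff_eq_empty.1 hA]
      simp
  · simp only [if_neg hk, add_zero, toric]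
    by_cases hkA : k ∈ A
    · simp only [if_pos hkA, if_pos (h.subset hkA)]; ring
    · simp only [if_neg hkA, one_mul]

lemma IsToricChart.logNorm_le (h : IsToricChart π φ' φ X A k₀)
    (hπ : ContMDiff 𝓘(ℂ, Fin n → ℂ) 𝓘(ℂ, Fin n → ℂ) ω π) (α : OneForm n M) {z : Fin n → ℂ}
    (hz : z ∈ φ'.target) :
    logNorm X φ' (pullback π α) z ≤ (1 + A.card) * logNorm X φ α (toric A k₀ z) := by
  have h0 := logNorm_nonneg X φ α (toric A k₀ z)
  refine (pi_norm_le_iff_of_nonneg (by positivity)).2 fun k => ?_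
  rw [h.logCoeff_of_ne hπ α hz, add_mul, one_mul]
  refine (norm_add_le _ _).trans (add_le_add (norm_logCoeff_le _ _ _ _ _) ?_)
  split_ifs
  · refine (norm_sum_le _ _).trans ?_
    rw [← nsmul_eq_mul]
    exact Finset.sum_le_card_nsmul _ _ _ fun l _ => norm_logCoeff_le _ _ _ _ _
  · rw [norm_zero]; positivity

/-- As `k₀ ∉ A`, the coefficients in `A` are unchanged, so the inverse matrix subtracts the same sum
and has the same bound. -/
lemma IsToricChart.le_logNorm (h : IsToricChart π φ' φ X A k₀)
    (hπ : ContMDiff 𝓘(ℂ, Fin n → ℂ) 𝓘(ℂ, Fin n → ℂ) ω π) (α : OneForm n M) {z : Fin n → ℂ}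
    (hz : z ∈ φ'.target) :
    logNorm X φ α (toric A k₀ z) ≤ (1 + A.card) * logNorm X φ' (pullback π α) z := by
  have h0 := logNorm_nonneg X φ' (pullback π α) z
  have h1 : ∀ k ∈ A, logCoeff X φ' (pullback π α) k z = logCoeff X φ α k (toric A k₀ z) :=
    fun k hk => by
      have hne : k ≠ k₀ := by rintro rfl; exact h.notMem hk
      rw [h.logCoeff_of_ne hπ α hz, if_neg hne, add_zero]
  have h2 : ∀ k, logCoeff X φ α k (toric A k₀ z) = logCoeff X φ' (pullback π α) k z -
      if k = k₀ then ∑ l ∈ A, logCoeff X φ' (pullback π α) l z else 0 := fun k => by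
    rw [Finset.sum_congr rfl h1, h.logCoeff_of_ne hπ α hz, add_sub_cancel_right]
  refine (pi_norm_le_iff_of_nonneg (by positivity)).2 fun k => ?_
  rw [h2, add_mul, one_mul]
  refine (norm_sub_le _ _).trans (add_le_add (norm_logCoeff_le _ _ _ _ _) ?_)
  split_ifs
  · refine (norm_sum_le _ _).trans ?_
    rw [← nsmul_eq_mul]
    exact Finset.sum_le_card_nsmul _ _ _ fun l _ => norm_logCoeff_le _ _ _ _ _
  · rw [norm_zero]; positivity

/-- The Harnack property along corresponding test curves upstairs and downstairs. -/
theorem IsToricChart.harnack_iff (h : IsToricChart π φ' φ X A k₀)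
    (hπ : ContMDiff 𝓘(ℂ, Fin n → ℂ) 𝓘(ℂ, Fin n → ℂ) ω π) (α : OneForm n M) {q : M'}
    (hq : q ∈ φ'.source) {w : Fin n → ℝ} {z₀ : Fin n → ℂ} (hp : TestPair X (φ' q) w z₀) :
    Harnack (logNorm X φ' (pullback π α)) w z₀ ↔
      Harnack (logNorm X φ α) (toricWeight A k₀ w) (toric A k₀ z₀) := by
  have htar := hp.tendsto.eventually (eventually_mem_target hq)
  have hz₀ : A.Nonempty → z₀ k₀ ≠ 0 := fun hA => hp.ne_zero _ (h.mem_of_nonempty hA)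
  constructor
  · intro H
    have hz₀' : A.Nonempty → toric A k₀ z₀ k₀ ≠ 0 := fun hA => by
      simpa [toric, h.notMem] using hz₀ hA
    -- The monomial map is not invertible along `z k₀ = 0`. If `A` is non-empty, the base point is
    -- off this hyperplane, and so are the curves for `t > 0`; hence division by `z k₀` is
    -- legitimate.
    have hinv : Tendsto (toricInv A k₀) (𝓝 (toric A k₀ z₀)) (𝓝 z₀) := by
      have := (continuousAt_toricInv (A := A) hz₀').tendsto
      rwa [toricInv_toric h.notMem hz₀] at this
    have hev : ∀ᶠ q : ℝ × (Fin n → ℂ) in 𝓝[>] 0 ×ˢ 𝓝 (toric A k₀ z₀),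
        0 < q.1 ∧ (A.Nonempty → q.2 k₀ ≠ 0) := by
      suffices h1 : ∀ᶠ z in 𝓝 (toric A k₀ z₀), A.Nonempty → z k₀ ≠ 0 from
        (eventually_pos_prod _).and ((tendsto_snd (f := 𝓝[>] (0 : ℝ))).eventually h1)
      by_cases hA : A.Nonempty
      · exact ((continuous_apply k₀).continuousAt.eventually_ne (hz₀' hA)).mono fun z hz _ => hz
      · exact Eventually.of_forall fun z h => absurd h hA
    have hcomm : ∀ᶠ q : ℝ × (Fin n → ℂ) in 𝓝[>] 0 ×ˢ 𝓝 (toric A k₀ z₀),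
        dil w q.1 (toricInv A k₀ q.2) = toricInv A k₀ (dil (toricWeight A k₀ w) q.1 q.2) ∧
        toric A k₀ (dil w q.1 (toricInv A k₀ q.2)) = dil (toricWeight A k₀ w) q.1 q.2 := by
      filter_upwards [hev] with q hq
      have h1 : toric A k₀ (dil w q.1 (toricInv A k₀ q.2)) = dil (toricWeight A k₀ w) q.1 q.2 := by
        rw [← dil_toric hq.1, toric_toricInv h.notMem hq.2]
      refine ⟨?_, h1⟩
      rw [← h1, toricInv_toric h.notMem]
      intro hA
      have := hq.2 hA
      have ht := (Real.rpow_pos_of_pos hq.1 (w k₀)).ne'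
      simp only [dil, toricInv, if_neg h.notMem]
      exact mul_ne_zero (by exact_mod_cast ht) this
    have ht : Tendsto (fun q : ℝ × (Fin n → ℂ) => (q.1, toricInv A k₀ q.2))
        (𝓝[>] 0 ×ˢ 𝓝 (toric A k₀ z₀)) (𝓝[>] 0 ×ˢ 𝓝 z₀) :=
      tendsto_fst.prodMk (hinv.comp tendsto_snd)
    have htar' := ht.eventually htar
    refine Harnack.of_comparable (logNorm_nonneg X φ α) (logNorm_nonneg X φ' (pullback π α))
      (Φ := toricInv A k₀) (fun q => toricInv A k₀ q.2) (hinv.comp tendsto_snd)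
      (hcomm.mono fun q hq => hq.1) ⟨1 + A.card, ?_⟩ ⟨1 + A.card, ?_⟩ H
    · filter_upwards [hcomm, htar'] with q h1 h2
      rw [← h1.1, ← h1.2]
      exact h.le_logNorm hπ α h2
    · filter_upwards [hcomm, htar'] with q h1 h2
      rw [← h1.1, ← h1.2]
      exact h.logNorm_le hπ α h2
  · intro H
    refine Harnack.of_comparable (logNorm_nonneg X φ' (pullback π α)) (logNorm_nonneg X φ α)
      (Φ := toric A k₀) (fun q => toric A k₀ q.2)
      ((continuous_toric.tendsto z₀).comp tendsto_snd) ?_ ⟨1 + A.card, ?_⟩ ⟨1 + A.card, ?_⟩ H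
    · filter_upwards [eventually_pos_prod z₀] with q hq
      exact dil_toric hq q.2
    · exact htar.mono fun q hq => h.logNorm_le hπ α hq
    · exact htar.mono fun q hq => h.le_logNorm hπ α hq

lemma IsToricChart.harnackIn_pullback (h : IsToricChart π φ' φ X A k₀)
    (hπ : ContMDiff 𝓘(ℂ, Fin n → ℂ) 𝓘(ℂ, Fin n → ℂ) ω π) {α : OneForm n M} {q : M'}
    (hq : q ∈ φ'.source) (H : HarnackIn X φ (π q) α) : HarnackIn X φ' q (pullback π α) := by
  intro w z₀ hp
  refine (h.harnack_iff hπ α hq hp).2 (H _ _ ?_)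
  rw [h.apply_eq q hq]
  exact hp.toric h.subset h.mem_of_nonempty

end ToricChart

/-! ## Charts of a combinatorial blowing-up -/

/-- A logarithmic chart, from a matching between the components of the divisor and coordinates. -/
lemma exists_isLogChart {n : ℕ} {M I : Type*} [TopologicalSpace M] [ChartedSpace (Fin n → ℂ) M]
    {E : I → Set M} {p : M} {φ : OpenPartialHomeomorph M (Fin n → ℂ)} {X : Finset (Fin n)}
    (hφ : φ ∈ coordSystems n M) (hp : p ∈ φ.source) (R : I → Fin n → Prop)
    (hex : ∀ i, p ∈ E i → ∃ k, R i k) (hinj : ∀ i i' k, R i k → R i' k → i = i')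
    (huniq : ∀ i k k', R i k → R i k' → k = k')
    (hrange : ∀ k, (∃ i, p ∈ E i ∧ R i k) ↔ k ∈ X ∧ φ p k = 0)
    (hmem : ∀ i k, R i k → ∀ᶠ q in 𝓝 p, q ∈ E i ↔ φ q k = 0)
    (hnot : ∀ i, p ∉ E i → ∀ᶠ q in 𝓝 p, q ∉ E i) : ∃ idx, IsLogChart E p φ X idx := by
  choose f hf using fun i : StratumIndex E p => hex i.1 i.2
  refine ⟨⟨f, fun i i' h => Subtype.ext (hinj _ _ _ (hf i) (h ▸ hf i'))⟩, hφ, hp, fun k => ?_,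
    fun i => hmem _ _ (hf i), hnot⟩
  rw [← hrange]
  constructor
  · rintro ⟨i, rfl⟩
    exact ⟨i.1, i.2, hf i⟩
  · rintro ⟨i, hi, hk⟩
    exact ⟨⟨i, hi⟩, huniq _ _ _ (hf ⟨i, hi⟩) hk⟩

section BlowupChart

variable {n : ℕ} {M M' I : Type*} [TopologicalSpace M] [ChartedSpace (Fin n → ℂ) M]
  [TopologicalSpace M'] [ChartedSpace (Fin n → ℂ) M']

/-- A chart of the blowing-up with center `E_J`, which covers a chart adapted to the divisor. The
proposition `P` tells whether the chart meets the exceptional divisor, which then is the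
hyperplane with equation number `k₀`. -/
structure IsBlowupChart {E : I → Set M} {p : M} (c : AdaptedCoords n E p) (J : Set I) (π : M' → M)
    (φ' : OpenPartialHomeomorph M' (Fin n → ℂ)) (A : Finset (Fin n)) (k₀ : Fin n) (P : Prop) :
    Prop extends IsToricChart π φ' c.chart c.divisorIdx A k₀ where
  mem_center : ∀ r ∈ φ'.source, π r ∈ stratumClosure E J ↔ P ∧ φ' r k₀ = 0
  prop_of_nonempty : A.Nonempty → P
  mem_of_prop : P → k₀ ∈ c.divisorIdx

variable {E : I → Set M} {p : M} {c : AdaptedCoords n E p} {J : Set I} {π : M' → M}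
  {φ' : OpenPartialHomeomorph M' (Fin n → ℂ)} {A : Finset (Fin n)} {k₀ : Fin n} {P : Prop}

lemma IsBlowupChart.notMem_strict (h : IsBlowupChart c J π φ' A k₀ P) {i : I} (hi : p ∉ E i)
    {r : M'} (hr : r ∈ φ'.source) : r ∉ transformDivisor E J π (some i) := by
  intro hmem
  have := (mem_closure_iff_frequently.1 hmem).and_eventually (φ'.open_source.mem_nhds hr)
  obtain ⟨r', h1, h2⟩ := this.exists
  exact c.not_mem i hi _ (h.mapsTo r' h2) h1.1

/-- The equation of `E i` pulls back to one coordinate, or to its product with the coordinate `k₀`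
if its number is in `A`; removing the center discards the latter factor. A component whose own
coordinate is the exceptional one disappears from the chart. -/
lemma IsBlowupChart.mem_diff_iff (h : IsBlowupChart c J π φ' A k₀ P) {i : I} (hi : p ∈ E i)
    {r : M'} (hr : r ∈ φ'.source) : r ∈ π ⁻¹' (E i \ stratumClosure E J) ↔
      ¬ (P ∧ c.idx ⟨i, hi⟩ = k₀) ∧ φ' r (c.idx ⟨i, hi⟩) = 0 ∧ ¬ (P ∧ φ' r k₀ = 0) := by
  rw [Set.mem_preimage, Set.mem_sdiff, h.mem_center r hr, c.mem_iff ⟨i, hi⟩ _ (h.mapsTo r hr),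
    h.apply_eq r hr]
  have hA := h.prop_of_nonempty
  by_cases hk : c.idx ⟨i, hi⟩ = k₀
  · have := h.notMem
    simp only [toric, hk, if_neg this]
    tauto
  · by_cases hkA : c.idx ⟨i, hi⟩ ∈ A
    · have hP := hA ⟨_, hkA⟩
      simp only [toric, if_pos hkA, mul_eq_zero]
      tauto
    · simp only [toric, if_neg hkA]
      tauto

/-- In a coordinate hyperplane other than the exceptional one, the points off the exceptional
divisor are dense, so taking the closure adds back the intersection. -/
lemma IsBlowupChart.mem_strict_iff (h : IsBlowupChart c J π φ' A k₀ P) {i : I} (hi : p ∈ E i)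
    {r : M'} (hr : r ∈ φ'.source) : r ∈ transformDivisor E J π (some i) ↔
      ¬ (P ∧ c.idx ⟨i, hi⟩ = k₀) ∧ φ' r (c.idx ⟨i, hi⟩) = 0 := by
  have hsrc := φ'.open_source.mem_nhds hr
  constructor
  · intro hmem
    have h1 := (mem_closure_iff_frequently.1 hmem).and_eventually hsrc
    have h2 : ∃ᶠ r' in 𝓝 r, ¬ (P ∧ c.idx ⟨i, hi⟩ = k₀) ∧ φ' r' (c.idx ⟨i, hi⟩) = 0 :=
      h1.mono fun r' hr' => by
        have := (h.mem_diff_iff hi hr'.2).1 hr'.1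
        exact ⟨this.1, this.2.1⟩
    obtain ⟨r', h3, -⟩ := h2.exists
    refine ⟨h3, ?_⟩
    by_contra hne
    have h4 : ∀ᶠ r' in 𝓝 r, φ' r' (c.idx ⟨i, hi⟩) ≠ 0 :=
      ((continuous_apply _).continuousAt.comp (φ'.continuousAt hr)).eventually_ne hne
    obtain ⟨r', h5, h6⟩ := (h2.and_eventually h4).exists
    exact h6 h5.2
  · rintro ⟨hk, h0⟩
    by_cases hP : P
    · have hne : c.idx ⟨i, hi⟩ ≠ k₀ := fun hk' => hk ⟨hP, hk'⟩
      -- Changing only the coordinate `k₀` leaves the exceptional hyperplane while staying in the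
      -- hyperplane of the strict transform.
      set γ : ℂ → (Fin n → ℂ) := fun s => Function.update (φ' r) k₀ (φ' r k₀ + s) with hγ
      have hγ0 : γ 0 = φ' r := by simp [hγ]
      have hγc : Continuous γ := continuous_const.update k₀ (by fun_prop)
      have hγt : Tendsto γ (𝓝[≠] 0) (𝓝 (φ' r)) := by
        have := hγc.tendsto 0
        rw [hγ0] at this
        exact this.mono_left nhdsWithin_le_nhds
      have hev : ∀ᶠ s in 𝓝[≠] (0 : ℂ), φ' r k₀ + s ≠ 0 := by
        by_cases hz : φ' r k₀ = 0
        · filter_upwards [self_mem_nhdsWithin] with s hs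
          rwa [hz, zero_add]
        · have : ContinuousAt (fun s : ℂ => φ' r k₀ + s) 0 := by fun_prop
          exact (this.eventually_ne (by simpa using hz)).filter_mono nhdsWithin_le_nhds
      refine mem_closure_iff_frequently.2
        (((tendsto_symm hr).comp hγt).frequently (Eventually.frequently ?_))
      filter_upwards [hev, hγt.eventually (eventually_mem_target hr)] with s hs hst
      refine (h.mem_diff_iff hi (φ'.map_target hst)).2 ⟨hk, ?_, ?_⟩
      · rw [φ'.right_inv hst, hγ]
        simpa [hne] using h0
      · rw [φ'.right_inv hst, hγ]
        simpa using fun _ => hs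
    · refine subset_closure ((h.mem_diff_iff hi hr).2 ⟨hk, h0, fun h => hP h.1⟩)

/-- A chart of the blowing-up is a logarithmic chart for the total transform of the divisor. -/
theorem IsBlowupChart.exists_isLogChart (h : IsBlowupChart c J π φ' A k₀ P) {q : M'}
    (hq : q ∈ φ'.source) :
    ∃ idx, IsLogChart (transformDivisor E J π) q φ' c.divisorIdx idx := by
  have hsrc := φ'.open_source.mem_nhds hq
  -- The exceptional divisor takes the coordinate `k₀`, and the strict transform of `E i` keeps the
  -- coordinate of `E i` unless that coordinate is `k₀`.
  refine NewtonFoliation.exists_isLogChart h.chart_mem' hq (fun o k => (o = none ∧ P ∧ k = k₀) ∨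
    ∃ i, ∃ hi : p ∈ E i, o = some i ∧ ¬ (P ∧ c.idx ⟨i, hi⟩ = k₀) ∧ k = c.idx ⟨i, hi⟩)
    ?_ ?_ ?_ ?_ ?_ ?_
  · rintro (_ | i) ho
    · exact ⟨k₀, Or.inl ⟨rfl, ((h.mem_center q hq).1 ho).1, rfl⟩⟩
    · by_cases hi : p ∈ E i
      · exact ⟨_, Or.inr ⟨i, hi, rfl, ((h.mem_strict_iff hi hq).1 ho).1, rfl⟩⟩
      · exact absurd ho (h.notMem_strict hi hq)
  · rintro o o' k (⟨rfl, hP, rfl⟩ | ⟨i, hi, rfl, hk, rfl⟩) (⟨rfl, hP', hk'⟩ | ⟨i', hi', rfl, hk', he⟩)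
    · rfl
    · exact absurd ⟨hP, he.symm⟩ hk'
    · exact absurd ⟨hP', hk'⟩ hk
    · have := congrArg Subtype.val (c.idx.injective he)
      exact congrArg some this
  · rintro o k k' (⟨rfl, hP, rfl⟩ | ⟨i, hi, rfl, hk, rfl⟩) (⟨ho, hP', hk'⟩ | ⟨i', hi', ho, hk', he⟩)
    · exact hk'.symm
    · cases ho
    · cases ho
    · cases ho
      exact he.symm
  · intro k
    constructor
    · rintro ⟨o, ho, ⟨rfl, hP, rfl⟩ | ⟨i, hi, rfl, hk, rfl⟩⟩
      · exact ⟨h.mem_of_prop hP, ((h.mem_center q hq).1 ho).2⟩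
      · exact ⟨c.mem_divisorIdx.2 ⟨_, rfl⟩, ((h.mem_strict_iff hi hq).1 ho).2⟩
    · rintro ⟨hkX, hk0⟩
      by_cases hk : P ∧ k = k₀
      · obtain ⟨hP, rfl⟩ := hk
        exact ⟨none, (h.mem_center q hq).2 ⟨hP, hk0⟩, Or.inl ⟨rfl, hP, rfl⟩⟩
      · obtain ⟨⟨i, hi⟩, rfl⟩ := c.mem_divisorIdx.1 hkX
        exact ⟨some i, (h.mem_strict_iff hi hq).2 ⟨hk, hk0⟩, Or.inr ⟨i, hi, rfl, hk, rfl⟩⟩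
  · rintro o k (⟨rfl, hP, rfl⟩ | ⟨i, hi, rfl, hk, rfl⟩)
    · filter_upwards [hsrc] with r hr
      exact (h.mem_center r hr).trans (and_iff_right hP)
    · filter_upwards [hsrc] with r hr
      exact (h.mem_strict_iff hi hr).trans (and_iff_right hk)
  · rintro (_ | i) ho
    · by_cases hP : P
      · have hne : φ' q k₀ ≠ 0 := fun h0 => ho ((h.mem_center q hq).2 ⟨hP, h0⟩)
        filter_upwards [hsrc, ((continuous_apply k₀).continuousAt.comp
          (φ'.continuousAt hq)).eventually_ne hne] with r hr hr0
        exact fun hr' => hr0 ((h.mem_center r hr).1 hr').2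
      · filter_upwards [hsrc] with r hr
        exact fun hr' => hP ((h.mem_center r hr).1 hr').1
    · by_cases hi : p ∈ E i
      · by_cases hk : P ∧ c.idx ⟨i, hi⟩ = k₀
        · filter_upwards [hsrc] with r hr
          exact fun hr' => ((h.mem_strict_iff hi hr).1 hr').1 hk
        · have hne : φ' q (c.idx ⟨i, hi⟩) ≠ 0 := fun h0 => ho ((h.mem_strict_iff hi hq).2 ⟨hk, h0⟩)
          filter_upwards [hsrc, ((continuous_apply (c.idx ⟨i, hi⟩)).continuousAt.comp
            (φ'.continuousAt hq)).eventually_ne hne] with r hr hr0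
          exact fun hr' => hr0 ((h.mem_strict_iff hi hr).1 hr').2
      · filter_upwards [hsrc] with r hr
        exact h.notMem_strict hi hr

/-- Away from the center, the blowing-up is an isomorphism. -/
lemma IsCombinatorialBlowup.exists_isBlowupChart_of_notMem
    [IsManifold 𝓘(ℂ, Fin n → ℂ) ω M] [IsManifold 𝓘(ℂ, Fin n → ℂ) ω M']
    (hπ : IsCombinatorialBlowup n E J π) (c : AdaptedCoords n E p)
    (hp : p ∉ stratumClosure E J) {q : M'} (hq : π q ∈ c.chart.source) (k₀ : Fin n) :
    ∃ φ', q ∈ φ'.source ∧ IsBlowupChart c J π φ' ∅ k₀ False := by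
  -- Some `E j` with `j ∈ J` misses `p`; an adapted chart then misses that component, hence the
  -- center. Therefore `A` is empty, `P` is false and `k₀` is a dummy.
  have hnot : ∀ p' ∈ c.chart.source, p' ∉ stratumClosure E J := fun p' hp' hJ => by
    simp only [stratumClosure, Set.mem_ofPred_eq, not_forall] at hp hJ
    obtain ⟨j, hj, hpj⟩ := hp
    exact c.not_mem j hpj _ hp' (hJ j hj)
  obtain ⟨Φ, hqΦ, hΦ⟩ := hπ.localDiffeo_compl ⟨q, hnot _ hq⟩
  have hΦ' : ∀ r ∈ Φ.source, π r = Φ.toOpenPartialHomeomorph r := fun r hr => hΦ hr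
  have hc := c.chart_mem
  have hmem : ∀ r ∈ (Φ.toOpenPartialHomeomorph ≫ₕ c.chart).source,
      r ∈ Φ.source ∧ π r ∈ c.chart.source := fun r hr => by
    rw [OpenPartialHomeomorph.trans_source] at hr
    refine ⟨hr.1, ?_⟩
    rw [hΦ' r hr.1]
    exact hr.2
  refine ⟨Φ.toOpenPartialHomeomorph ≫ₕ c.chart, ?_, ⟨?_, hc, fun r hr => (hmem r hr).2,
    fun r hr => ?_, Finset.empty_subset _, Finset.notMem_empty _, fun h => absurd rfl h.ne_empty⟩,
    fun r hr => ?_, fun h => absurd rfl h.ne_empty, False.elim⟩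
  · rw [OpenPartialHomeomorph.trans_source]
    refine ⟨hqΦ, ?_⟩
    rwa [hΦ' q hqΦ] at hq
  · refine OpenPartialHomeomorph.mem_maximalAtlas_of_contMDiffOn _ ?_ ?_
    · rw [OpenPartialHomeomorph.coe_trans, OpenPartialHomeomorph.trans_source]
      exact (contMDiffOn_of_mem_maximalAtlas hc).comp
        (Φ.contMDiffOn_toFun.mono inter_subset_left) inter_subset_right
    · rw [OpenPartialHomeomorph.coe_trans_symm, OpenPartialHomeomorph.trans_target]
      exact ContMDiffOn.comp (t := Φ.target) Φ.contMDiffOn_invFun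
        ((contMDiffOn_symm_of_mem_maximalAtlas hc).mono inter_subset_left) inter_subset_right
  · rw [hΦ' r (hmem r hr).1]
    funext k
    simp [toric]
  · simpa only [false_and, iff_false] using hnot _ (hmem r hr).2

/-- The charts of the blowing-up over a chart adapted to the divisor at a point of the center. -/
lemma isBlowupChart_of_mem {c : AdaptedCoords n E p} (hp : p ∈ stratumClosure E J)
    {L : M' → ℙ ℂ (J → ℂ)}
    (hL : ∀ r, π r ∈ c.chart.source →
      (fun j : J => c.chart (π r) (c.idx ⟨j.1, hp j.1 j.2⟩)) ∈ (L r).submodule)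
    {j₀ : J} {ψ : OpenPartialHomeomorph M' (Fin n → ℂ)} (hψ : ψ ∈ coordSystems n M')
    (hsource : ψ.source = {q | π q ∈ c.chart.source ∧ (L q).rep j₀ ≠ 0})
    (hval : ∀ q ∈ ψ.source,
      ψ q (c.idx ⟨j₀.1, hp j₀.1 j₀.2⟩) = c.chart (π q) (c.idx ⟨j₀.1, hp j₀.1 j₀.2⟩) ∧
      (∀ j : J, j ≠ j₀ → ψ q (c.idx ⟨j.1, hp j.1 j.2⟩) = (L q).rep j / (L q).rep j₀) ∧
      ∀ k : Fin n, (∀ j : J, k ≠ c.idx ⟨j.1, hp j.1 j.2⟩) → ψ q k = c.chart (π q) k)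
    {A : Finset (Fin n)}
    (hA : ∀ k, k ∈ A ↔ ∃ j : J, j ≠ j₀ ∧ c.idx ⟨j.1, hp j.1 j.2⟩ = k) :
    IsBlowupChart c J π ψ A (c.idx ⟨j₀.1, hp j₀.1 j₀.2⟩) True := by
  have hinj : ∀ j j' : J, c.idx ⟨j.1, hp j.1 j.2⟩ = c.idx ⟨j'.1, hp j'.1 j'.2⟩ → j = j' :=
    fun j j' h => Subtype.ext (Subtype.mk.inj (c.idx.injective h))
  have hnot : c.idx ⟨j₀.1, hp j₀.1 j₀.2⟩ ∉ A := fun h => by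
    obtain ⟨j, hj, hjj⟩ := (hA _).1 h
    exact hj (hinj _ _ hjj)
  have hsrc : ∀ r ∈ ψ.source, π r ∈ c.chart.source ∧ (L r).rep j₀ ≠ 0 := fun r hr => by
    rwa [hsource] at hr
  have happ : ∀ r ∈ ψ.source,
      c.chart (π r) = toric A (c.idx ⟨j₀.1, hp j₀.1 j₀.2⟩) (ψ r) := fun r hr => by
    obtain ⟨h1, h2, h3⟩ := hval r hr
    funext k
    by_cases hk : ∃ j : J, k = c.idx ⟨j.1, hp j.1 j.2⟩
    · obtain ⟨j, rfl⟩ := hk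
      by_cases hj : j = j₀
      · subst hj
        rw [toric, if_neg hnot, h1]
      · rw [toric, if_pos ((hA _).2 ⟨j, hj, rfl⟩), h1, h2 j hj]
        -- The vector of the `x j` is a multiple of the representative of its line, so `x j` is `x
        -- j₀` times the quotient of the homogeneous coordinates, also where the vector is zero.
        have := hL r (hsrc r hr).1
        rw [Projectivization.submodule_eq, Submodule.mem_span_singleton] at this
        obtain ⟨a, ha⟩ := this
        have e1 := congrFun ha j
        have e2 := congrFun ha j₀
        simp only [Pi.smul_apply, smul_eq_mul] at e1 e2
        rw [← e1, ← e2]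
        field_simp [(hsrc r hr).2]
    · have hk' : k ∉ A := fun h => by
        obtain ⟨j, -, hj⟩ := (hA _).1 h
        exact hk ⟨j, hj.symm⟩
      rw [toric, if_neg hk', h3 k (fun j hj => hk ⟨j, hj⟩)]
  refine ⟨⟨hψ, c.chart_mem, fun r hr => (hsrc r hr).1, happ, fun k hk => ?_, hnot, fun _ => ?_⟩,
    fun r hr => ?_, fun _ => trivial, fun _ => ?_⟩
  · obtain ⟨j, -, rfl⟩ := (hA _).1 hk
    exact c.mem_divisorIdx.2 ⟨_, rfl⟩
  · exact c.mem_divisorIdx.2 ⟨_, rfl⟩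
  · rw [true_and]
    have hmem := fun j : J => c.mem_iff ⟨j.1, hp j.1 j.2⟩ _ (hsrc r hr).1
    rw [happ r hr] at hmem
    constructor
    · intro h
      have := (hmem j₀).1 (h j₀.1 j₀.2)
      rwa [toric, if_neg hnot] at this
    · intro h0 j hj
      refine (hmem ⟨j, hj⟩).2 ?_
      by_cases hjj : (⟨j, hj⟩ : J) = j₀
      · subst hjj
        rwa [toric, if_neg hnot]
      · rw [toric, if_pos ((hA _).2 ⟨_, hjj, rfl⟩), h0, zero_mul]
  · exact c.mem_divisorIdx.2 ⟨_, rfl⟩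

/-- The domains of the charts of the blowing-up cover. -/
lemma IsCombinatorialBlowup.exists_isBlowupChart
    [IsManifold 𝓘(ℂ, Fin n → ℂ) ω M] [IsManifold 𝓘(ℂ, Fin n → ℂ) ω M']
    (hE : IsStrongNormalCrossings n E) (hπ : IsCombinatorialBlowup n E J π) (k : Fin n) (q : M') :
    ∃ (c : AdaptedCoords n E (π q)) (φ' : OpenPartialHomeomorph M' (Fin n → ℂ))
      (A : Finset (Fin n)) (k₀ : Fin n) (P : Prop), q ∈ φ'.source ∧
        IsBlowupChart c J π φ' A k₀ P := by
  classical
  by_cases hp : π q ∈ stratumClosure E J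
  · obtain ⟨c, L, hL, hψ⟩ := hπ.over_center _ hp
    obtain ⟨j₀, hj₀⟩ := Function.ne_iff.1 (L q).rep_nonzero
    obtain ⟨ψ, hψmem, hψs, hψv⟩ := hψ j₀
    refine ⟨c, ψ, Finset.univ.filter fun k => ∃ j : J, j ≠ j₀ ∧ c.idx ⟨j.1, hp j.1 j.2⟩ = k, _, _,
      ?_, isBlowupChart_of_mem hp (fun r hr => (hL.mapsTo hr).2) hψmem hψs hψv (by simp)⟩
    rw [hψs]
    exact ⟨c.mem_source, hj₀⟩
  · obtain ⟨c⟩ := hE.exists_adapted (π q)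
    obtain ⟨φ', h⟩ := hπ.exists_isBlowupChart_of_notMem c hp c.mem_source k
    exact ⟨c, φ', _, _, _, h⟩

end BlowupChart

/-! ### Lifting test curves to the blowing-up -/

section Lift

variable {n : ℕ} {M M' I : Type*} [TopologicalSpace M] [ChartedSpace (Fin n → ℂ) M]
  [TopologicalSpace M'] [ChartedSpace (Fin n → ℂ) M'] {E : I → Set M} {J : Set I} {π : M' → M}

/-- Every test pair at a point of the center comes from a test pair in a chart of the
blowing-up. -/
lemma IsBlowupOver.exists_lift [Finite I] {p : M} {c : AdaptedCoords n E p}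
    (hp : p ∈ stratumClosure E J) (hJ : J.Nonempty) (hc : IsBlowupOver c J hp π)
    {w : Fin n → ℝ} {z : Fin n → ℂ} (h : TestPair c.divisorIdx 0 w z) :
    ∃ (q : M') (φ' : OpenPartialHomeomorph M' (Fin n → ℂ)) (A : Finset (Fin n)) (k₀ : Fin n)
      (P : Prop) (w' : Fin n → ℝ) (z' : Fin n → ℂ), π q = p ∧ q ∈ φ'.source ∧
      IsBlowupChart c J π φ' A k₀ P ∧ TestPair c.divisorIdx (φ' q) w' z' ∧
      toricWeight A k₀ w' = w ∧ toric A k₀ z' = z := by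
  classical
  have := hJ.to_subtype
  obtain ⟨L, hL, hψ⟩ := hc
  set ι : J → Fin n := fun j => c.idx ⟨j.1, hp j.1 j.2⟩ with hι
  have hιX : ∀ j, ι j ∈ c.divisorIdx := fun j => c.mem_divisorIdx.2 ⟨_, rfl⟩
  -- Along the curve the coordinate of least weight on `J` tends to zero most slowly, so the
  -- quotients by it have limits. This is the chart that the lifted curve enters.
  obtain ⟨j₀, hj₀⟩ := Finite.exists_min fun j : J => w (ι j)
  obtain ⟨ψ, hψmem, hψs, hψv⟩ := hψ j₀
  set A : Finset (Fin n) := Finset.univ.filter fun k => ∃ j : J, j ≠ j₀ ∧ ι j = k with hA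
  have hmemA : ∀ k, k ∈ A ↔ ∃ j : J, j ≠ j₀ ∧ ι j = k := by simp [hA]
  have hchart : IsBlowupChart c J π ψ A (ι j₀) True :=
    isBlowupChart_of_mem hp (fun r hr => (hL.mapsTo hr).2) hψmem hψs hψv hmemA
  have hnot := hchart.notMem
  have hz₀ : z (ι j₀) ≠ 0 := h.ne_zero _ (hιX j₀)
  set w' : Fin n → ℝ := fun k => if k ∈ A then w k - w (ι j₀) else w k with hw'
  -- The end point of the lifted curve: a quotient of two coordinates of equal weight has a non-zero
  -- limit.
  set e : Fin n → ℂ := fun k => if w' k = 0 then toricInv A (ι j₀) z k else 0 with he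
  have hpair : TestPair c.divisorIdx e w' (toricInv A (ι j₀) z) := by
    refine ⟨fun k => ?_, fun k hk => ?_, fun k hk => ?_, fun k => rfl⟩ <;>
    by_cases hkA : k ∈ A
    · obtain ⟨j, -, rfl⟩ := (hmemA k).1 hkA
      simpa only [hw', if_pos hkA] using sub_nonneg.2 (hj₀ j)
    · simpa only [hw', if_neg hkA] using h.nonneg k
    · exact hchart.subset hkA
    · simp only [hw', if_neg hkA] at hk
      exact h.mem k hk
    · simpa only [toricInv, if_pos hkA] using div_ne_zero (h.ne_zero k hk) hz₀
    · simpa only [toricInv, if_neg hkA] using h.ne_zero k hk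
  have he0 : ∀ k ∉ A, e k = 0 := fun k hk => by
    simpa only [he, hw', toricInv, if_neg hk, Pi.zero_apply] using h.limit k
  set ξ : J → ℂ := fun j => if j = j₀ then 1 else e (ι j) with hξ
  have hξ₀ : ξ j₀ = 1 := if_pos rfl
  have hξne : ξ ≠ 0 := fun h0 => by simp [h0] at hξ₀
  -- The limit direction `ξ` determines a point over `p`, because the zero vector of coordinates of
  -- `p` lies on every line.
  obtain ⟨q, hq, hqp⟩ := hL.surjOn (show (p, Projectivization.mk ℂ ξ hξne) ∈ _ from by
    refine ⟨c.mem_source, ?_⟩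
    have : (fun j : J => c.chart p (c.idx ⟨j.1, hp j.1 j.2⟩)) = 0 := by
      funext j
      rw [c.chart_center]
      rfl
    simp only [this]
    exact Submodule.zero_mem _)
  obtain ⟨hqp, hqL⟩ := Prod.mk.inj hqp
  obtain ⟨a, ha⟩ := Projectivization.exists_smul_eq_mk_rep ℂ ξ hξne
  have hrep : ∀ j, (L q).rep j = a * ξ j := fun j => by
    rw [hqL, ← ha]
    rfl
  have ha0 : (a : ℂ) ≠ 0 := a.ne_zero
  have hqψ : q ∈ ψ.source := by
    rw [hψs]
    exact ⟨hq, by rwa [hrep, hξ₀, mul_one]⟩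
  have hψq : ψ q = e := by
    obtain ⟨h1, h2, h3⟩ := hψv q hqψ
    rw [hqp, c.chart_center] at h1 h3
    funext k
    by_cases hk : ∃ j : J, k = ι j
    · obtain ⟨j, rfl⟩ := hk
      by_cases hj : j = j₀
      · rw [hj, he0 _ hnot]
        exact h1
      · refine (h2 j hj).trans ?_
        rw [hrep, hrep, hξ₀, mul_one, mul_div_cancel_left₀ _ ha0, hξ]
        exact if_neg hj
    · have hkA : k ∉ A := fun hkA => by
        obtain ⟨j, -, hj⟩ := (hmemA k).1 hkA
        exact hk ⟨j, hj.symm⟩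
      rw [he0 k hkA]
      exact h3 k fun j hj => hk ⟨j, hj⟩
  refine ⟨q, ψ, A, ι j₀, True, w', toricInv A (ι j₀) z, hqp, hqψ, hchart, hψq ▸ hpair, ?_,
    toric_toricInv hnot fun _ => hz₀⟩
  funext k
  by_cases hkA : k ∈ A
  · simp [toricWeight, hw', hkA, hnot]
  · simp [toricWeight, hw', hkA]

/-- Every test pair comes from a test pair in a chart of the blowing-up. -/
lemma IsCombinatorialBlowup.exists_lift [Finite I]
    [IsManifold 𝓘(ℂ, Fin n → ℂ) ω M] [IsManifold 𝓘(ℂ, Fin n → ℂ) ω M']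
    (hE : IsStrongNormalCrossings n E) (hJ : J.Nonempty) (hπ : IsCombinatorialBlowup n E J π)
    (k : Fin n) (p : M) : ∃ c : AdaptedCoords n E p, ∀ w z, TestPair c.divisorIdx 0 w z →
    ∃ (q : M') (φ' : OpenPartialHomeomorph M' (Fin n → ℂ)) (A : Finset (Fin n)) (k₀ : Fin n)
      (P : Prop) (w' : Fin n → ℝ) (z' : Fin n → ℂ), π q = p ∧ q ∈ φ'.source ∧
      IsBlowupChart c J π φ' A k₀ P ∧ TestPair c.divisorIdx (φ' q) w' z' ∧
      toricWeight A k₀ w' = w ∧ toric A k₀ z' = z := by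
  by_cases hp : p ∈ stratumClosure E J
  · obtain ⟨c, hc⟩ := hπ.over_center p hp
    exact ⟨c, fun w z h => hc.exists_lift hp hJ h⟩
  · obtain ⟨c⟩ := hE.exists_adapted p
    refine ⟨c, fun w z h => ?_⟩
    obtain ⟨q, -, rfl⟩ := hπ.bijOn_compl.surjOn hp
    obtain ⟨φ', hq, hφ'⟩ := hπ.exists_isBlowupChart_of_notMem c hp c.mem_source k
    refine ⟨q, φ', ∅, k, False, w, z, rfl, hq, hφ', ?_, ?_, ?_⟩
    · have := hφ'.apply_eq q hq
      rw [c.chart_center] at this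
      have h0 : φ' q = 0 := by
        funext l
        have := congrFun this l
        simpa [toric] using this.symm
      rwa [h0]
    · funext l
      simp [toricWeight]
    · funext l
      simp [toric]

end Lift

/-! ### Local equations of divisor components -/

section LocalEquation

variable {n : ℕ} {M I : Type*} [TopologicalSpace M] [ChartedSpace (Fin n → ℂ) M]
  {E : I → Set M} {q : M} {φ : OpenPartialHomeomorph M (Fin n → ℂ)} {X : Finset (Fin n)}
  {idx : StratumIndex E q ↪ Fin n}

/-- In a logarithmic chart, a local equation of a component is a coordinate times a unit. -/
lemma IsLogChart.exists_eq_mon_mul (h : IsLogChart E q φ X idx) {o : I} {t : M → ℂ}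
    (ht : IsLocalEquation n (E o) q t) : ∃ (μ : Fin n → ℕ) (u : (Fin n → ℂ) → ℂ),
      (∀ i ∉ X, μ i = 0) ∧ AnalyticAt ℂ u (φ q) ∧ u (φ q) ≠ 0 ∧
      ∀ᶠ z in 𝓝 (φ q), t (φ.symm z) = mon z μ * u z := by
  have hT := analyticAt_comp_symm h.chart_mem ht.holomorphic h.mem_source
  by_cases hq : q ∈ E o
  swap
  -- Off the component the local equation is itself a unit, and the monomial is trivial.
  · refine ⟨0, _, fun _ _ => rfl, hT, ?_, Eventually.of_forall fun z => ?_⟩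
    · rw [φ.left_inv h.mem_source]
      exact fun h0 => hq (ht.zero_iff.self_of_nhds.2 h0)
    · rw [mon_zero_right, one_mul]
  set k := idx ⟨o, hq⟩ with hk
  have hkX := (h.mem_range k).1 ⟨_, rfl⟩
  obtain ⟨g, hg, hTg⟩ := exists_eq_coord_mul hT hkX.2 (by
    filter_upwards [(tendsto_symm h.mem_source).eventually (ht.zero_iff.and (h.mem_iff ⟨o, hq⟩)),
      eventually_mem_target h.mem_source] with z hz hzt hz0
    rw [φ.right_inv hzt] at hz
    exact hz.1.1 (hz.2.2 hz0))
  refine ⟨Pi.single k 1, g, fun i hi => ?_, hg, fun hg0 => ?_, ?_⟩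
  · have hik : i ≠ k := fun hik => hi (by rw [hik]; exact hkX.1)
    exact Pi.single_eq_of_ne hik _
  -- If both the coordinate and the cofactor vanished at `q`, their product would have zero
  -- differential there, contrary to the equation being reduced.
  · refine ht.differential_ne_zero hq ?_
    have h1 : HasFDerivAt (fun z : Fin n → ℂ => z k * g z) (0 : (Fin n → ℂ) →L[ℂ] ℂ) (φ q) :=
      ((hasFDerivAt_coord k (φ q)).mul hg.differentiableAt.hasFDerivAt).congr_fderiv (by
        rw [hkX.2, hg0]
        ext v
        exact (congrArg₂ (fun a b : ℂ => a + b) (zero_mul _) (zero_mul _)).trans (add_zero _))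
    have h2 : HasFDerivAt (fun z => t (φ.symm z)) (0 : (Fin n → ℂ) →L[ℂ] ℂ) (φ q) :=
      h1.congr_of_eventuallyEq hTg
    have h3 : t =ᶠ[𝓝 q] (fun z => t (φ.symm z)) ∘ φ := by
      filter_upwards [φ.open_source.mem_nhds h.mem_source] with r hr
      rw [Function.comp_apply, φ.left_inv hr]
    have h4 := (contMDiffAt_chart h.chart_mem h.mem_source).mdifferentiableAt (by simp)
    rw [differential, h3.mfderiv_eq, mfderiv_comp q h2.differentiableAt.mdifferentiableAt h4,
      mfderiv_eq_fderiv, h2.fderiv]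
    exact ContinuousLinearMap.zero_comp _
  · simpa only [mon_single] using hTg

/-- The Harnack property is not affected by a power of a local equation of a component. -/
lemma IsLogChart.harnackIn_iff_of_eq_smul (h : IsLogChart E q φ X idx) {o : I} {t : M → ℂ}
    (ht : IsLocalEquation n (E o) q t) {m : ℕ} {α β : OneForm n M}
    (hβ : ∀ᶠ r in 𝓝 q, β r = t r ^ m • α r) : HarnackIn X φ q β ↔ HarnackIn X φ q α := by
  obtain ⟨μ, u, hμ, hu, hu0, htu⟩ := h.exists_eq_mon_mul ht
  have hc := eventually_coeff_smul (h := fun r => t r ^ m) h.mem_source hβ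
  have heq : ∀ᶠ z in 𝓝 (φ q),
      ‖mon z (m • μ) * u z ^ m‖ * logNorm X φ α z = logNorm X φ β z := by
    filter_upwards [hc, htu] with z hz hzt
    have hm : mon z (m • μ) * u z ^ m = t (φ.symm z) ^ m := by
      rw [hzt, mul_pow, mon, mon, ← Finset.prod_pow]
      simp [← pow_mul, mul_comm]
    rw [hm, logNorm, logNorm, ← norm_smul]
    congr 1
    funext k
    simp only [Pi.smul_apply, smul_eq_mul, logCoeff, hz k]
    ring
  have hiff := fun w z₀ (hp : TestPair X (φ q) w z₀) =>
    harnack_mon_mul_iff hp (μ := m • μ) (u := fun z => u z ^ m) (fun i hi => by simp [hμ i hi])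
      (hu.continuousAt.pow m) (pow_ne_zero m hu0) (logNorm_nonneg X φ α)
  constructor
  · intro H w z₀ hp
    exact (hiff w z₀ hp).1 (Harnack.congr hp heq (H w z₀ hp))
  · intro H w z₀ hp
    exact Harnack.congr hp (heq.mono fun z hz => hz.symm) ((hiff w z₀ hp).2 (H w z₀ hp))

end LocalEquation

/-- Newton non-degeneracy is stable under combinatorial blowing-up. -/
theorem newtonNondegenerate_iff_transform {n : ℕ} {M M' I : Type*} [Fintype I]
    [TopologicalSpace M] [ChartedSpace (Fin n → ℂ) M]
    [IsManifold 𝓘(ℂ, Fin n → ℂ) ω M]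
    [TopologicalSpace M'] [ChartedSpace (Fin n → ℂ) M']
    [IsManifold 𝓘(ℂ, Fin n → ℂ) ω M']
    (E : I → Set M) (hE : IsStrongNormalCrossings n E)
    (F : Foliation n M)
    (J : Set I) (hJ : J.Nonempty)
    (π : M' → M) (hπ : IsCombinatorialBlowup n E J π)
    (F' : Foliation n M') (hF' : IsTransform E J π F F') :
    NewtonNondegenerate E F ↔
      NewtonNondegenerate (transformDivisor E J π) F' := by
  -- A family without common factor has a non-zero member, so the dimension is positive; the index
  -- is only the dummy `k₀` of the charts off the center.
  have hk : ∀ p, Nonempty (Fin n) := fun p => by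
    obtain ⟨α, hα⟩ := F.exists_isGenerator p
    obtain ⟨φ, hφ, hp, -⟩ := F.locally_generated p
    obtain ⟨k, -⟩ := (hα.coeff hφ hp).2.exists_ne_zero
    exact ⟨k⟩
  -- Upstairs the condition is read on the plain pull-back of a generator, since the exceptional
  -- factor `t ^ m` is harmless.
  have key : ∀ {p q α φ' A k₀ P} {c : AdaptedCoords n E p}, F.IsGenerator (π q) α →
      q ∈ φ'.source → IsBlowupChart c J π φ' A k₀ P →
      (NewtonNondegenerateAt (transformDivisor E J π) F' q ↔
        HarnackIn c.divisorIdx φ' q (pullback π α)) := by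
    intro p q α φ' A k₀ P c hα hq h
    obtain ⟨t, m, α', ht, hα', heq⟩ := hF' q α hα
    obtain ⟨idx, hidx⟩ := h.exists_isLogChart hq
    rw [newtonNondegenerateAt_iff hα' hidx,
      hidx.harnackIn_iff_of_eq_smul (o := none) ht heq]
  constructor
  · intro H q
    obtain ⟨k⟩ := hk (π q)
    obtain ⟨α, hα⟩ := F.exists_isGenerator (π q)
    obtain ⟨c, φ', A, k₀, P, hq, h⟩ := hπ.exists_isBlowupChart hE k q
    exact (key hα hq h).2 (h.harnackIn_pullback hπ.holomorphic hq
      ((newtonNondegenerateAt_iff hα c.isLogChart).1 (H (π q))))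
  · intro H p
    obtain ⟨k⟩ := hk p
    obtain ⟨α, hα⟩ := F.exists_isGenerator p
    obtain ⟨c, hc⟩ := hπ.exists_lift hE hJ k p
    refine (newtonNondegenerateAt_iff hα c.isLogChart).2 fun w z hp => ?_
    rw [c.chart_center] at hp
    obtain ⟨q, φ', A, k₀, P, w', z', rfl, hq, h, hp', rfl, rfl⟩ := hc w z hp
    exact (h.harnack_iff hπ.holomorphic α hq hp').1 ((key hα hq h).1 (H q) w' z' hp')

end NewtonFoliation

end

theorem proposition1 {n : ℕ} {M M' I : Type*} [Fintype I]
    [TopologicalSpace M] [T2Space M] [ChartedSpace (Fin n → ℂ) M]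
    [IsManifold 𝓘(ℂ, Fin n → ℂ) ω M]
    [TopologicalSpace M'] [T2Space M'] [ChartedSpace (Fin n → ℂ) M']
    [IsManifold 𝓘(ℂ, Fin n → ℂ) ω M']
    (E : I → Set M) (hE : NewtonFoliation.IsStrongNormalCrossings n E)
    (F : NewtonFoliation.Foliation n M)
    (J : Set I) (hJ : J.Nonempty)
    (π : M' → M) (hπ : NewtonFoliation.IsCombinatorialBlowup n E J π)
    (F' : NewtonFoliation.Foliation n M') (hF' : NewtonFoliation.IsTransform E J π F F') :
    NewtonFoliation.NewtonNondegenerate E F ↔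
      NewtonFoliation.NewtonNondegenerate (NewtonFoliation.transformDivisor E J π) F' :=
  NewtonFoliation.newtonNondegenerate_iff_transform E hE F J hJ π hπ F' hF'
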